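/- Let $M$ be a smooth manifold with a flat torsion-free connection $\nabla$ and a Riemannian metric $\langle\cdot,\cdot\rangle$. Let $D$ be the Levi-Civita connection of $\langle\cdot,\cdot\rangle$, let $\gamma_XY=D_XY-\nabla_XY$, and let $\gamma^*$ be defined by $\langle\gamma^*_XY,Z\rangle=\langle Y,\gamma_XZ\rangle$. For a $TM$-valued bilinear tensor field $A$ on $M$ (written $A(X,Y)=A_XY$) put $\mathrm{tr}_{\langle\cdot,\cdot\rangle}(A)=\sum_i A(E_i,E_i)$, where $(E_i)$ is a local orthonormal frame, and $D_X(A)(Y,Z)=D_X(A(Y,Z))-A(D_XY,Z)-A(Y,D_XZ)$. Equip the tangent bundle $TM$ with the Hermitian structure $(J_1,g_1)$ given, in terms of the vertical lifts $X^v$ and the $\nabla$-horizontal lifts $X^h$ of vector fields $X$ on $M$, and of the projection $\pi:TM\to M$, by $J_1X^h=X^v$, $J_1X^v=-X^h$, $g_1(X^h,Y^h)=g_1(X^v,Y^v)=\langle X,Y\rangle\circ\pi$ and $g_1(X^h,Y^v)=0$. Let $\omega=g_1(J_1\cdot,\cdot)$, and let $\nabla^{LC}$ be the Levi-Civita connection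 of $g_1$. The Bismut connection $\nabla^B$ and the Chern connection $\nabla^C$ of $(TM,J_1,g_1)$ are given by $$g_1(\nabla^B_UV,W)=g_1(\nabla^{LC}_UV,W)+\tfrac12 d\omega(J_1U,J_1V,J_1W),\qquad g_1(\nabla^C_UV,W)=g_1(\nabla^{LC}_UV,W)-\tfrac12 d\omega(J_1U,V,W).$$ For $\tau\in\{B,C\}$ let $R^\tau(U,V)=\nabla^\tau_{[U,V]}-\nabla^\tau_U\nabla^\tau_V+\nabla^\tau_V\nabla^\tau_U$, and let $\rho^\tau(U,V)=\frac12\sum_i g_1(R^\tau(U,V)F_i,J_1F_i)$ be the Ricci form, where $(F_i)$ is a local $g_1$-orthonormal frame of $T(TM)$. Then: 1. If $\mathrm{tr}_{\langle\cdot,\cdot\rangle}(\gamma)=0$, then $\mathrm{tr}_{\langle\cdot,\cdot\rangle}(D_X(\gamma))=0$ for every smooth vector field $X$ on $M$, and $(TM,J_1,g_1)$ is Calabi–Yau with torsion, i.e. $\rho^B=0$. 2. If $\mathrm{tr}_{\langle\cdot,\cdot\rangle}(\gamma^*)=0$, then $\mathrm{tr}_{\langle\cdot,\cdot\rangle}(D_X(\gamma^*))=0$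 for every smooth vector field $X$ on $M$, and the Chern Ricci form vanishes: $\rho^C=0$. -/

import Mathlib

open Bundle Module
open scoped Manifold ContDiff

set_option linter.unusedSectionVars false

noncomputable section

namespace AffineRiemann

/-! ### Calculus of vector fields on a manifold with a Riemannian metric -/

section General

variable {E : Type*} [NormedAddCommGroup E] [NormedSpace ℝ E] [FiniteDimensional ℝ E]
  {H : Type*} [TopologicalSpace H] {I : ModelWithCorners ℝ E H}
  {M : Type*} [TopologicalSpace M] [ChartedSpace H M] [IsManifold I ∞ M]

/-- (Not necessarily smooth) vector fields. -/
abbrev VField (I : ModelWithCorners ℝ E H) (M : Type*) [TopologicalSpace M] [ChartedSpace H M] :=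
  (x : M) → TangentSpace I x

/-- Smoothness of a vector field: `X ∈ Γ(TM)`. -/
def IsSmoothField (X : VField I M) : Prop :=
  ContMDiff I I.tangent ∞ (fun x => (⟨x, X x⟩ : TangentBundle I M))

/-- A vector field which is smooth near `x`, with value `v` at `x`. -/
def ext {x : M} (v : TangentSpace I x) : VField I M := FiberBundle.extend E v

/-- `X · f`, the derivative of the function `f` along the vector field `X`. -/
def along (X : VField I M) (f : M → ℝ) (x : M) : ℝ := mvfderiv I f x (X x)

/-- The Lie bracket of vector fields. -/
def bracket (X Y : VField I M) : VField I M := VectorField.mlieBracket I X Y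

/-- The function `⟨X, Y⟩`. -/
def pairing (G : RiemannianMetric (TangentSpace I : M → Type _)) (X Y : VField I M) (x : M) : ℝ :=
  G.inner x (X x) (Y x)

/-- An orthonormal basis of the tangent space at `x`. -/
def orthoBasis (G : RiemannianMetric (TangentSpace I : M → Type _)) (x : M) :
    Basis (Fin (finrank ℝ E)) ℝ (TangentSpace I x) :=
  letI : RiemannianBundle (TangentSpace I : M → Type _) := ⟨G⟩
  haveI : FiniteDimensional ℝ (TangentSpace I x) := inferInstanceAs (FiniteDimensional ℝ E)
  (stdOrthonormalBasis ℝ (TangentSpace I x)).toBasis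

theorem orthoBasis_orthonormal (G : RiemannianMetric (TangentSpace I : M → Type _)) (x : M)
    (i j : Fin (finrank ℝ E)) :
    G.inner x (orthoBasis G x i) (orthoBasis G x j) = if i = j then 1 else 0 := by
  let : RiemannianBundle (TangentSpace I : M → Type _) := ⟨G⟩
  have : FiniteDimensional ℝ (TangentSpace I x) := inferInstanceAs (FiniteDimensional ℝ E)
  have h := orthonormal_iff_ite.1 (stdOrthonormalBasis ℝ (TangentSpace I x)).orthonormal i j
  simpa [orthoBasis] using! h

/-- For a linear form `φ` on the tangent space at `x`, the vector `w` with `⟨w, z⟩ = φ z`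
for all `z`. -/
def sharp (G : RiemannianMetric (TangentSpace I : M → Type _)) (x : M)
    (φ : TangentSpace I x → ℝ) : TangentSpace I x :=
  ∑ i, φ (orthoBasis G x i) • orthoBasis G x i

theorem inner_sharp (G : RiemannianMetric (TangentSpace I : M → Type _)) (x : M)
    (φ : TangentSpace I x →ₗ[ℝ] ℝ) (z : TangentSpace I x) :
    G.inner x (sharp G x φ) z = φ z := by
  have h : ((G.inner x (sharp G x φ) : TangentSpace I x →L[ℝ] ℝ) : TangentSpace I x →ₗ[ℝ] ℝ)
      = φ := by
    refine (orthoBasis G x).ext fun j => ?_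
    simp [sharp, orthoBasis_orthonormal]
  exact DFunLike.congr_fun h z

/-- The trace `tr_⟨,⟩ (A) = ∑ A(E_i, E_i)`, `(E_i)` orthonormal, of a tensorial operation `A` on
pairs of vector fields. -/
def metricTrace (G : RiemannianMetric (TangentSpace I : M → Type _))
    (A : VField I M → VField I M → VField I M) : VField I M :=
  fun x => ∑ i, A (ext (orthoBasis G x i)) (ext (orthoBasis G x i)) x

/-- The Koszul expression, which equals `2 ⟨D_X Y, Z⟩` for the Levi-Civita connection `D`. -/
def koszul (G : RiemannianMetric (TangentSpace I : M → Type _)) (X Y Z : VField I M) (x : M) : ℝ :=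
  along X (pairing G Y Z) x + along Y (pairing G X Z) x - along Z (pairing G X Y) x
    + pairing G (bracket X Y) Z x - pairing G (bracket X Z) Y x - pairing G (bracket Y Z) X x

/-- The Levi-Civita connection `(X, Y) ↦ D_X Y`. -/
def leviCivita (G : RiemannianMetric (TangentSpace I : M → Type _)) (X Y : VField I M) :
    VField I M :=
  fun x => sharp G x fun z => 1 / 2 * koszul G X Y (ext z) x

/-- The curvature `R(X, Y) Z = ∇_[X,Y] Z - ∇_X ∇_Y Z + ∇_Y ∇_X Z` of a connection
`(X, Y) ↦ ∇_X Y`. -/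
def curvature (nab : VField I M → VField I M → VField I M) (X Y Z : VField I M) : VField I M :=
  nab (bracket X Y) Z - nab X (nab Y Z) + nab Y (nab X Z)

/-- The derivative `D_X (A) (Y, Z) = D_X (A(Y, Z)) - A(D_X Y, Z) - A(Y, D_X Z)` with respect to the
Levi-Civita connection of a tensorial operation `A`. -/
def covDeriv (G : RiemannianMetric (TangentSpace I : M → Type _)) (X : VField I M)
    (A : VField I M → VField I M → VField I M) (Y Z : VField I M) : VField I M :=
  leviCivita G X (A Y Z) - A (leviCivita G X Y) Z - A Y (leviCivita G X Z)

/-- A field of endomorphisms applied to a vector field. -/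
def app (J : (x : M) → TangentSpace I x →L[ℝ] TangentSpace I x) (X : VField I M) : VField I M :=
  fun x => J x (X x)

/-- The function `ω(X, Y) = g(J X, Y)`, where `ω` is the fundamental form. -/
def fundForm (G : RiemannianMetric (TangentSpace I : M → Type _))
    (J : (x : M) → TangentSpace I x →L[ℝ] TangentSpace I x) (X Y : VField I M) : M → ℝ :=
  pairing G (app J X) Y

/-- The function `dω(X, Y, Z)`, where `ω` is the fundamental form. -/
def dFundForm (G : RiemannianMetric (TangentSpace I : M → Type _))
    (J : (x : M) → TangentSpace I x →L[ℝ] TangentSpace I x) (X Y Z : VField I M) (x : M) : ℝ :=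
  along X (fundForm G J Y Z) x - along Y (fundForm G J X Z) x + along Z (fundForm G J X Y) x
    - fundForm G J (bracket X Y) Z x + fundForm G J (bracket X Z) Y x
    - fundForm G J (bracket Y Z) X x

/-- The Bismut connection:
`g(∇ᴮ_X Y, Z) = g(∇ᴸᶜ_X Y, Z) + 1/2 dω(JX, JY, JZ)`. -/
def bismut (G : RiemannianMetric (TangentSpace I : M → Type _))
    (J : (x : M) → TangentSpace I x →L[ℝ] TangentSpace I x) (X Y : VField I M) : VField I M :=
  fun x => sharp G x fun z => G.inner x (leviCivita G X Y x) z
    + 1 / 2 * dFundForm G J (app J X) (app J Y) (app J (ext z)) x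

/-- The Chern connection:
`g(∇ᶜ_X Y, Z) = g(∇ᴸᶜ_X Y, Z) - 1/2 dω(JX, Y, Z)`. -/
def chern (G : RiemannianMetric (TangentSpace I : M → Type _))
    (J : (x : M) → TangentSpace I x →L[ℝ] TangentSpace I x) (X Y : VField I M) : VField I M :=
  fun x => sharp G x fun z => G.inner x (leviCivita G X Y x) z
    - 1 / 2 * dFundForm G J (app J X) Y (ext z) x

/-- The Ricci form `ρ(X, Y) = 1/2 ∑ g(R(X, Y) E_i, J E_i)`, `(E_i)` orthonormal, of a
connection. -/
def ricciForm (G : RiemannianMetric (TangentSpace I : M → Type _))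
    (J : (x : M) → TangentSpace I x →L[ℝ] TangentSpace I x)
    (nab : VField I M → VField I M → VField I M) (X Y : VField I M) (x : M) : ℝ :=
  1 / 2 * ∑ i, G.inner x (curvature nab X Y (ext (orthoBasis G x i)) x) (J x (orthoBasis G x i))

end General

/-! ### Affine-Riemann manifolds -/

section AffineRiemannManifold

variable {E : Type*} [NormedAddCommGroup E] [NormedSpace ℝ E] [FiniteDimensional ℝ E]
  {M : Type*} [TopologicalSpace M] [ChartedSpace E M] [IsManifold 𝓘(ℝ, E) ∞ M]

/-- A covariant derivative as the operation `(X, Y) ↦ ∇_X Y` on vector fields. -/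
def conn (nab : CovariantDerivative 𝓘(ℝ, E) E (TangentSpace 𝓘(ℝ, E) : M → Type _))
    (X Y : VField 𝓘(ℝ, E) M) : VField 𝓘(ℝ, E) M :=
  fun x => nab Y x (X x)

/-- Vanishing of the curvature. -/
def IsFlat (nab : CovariantDerivative 𝓘(ℝ, E) E (TangentSpace 𝓘(ℝ, E) : M → Type _)) : Prop :=
  ∀ X Y Z : VField 𝓘(ℝ, E) M, IsSmoothField X → IsSmoothField Y → IsSmoothField Z →
    curvature (conn nab) X Y Z = 0

/-- The difference tensor `γ_X Y = D_X Y - ∇_X Y`. -/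
def gam (nab : CovariantDerivative 𝓘(ℝ, E) E (TangentSpace 𝓘(ℝ, E) : M → Type _))
    (G : RiemannianMetric (TangentSpace 𝓘(ℝ, E) : M → Type _)) (X Y : VField 𝓘(ℝ, E) M) :
    VField 𝓘(ℝ, E) M :=
  leviCivita G X Y - conn nab X Y

/-- The adjoint of the difference tensor: `⟨γ*_X Y, Z⟩ = ⟨Y, γ_X Z⟩`. -/
def gamStar (nab : CovariantDerivative 𝓘(ℝ, E) E (TangentSpace 𝓘(ℝ, E) : M → Type _))
    (G : RiemannianMetric (TangentSpace 𝓘(ℝ, E) : M → Type _)) (X Y : VField 𝓘(ℝ, E) M) :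
    VField 𝓘(ℝ, E) M :=
  fun x => sharp G x fun z => G.inner x (Y x) (gam nab G X (ext z) x)

/-! ### The Hermitian structure of the tangent bundle -/

/-- The differential at `p` of the projection `TM → M`. -/
def dproj (p : TangentBundle 𝓘(ℝ, E) M) :
    TangentSpace 𝓘(ℝ, E).tangent p →L[ℝ] TangentSpace 𝓘(ℝ, E) p.proj :=
  mfderiv 𝓘(ℝ, E).tangent 𝓘(ℝ, E) (fun q : TangentBundle 𝓘(ℝ, E) M => q.proj) p

/-- The vertical lift at `p = (x, u)`: the differential at `u` of the inclusion of the fiber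
`T_x M` in `TM`, so that `w` is sent to the velocity of `t ↦ (x, u + t w)` at `t = 0`. -/
def vLift (p : TangentBundle 𝓘(ℝ, E) M) :
    TangentSpace 𝓘(ℝ, E) p.proj →L[ℝ] TangentSpace 𝓘(ℝ, E).tangent p :=
  mfderiv 𝓘(ℝ, E) 𝓘(ℝ, E).tangent (fun w : E => (⟨p.proj, w⟩ : TangentBundle 𝓘(ℝ, E) M)) p.snd

/-- The horizontal lift at `p = (x, u)`: for a local section `σ` of `TM` with `σ(x) = u`, it sends
`v` to `dσ(v)` minus the vertical lift of `∇_v σ`. -/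
def hLift (nab : CovariantDerivative 𝓘(ℝ, E) E (TangentSpace 𝓘(ℝ, E) : M → Type _))
    (p : TangentBundle 𝓘(ℝ, E) M) :
    TangentSpace 𝓘(ℝ, E) p.proj →L[ℝ] TangentSpace 𝓘(ℝ, E).tangent p :=
  letI dsigma : TangentSpace 𝓘(ℝ, E) p.proj →L[ℝ] TangentSpace 𝓘(ℝ, E).tangent p :=
    mfderiv 𝓘(ℝ, E) 𝓘(ℝ, E).tangent
      (fun y => (⟨y, ext (I := 𝓘(ℝ, E)) p.snd y⟩ : TangentBundle 𝓘(ℝ, E) M)) p.proj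
  dsigma - (vLift p).comp (nab (ext (I := 𝓘(ℝ, E)) p.snd) p.proj)

theorem trivializationAt_fiber (x : M) (w : E) :
    (trivializationAt E (TangentSpace 𝓘(ℝ, E)) x (⟨x, w⟩ : TangentBundle 𝓘(ℝ, E) M)).2 = w :=
  (tangentBundleCore 𝓘(ℝ, E) M).coordChange_self (achart E x) x (mem_chart_source E x) w

theorem mdifferentiable_fiber (x : M) :
    MDifferentiable 𝓘(ℝ, E) 𝓘(ℝ, E).tangent
      (fun w : E => (⟨x, w⟩ : TangentBundle 𝓘(ℝ, E) M)) := by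
  intro w
  rw [mdifferentiableAt_totalSpace]
  refine ⟨mdifferentiableAt_const, ?_⟩
  simp only [trivializationAt_fiber]
  exact mdifferentiableAt_id

theorem dproj_vLift (p : TangentBundle 𝓘(ℝ, E) M) (w : TangentSpace 𝓘(ℝ, E) p.proj) :
    dproj p (vLift p w) = 0 := by
  obtain ⟨x, u⟩ := p
  change E at u
  have h := mfderiv_comp (I := 𝓘(ℝ, E)) (I' := 𝓘(ℝ, E).tangent) (I'' := 𝓘(ℝ, E))
    (f := fun w : E => (⟨x, w⟩ : TangentBundle 𝓘(ℝ, E) M))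
    (g := fun q : TangentBundle 𝓘(ℝ, E) M => q.proj) u
    (mdifferentiableAt_proj _) (mdifferentiable_fiber x u)
  have h2 : mfderiv 𝓘(ℝ, E) 𝓘(ℝ, E) ((fun q : TangentBundle 𝓘(ℝ, E) M => q.proj) ∘
     fun w : E => (⟨x, w⟩ : TangentBundle 𝓘(ℝ, E) M)) u = 0 := mfderiv_const
  rw [h2] at h
  exact (DFunLike.congr_fun h w).symm

theorem dproj_hLift (nab : CovariantDerivative 𝓘(ℝ, E) E (TangentSpace 𝓘(ℝ, E) : M → Type _))
    (p : TangentBundle 𝓘(ℝ, E) M) (v : TangentSpace 𝓘(ℝ, E) p.proj) :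
    dproj p (hLift nab p v) = v := by
  have hs : MDifferentiableAt 𝓘(ℝ, E) 𝓘(ℝ, E).tangent
      (fun y => (⟨y, ext (I := 𝓘(ℝ, E)) p.snd y⟩ : TangentBundle 𝓘(ℝ, E) M)) p.proj :=
    FiberBundle.mdifferentiableAt_extend ..
  have h := mfderiv_comp (I := 𝓘(ℝ, E)) (I' := 𝓘(ℝ, E).tangent) (I'' := 𝓘(ℝ, E))
    (f := fun y => (⟨y, ext (I := 𝓘(ℝ, E)) p.snd y⟩ : TangentBundle 𝓘(ℝ, E) M))
    (g := fun q : TangentBundle 𝓘(ℝ, E) M => q.proj) p.proj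
    (mdifferentiableAt_proj _) hs
  have h2 : mfderiv 𝓘(ℝ, E) 𝓘(ℝ, E) ((fun q : TangentBundle 𝓘(ℝ, E) M => q.proj) ∘
      fun y => (⟨y, ext (I := 𝓘(ℝ, E)) p.snd y⟩ : TangentBundle 𝓘(ℝ, E) M)) p.proj
      = ContinuousLinearMap.id ℝ _ := mfderiv_id
  rw [h2] at h
  have hp : (⟨p.proj, ext (I := 𝓘(ℝ, E)) p.snd p.proj⟩ : TangentBundle 𝓘(ℝ, E) M) = p := by
    simp [ext]
  have key : ∀ q : TangentBundle 𝓘(ℝ, E) M, q = p → ∀ ξ : E × E,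
      (mfderiv 𝓘(ℝ, E).tangent 𝓘(ℝ, E) (fun q : TangentBundle 𝓘(ℝ, E) M => q.proj) q ξ : E)
        = dproj p ξ := by
    rintro q rfl ξ
    rfl
  refine (map_sub (dproj p) _ _).trans ?_
  have h4 := dproj_vLift p (nab (ext (I := 𝓘(ℝ, E)) p.snd) p.proj v)
  refine (congrArg₂ _ ((key _ hp _).symm.trans (DFunLike.congr_fun h v).symm) h4).trans ?_
  exact sub_zero _

theorem vLift_injective (p : TangentBundle 𝓘(ℝ, E) M) : Function.Injective (vLift p) := by
  obtain ⟨x, u⟩ := p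
  change E at u
  have hp : (⟨x, u⟩ : TangentBundle 𝓘(ℝ, E) M) ∈
      (trivializationAt E (TangentSpace 𝓘(ℝ, E)) x).source := by
    simp
  have hg : MDifferentiableAt 𝓘(ℝ, E).tangent 𝓘(ℝ, E) (fun q : TangentBundle 𝓘(ℝ, E) M =>
      (trivializationAt E (TangentSpace 𝓘(ℝ, E)) x q).2) (⟨x, u⟩ : TangentBundle 𝓘(ℝ, E) M) := by
    have h1 := ((mdifferentiableAt_totalSpace (IM := 𝓘(ℝ, E).tangent) (IB := 𝓘(ℝ, E)) (F := E)
      (E := (TangentSpace 𝓘(ℝ, E) : M → Type _))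
      (f := (id : TangentBundle 𝓘(ℝ, E) M → TangentBundle 𝓘(ℝ, E) M))
      (x₀ := (⟨x, u⟩ : TangentBundle 𝓘(ℝ, E) M))).1 mdifferentiableAt_id).2
    exact h1
  have h := mfderiv_comp (I := 𝓘(ℝ, E)) (I' := 𝓘(ℝ, E).tangent) (I'' := 𝓘(ℝ, E))
    (f := fun w : E => (⟨x, w⟩ : TangentBundle 𝓘(ℝ, E) M))
    (g := fun q : TangentBundle 𝓘(ℝ, E) M =>
      (trivializationAt E (TangentSpace 𝓘(ℝ, E)) x q).2) u hg
    (mdifferentiable_fiber x u)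
  have h2 : mfderiv 𝓘(ℝ, E) 𝓘(ℝ, E) ((fun q : TangentBundle 𝓘(ℝ, E) M =>
      (trivializationAt E (TangentSpace 𝓘(ℝ, E)) x q).2) ∘
      fun w : E => (⟨x, w⟩ : TangentBundle 𝓘(ℝ, E) M)) u
      = ContinuousLinearMap.id ℝ _ := by
    have : ((fun q : TangentBundle 𝓘(ℝ, E) M =>
      (trivializationAt E (TangentSpace 𝓘(ℝ, E)) x q).2) ∘
      fun w : E => (⟨x, w⟩ : TangentBundle 𝓘(ℝ, E) M)) = id := by
      funext w
      exact trivializationAt_fiber x w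
    rw [this]
    exact mfderiv_id
  rw [h2] at h
  intro w w' hw
  have h3 := DFunLike.congr_fun h w
  have h4 := DFunLike.congr_fun h w'
  refine h3.trans (Eq.trans ?_ h4.symm)
  exact congrArg (mfderiv 𝓘(ℝ, E).tangent 𝓘(ℝ, E) (fun q : TangentBundle 𝓘(ℝ, E) M =>
      (trivializationAt E (TangentSpace 𝓘(ℝ, E)) x q).2) ⟨x, u⟩) hw

/-- The splitting `T_x M × T_x M ≃ T_p (TM)`, `(v, w) ↦ v^h + w^v`, at `p = (x, u)`. -/
def split (nab : CovariantDerivative 𝓘(ℝ, E) E (TangentSpace 𝓘(ℝ, E) : M → Type _))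
    (p : TangentBundle 𝓘(ℝ, E) M) :
    (TangentSpace 𝓘(ℝ, E) p.proj × TangentSpace 𝓘(ℝ, E) p.proj) ≃L[ℝ]
      TangentSpace 𝓘(ℝ, E).tangent p :=
  haveI : FiniteDimensional ℝ (TangentSpace 𝓘(ℝ, E) p.proj) :=
    inferInstanceAs (FiniteDimensional ℝ E)
  haveI : FiniteDimensional ℝ (TangentSpace 𝓘(ℝ, E).tangent p) :=
    inferInstanceAs (FiniteDimensional ℝ (E × E))
  haveI : T2Space (TangentSpace 𝓘(ℝ, E) p.proj) := inferInstanceAs (T2Space E)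
  haveI : T2Space (TangentSpace 𝓘(ℝ, E).tangent p) := inferInstanceAs (T2Space (E × E))
  (LinearEquiv.ofBijective
    (((hLift nab p).coprod (vLift p) :
      TangentSpace 𝓘(ℝ, E) p.proj × TangentSpace 𝓘(ℝ, E) p.proj →L[ℝ]
        TangentSpace 𝓘(ℝ, E).tangent p) :
      TangentSpace 𝓘(ℝ, E) p.proj × TangentSpace 𝓘(ℝ, E) p.proj →ₗ[ℝ]
        TangentSpace 𝓘(ℝ, E).tangent p) (by
    have hinj : Function.Injective (((hLift nab p).coprod (vLift p) :
        TangentSpace 𝓘(ℝ, E) p.proj × TangentSpace 𝓘(ℝ, E) p.proj →L[ℝ]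
          TangentSpace 𝓘(ℝ, E).tangent p) :
        TangentSpace 𝓘(ℝ, E) p.proj × TangentSpace 𝓘(ℝ, E) p.proj →ₗ[ℝ]
          TangentSpace 𝓘(ℝ, E).tangent p) := by
      refine (injective_iff_map_eq_zero _).2 ?_
      rintro ⟨v, w⟩ h
      have h' : hLift nab p v + vLift p w = 0 := h
      have hv : v = 0 := by
        have := congrArg (dproj p) h'
        rwa [map_add, dproj_hLift, dproj_vLift, add_zero, map_zero] at this
      subst hv
      rw [map_zero, zero_add] at h'
      rw [vLift_injective p (h'.trans (map_zero _).symm)]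
      rfl
    refine ⟨hinj, (LinearMap.injective_iff_surjective_of_finrank_eq_finrank ?_).1 hinj⟩
    rfl)).toContinuousLinearEquiv

theorem split_apply (nab : CovariantDerivative 𝓘(ℝ, E) E (TangentSpace 𝓘(ℝ, E) : M → Type _))
    (p : TangentBundle 𝓘(ℝ, E) M) (v w : TangentSpace 𝓘(ℝ, E) p.proj) :
    split nab p (v, w) = hLift nab p v + vLift p w := rfl

/-- The horizontal component of a tangent vector of `TM`. -/
def hPart (nab : CovariantDerivative 𝓘(ℝ, E) E (TangentSpace 𝓘(ℝ, E) : M → Type _))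
    (p : TangentBundle 𝓘(ℝ, E) M) :
    TangentSpace 𝓘(ℝ, E).tangent p →L[ℝ] TangentSpace 𝓘(ℝ, E) p.proj :=
  (ContinuousLinearMap.fst ℝ _ _).comp (split nab p).symm.toContinuousLinearMap

/-- The vertical component of a tangent vector of `TM`, that is, the connection map of `∇`. -/
def vPart (nab : CovariantDerivative 𝓘(ℝ, E) E (TangentSpace 𝓘(ℝ, E) : M → Type _))
    (p : TangentBundle 𝓘(ℝ, E) M) :
    TangentSpace 𝓘(ℝ, E).tangent p →L[ℝ] TangentSpace 𝓘(ℝ, E) p.proj :=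
  (ContinuousLinearMap.snd ℝ _ _).comp (split nab p).symm.toContinuousLinearMap

/-- The complex structure of `TM`: `J X^h = X^v` and `J X^v = - X^h`. -/
def J1 (nab : CovariantDerivative 𝓘(ℝ, E) E (TangentSpace 𝓘(ℝ, E) : M → Type _))
    (p : TangentBundle 𝓘(ℝ, E) M) :
    TangentSpace 𝓘(ℝ, E).tangent p →L[ℝ] TangentSpace 𝓘(ℝ, E).tangent p :=
  (vLift p).comp (hPart nab p) - (hLift nab p).comp (vPart nab p)

/-- The bilinear form `g(X^h, Y^h) = g(X^v, Y^v) = ⟨X, Y⟩`, `g(X^h, Y^v) = 0` on `T_p (TM)`. -/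
def g1Inner (nab : CovariantDerivative 𝓘(ℝ, E) E (TangentSpace 𝓘(ℝ, E) : M → Type _))
    (G : RiemannianMetric (TangentSpace 𝓘(ℝ, E) : M → Type _)) (p : TangentBundle 𝓘(ℝ, E) M) :
    TangentSpace 𝓘(ℝ, E).tangent p →L[ℝ] TangentSpace 𝓘(ℝ, E).tangent p →L[ℝ] ℝ :=
  (ContinuousLinearMap.precomp ℝ (hPart nab p)).comp ((G.inner p.proj).comp (hPart nab p))
    + (ContinuousLinearMap.precomp ℝ (vPart nab p)).comp ((G.inner p.proj).comp (vPart nab p))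

theorem g1Inner_apply (nab : CovariantDerivative 𝓘(ℝ, E) E (TangentSpace 𝓘(ℝ, E) : M → Type _))
    (G : RiemannianMetric (TangentSpace 𝓘(ℝ, E) : M → Type _)) (p : TangentBundle 𝓘(ℝ, E) M)
    (ξ η : TangentSpace 𝓘(ℝ, E).tangent p) :
    g1Inner nab G p ξ η = G.inner p.proj (hPart nab p ξ) (hPart nab p η)
      + G.inner p.proj (vPart nab p ξ) (vPart nab p η) := rfl

theorem g1Inner_pos (nab : CovariantDerivative 𝓘(ℝ, E) E (TangentSpace 𝓘(ℝ, E) : M → Type _))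
    (G : RiemannianMetric (TangentSpace 𝓘(ℝ, E) : M → Type _)) (p : TangentBundle 𝓘(ℝ, E) M)
    (ξ : TangentSpace 𝓘(ℝ, E).tangent p) (hξ : ξ ≠ 0) : 0 < g1Inner nab G p ξ ξ := by
  have hnn : ∀ v : TangentSpace 𝓘(ℝ, E) p.proj, 0 ≤ G.inner p.proj v v := fun v => by
    rcases eq_or_ne v 0 with rfl | hv
    · simp
    · exact (G.pos _ v hv).le
  rw [g1Inner_apply]
  by_cases h : hPart nab p ξ = 0
  · have hv : vPart nab p ξ ≠ 0 := by
      intro h2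
      apply hξ
      have h0 : (split nab p).symm ξ = 0 := Prod.ext h h2
      exact (map_eq_zero_iff _ (split nab p).symm.injective).1 h0
    exact add_pos_of_nonneg_of_pos (hnn _) (G.pos _ _ hv)
  · exact add_pos_of_pos_of_nonneg (G.pos _ _ h) (hnn _)

/-- The sublevel sets of a positive definite form on a finite-dimensional space are bounded. -/
theorem isVonNBounded_of_pos {V : Type*} [NormedAddCommGroup V] [NormedSpace ℝ V]
    [FiniteDimensional ℝ V] (B : V →L[ℝ] V →L[ℝ] ℝ) (hB : ∀ v, v ≠ 0 → 0 < B v v) :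
    Bornology.IsVonNBounded ℝ {v : V | B v v < 1} := by
  have hc : Continuous fun v : V => B v v := by fun_prop
  rcases (Metric.sphere (0 : V) 1).eq_empty_or_nonempty with he | hne
  · have : Subsingleton V := by
      by_contra hn
      rw [not_subsingleton_iff_nontrivial] at hn
      exact (NormedSpace.sphere_nonempty.2 zero_le_one : (Metric.sphere (0 : V) 1).Nonempty).ne_empty
        he
    exact (NormedSpace.isVonNBounded_iff ℝ).2 (Set.toFinite _).isBounded
  · obtain ⟨v₀, hv₀, hmin⟩ := (isCompact_sphere (0 : V) 1).exists_isMinOn hne hc.continuousOn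
    have hv₀' : v₀ ≠ 0 := by
      rintro rfl
      simp at hv₀
    have hpos := hB v₀ hv₀'
    refine (NormedSpace.isVonNBounded_iff ℝ).2
      (isBounded_iff_forall_norm_le.2 ⟨1 + 1 / B v₀ v₀, fun v hv => ?_⟩)
    rcases eq_or_ne v 0 with rfl | hv0
    · rw [norm_zero]
      positivity
    have hn : 0 < ‖v‖ := norm_pos_iff.2 hv0
    have h1 : B v₀ v₀ ≤ B (‖v‖⁻¹ • v) (‖v‖⁻¹ • v) :=
      hmin (by simp [norm_smul, hn.ne'])
    have h2 : B v₀ v₀ * ‖v‖ ^ 2 ≤ B v v := by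
      simp only [map_smul, smul_apply, smul_eq_mul] at h1
      have := mul_le_mul_of_nonneg_right h1 (sq_nonneg ‖v‖)
      field_simp at this
      linarith
    have h3 : B v v < 1 := hv
    have h4 : ‖v‖ ^ 2 ≤ 1 / B v₀ v₀ := by
      rw [le_div_iff₀ hpos]
      linarith
    nlinarith [sq_nonneg (‖v‖ - 1)]

/-- The metric `g₁` of `TM`. -/
def g1 (nab : CovariantDerivative 𝓘(ℝ, E) E (TangentSpace 𝓘(ℝ, E) : M → Type _))
    (G : RiemannianMetric (TangentSpace 𝓘(ℝ, E) : M → Type _)) :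
    RiemannianMetric (TangentSpace 𝓘(ℝ, E).tangent : TangentBundle 𝓘(ℝ, E) M → Type _) where
  inner := g1Inner nab G
  symm p ξ η := by
    simp only [g1Inner_apply]
    rw [G.symm p.proj (hPart nab p ξ), G.symm p.proj (vPart nab p ξ)]
  pos := g1Inner_pos nab G
  continuousAt p := by
    let B : E × E →L[ℝ] E × E →L[ℝ] ℝ := g1Inner nab G p
    have : Continuous fun v : E × E => B v v := by fun_prop
    exact this.continuousAt
  isVonNBounded p :=
    isVonNBounded_of_pos (V := E × E) (g1Inner nab G p) (g1Inner_pos nab G p)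

end AffineRiemannManifold
end AffineRiemann

end

/-!
Everything is computed in orthonormal frames. In a smooth orthonormal frame `F` a connection is
given by its coefficients `Θ a b c = ⟨∇_{F a} F b, F c⟩` (`HasConnCoeffs`), and its curvature by
the matrix of two-forms `dθ + θ ∧ θ`. Suppose that an almost complex structure has a constant matrix
`j` in the frame, and that all the matrices `Θ a` commute with `j` and are orthogonal to it for
the trace form. Then the trace of `j` against `θ ∧ θ` vanishes, since it is the trace of `j` times a
commutator of matrices which commute with `j`, and the trace of `j` against `dθ` is the derivative
of the trace of `j` against `θ`, which is zero. So the Ricci form vanishes: `ricciForm_eq_zero`.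

On `M` put `m a b c = ⟨∇_{F a} F b, F c⟩` (`connCoeff`). Because `∇` is torsion-free, the
brackets of the frame fields, and with them the Levi-Civita connection and the tensors `γ` and `γ*`,
are linear expressions in `m`. The condition `tr γ = 0` becomes `∑ a, (m c a a - m a c a - m a a c)
= 0` for all `c`, and `tr γ* = 0` becomes `∑ a, m c a a = 0` for all `c`. The statements on
`tr (D_X γ)` and `tr (D_X γ*)` hold for every tensor field with vanishing trace, because the
coefficients of the Levi-Civita connection are skew-symmetric (`metricTrace_covDeriv_eq_zero`).

On `TM` the lifts `(F a)^h`, `(F a)^v` form a `g₁`-orthonormal frame in which `J₁` is constant. Its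
brackets are given by `[X^h, Y^h] = [X, Y]^h`, which is flatness of `∇`, `[X^h, Y^v] = (∇_X Y)^v`
and `[X^v, Y^v] = 0`. They are obtained by comparing derivatives of functions: a tangent vector of
`TM` is determined by its projection to `M` and by the derivatives of the fiber coordinates
`q ↦ ⟨q, F i⟩` (`eq_of_dproj_of_fiberCoord`), which also yield the smoothness of the lifts. The
coefficients of the Bismut and Chern connections in the lifted frame are then explicit linear
expressions in `m`, constant along the fibers of `TM`. They commute with the matrix of `J₁`, and
their traces against it are zero for horizontal directions and, for vertical ones, multiples of the
two sums above: the first for the Bismut connection (`sum_liftBismutCoeff`), the second for the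
Chern connection (`sum_liftChernCoeff`).
-/

set_option linter.unusedSectionVars false

noncomputable section

namespace AffineRiemann

/-! ### Derivatives along vector fields -/

section Calculus

open Set Filter Topology VectorField

variable {E : Type*} [NormedAddCommGroup E] [NormedSpace ℝ E] [FiniteDimensional ℝ E]
  {H : Type*} [TopologicalSpace H] {I : ModelWithCorners ℝ E H}
  {M : Type*} [TopologicalSpace M] [ChartedSpace H M] [IsManifold I ∞ M]

/-- The derivative of `f` along `V`, computed in the chart at `x`: the pullback of `V` to the chart
is applied to the coordinate expression of `f`. -/
theorem fderivWithin_comp_extChartAt_symm_mpullbackWithin {f : M → ℝ} {x : M} {z : E}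
    (hz : z ∈ (extChartAt I x).target) (hf : MDiffAt f ((extChartAt I x).symm z))
    (V : VField I M) :
    fderivWithin ℝ (f ∘ (extChartAt I x).symm) (range I) z
        (mpullbackWithin 𝓘(ℝ, E) I (extChartAt I x).symm V (range I) z)
      = along V f ((extChartAt I x).symm z) := by
  have hr := extChartAt_target_subset_range x hz
  have hinv := isInvertible_mfderivWithin_extChartAt_symm (I := I) hz
  have h := mfderiv_comp_mfderivWithin (I := 𝓘(ℝ, E)) (I' := I) (I'' := 𝓘(ℝ, ℝ)) z hf
    (mdifferentiableWithinAt_extChartAt_symm hz) (I.uniqueMDiffOn z hr)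
  rw [mfderivWithin_eq_fderivWithin] at h
  refine (DFunLike.congr_fun h _).trans ?_
  exact congrArg (mfderiv I 𝓘(ℝ, ℝ) f _) (hinv.self_apply_inverse _)

/-- The differential of a smooth function is a smooth function on the tangent bundle. -/
theorem contMDiffOn_mvfderiv {f : M → ℝ} {u : Set M} (hu : IsOpen u)
    (hf : ContMDiffOn I 𝓘(ℝ, ℝ) ∞ f u) :
    ContMDiffOn I.tangent 𝓘(ℝ, ℝ) ∞ (fun ξ : TangentBundle I M => mvfderiv I f ξ.1 ξ.2)
      (TotalSpace.proj ⁻¹' u) := by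
  have h := hf.contMDiffOn_tangentMapWithin (m := ∞) (by simp) hu.uniqueMDiffOn
  have h2 := (contMDiff_snd_tangentBundle_modelSpace ℝ 𝓘(ℝ, ℝ) (n := ∞)).comp_contMDiffOn h
  refine h2.congr fun ξ hξ => ?_
  simp only [Function.comp, tangentMapWithin]
  rw [mfderivWithin_of_isOpen hu hξ]
  rfl

theorem mdifferentiableAt_of_contMDiffOn {E' : Type*} [NormedAddCommGroup E'] [NormedSpace ℝ E']
    {H' : Type*} [TopologicalSpace H'] {I' : ModelWithCorners ℝ E' H'}
    {M' : Type*} [TopologicalSpace M'] [ChartedSpace H' M'] {f : M → M'} {u : Set M}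
    (hf : ContMDiffOn I I' ∞ f u) (hu : IsOpen u) {x : M} (hx : x ∈ u) :
    MDifferentiableAt I I' f x :=
  (hf.contMDiffAt (hu.mem_nhds hx)).mdifferentiableAt (by simp)

theorem contMDiffOn_along {f : M → ℝ} {u : Set M} (hu : IsOpen u) {X : VField I M}
    (hX : CMDiff[u] ∞ (T% X)) (hf : ContMDiffOn I 𝓘(ℝ, ℝ) ∞ f u) :
    ContMDiffOn I 𝓘(ℝ, ℝ) ∞ (along X f) u :=
  (contMDiffOn_mvfderiv hu hf).comp hX fun _ hx => hx

theorem contMDiffOn_bracket {u : Set M} (hu : IsOpen u) {X Y : VField I M}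
    (hX : CMDiff[u] ∞ (T% X)) (hY : CMDiff[u] ∞ (T% Y)) :
    CMDiff[u] ∞ (T% (bracket X Y)) := fun x hx =>
  have : IsManifold I (minSmoothness ℝ 2) M := by simpa using! inferInstanceAs (IsManifold I 2 M)
  have : IsManifold I (((⊤ : ℕ∞) : ℕ∞ω) + 1) M := inferInstanceAs (IsManifold I ∞ M)
  (((hX.contMDiffAt (hu.mem_nhds hx)).mlieBracket_vectorField (m := ⊤) (n := ⊤)
    (hY.contMDiffAt (hu.mem_nhds hx)) (by simp)).contMDiffWithinAt)

/-- The derivative along a Lie bracket is the commutator of the derivatives. -/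
theorem along_bracket {f : M → ℝ} {u : Set M} (hu : IsOpen u)
    (hf : ContMDiffOn I 𝓘(ℝ, ℝ) ∞ f u) {X Y : VField I M}
    (hX : CMDiff[u] ∞ (T% X)) (hY : CMDiff[u] ∞ (T% Y)) {x : M} (hx : x ∈ u) :
    along (bracket X Y) f x = along X (along Y f) x - along Y (along X f) x := by
  have hxt := mem_extChartAt_target (I := I) x
  have hxl : (extChartAt I x).symm (extChartAt I x x) = x := extChartAt_to_inv x
  -- the assertion is transported to the chart at `x`, where it is the formula for the bracket of
  -- vector fields on a vector space
  have key : ∀ (g : M → ℝ), MDiffAt g x → ∀ V : VField I M,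
      along V g x = fderivWithin ℝ (g ∘ (extChartAt I x).symm) (range I) (extChartAt I x x)
        (mpullbackWithin 𝓘(ℝ, E) I (extChartAt I x).symm V (range I) (extChartAt I x x)) := by
    intro g hg V
    rw [fderivWithin_comp_extChartAt_symm_mpullbackWithin hxt (by rwa [hxl]), hxl]
  have near : ∀ V : VField I M,
      (along V f ∘ (extChartAt I x).symm) =ᶠ[𝓝[range I] (extChartAt I x x)]
        fun z => fderivWithin ℝ (f ∘ (extChartAt I x).symm) (range I) z
          (mpullbackWithin 𝓘(ℝ, E) I (extChartAt I x).symm V (range I) z) := by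
    intro V
    have hcont : (extChartAt I x).symm ⁻¹' u ∈ 𝓝[range I] (extChartAt I x x) := by
      have := (continuousAt_extChartAt_symm (I := I) x).preimage_mem_nhds
        (hxl.symm ▸ hu.mem_nhds hx)
      exact nhdsWithin_le_nhds this
    filter_upwards [extChartAt_target_mem_nhdsWithin (I := I) x, hcont] with z hz hzu
    exact (fderivWithin_comp_extChartAt_symm_mpullbackWithin hz
      (mdifferentiableAt_of_contMDiffOn hf hu hzu) V).symm
  have hfd : ContDiffWithinAt ℝ ∞ (f ∘ (extChartAt I x).symm) (range I) (extChartAt I x x) := by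
    have h1 := (hf.contMDiffAt (hu.mem_nhds hx))
    have := (contMDiffAt_iff.1 h1).2
    simpa using! this
  have hXd : DifferentiableWithinAt ℝ (mpullbackWithin 𝓘(ℝ, E) I (extChartAt I x).symm X (range I))
      (range I) (extChartAt I x x) := by
    have := (mdifferentiableAt_of_contMDiffOn hX hu hx).mdifferentiableWithinAt
      (s := univ) |>.differentiableWithinAt_mpullbackWithin_vectorField
    simpa using! this
  have hYd : DifferentiableWithinAt ℝ (mpullbackWithin 𝓘(ℝ, E) I (extChartAt I x).symm Y (range I))
      (range I) (extChartAt I x x) := by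
    have := (mdifferentiableAt_of_contMDiffOn hY hu hx).mdifferentiableWithinAt
      (s := univ) |>.differentiableWithinAt_mpullbackWithin_vectorField
    simpa using! this
  -- the bracket is defined by pullback along the chart at `x`; the derivative of that chart at `x`
  -- is the identity
  have hbr : mpullbackWithin 𝓘(ℝ, E) I (extChartAt I x).symm (bracket X Y) (range I)
      (extChartAt I x x) = lieBracketWithin ℝ
        (mpullbackWithin 𝓘(ℝ, E) I (extChartAt I x).symm X (range I))
        (mpullbackWithin 𝓘(ℝ, E) I (extChartAt I x).symm Y (range I)) (range I)
        (extChartAt I x x) := by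
    have h1 : ∀ y, y = x → ((mfderiv[range I] (extChartAt I x).symm (extChartAt I x x)).inverse
        : E → E) (bracket X Y y : E) = (bracket X Y x : E) := by
      rintro y rfl
      exact mfderivWithin_extChartAt_symm_inverse_apply _
    refine (h1 _ hxl).trans ?_
    change mlieBracketWithin I X Y univ x = _
    rw [mlieBracketWithin_apply, mfderiv_extChartAt_self]
    simp only [preimage_univ, univ_inter]
    exact congrArg (fun A : E →L[ℝ] E => A _) ContinuousLinearMap.inverse_id
  rw [key f (mdifferentiableAt_of_contMDiffOn hf hu hx), hbr,
    fderivWithin_apply_lieBracket hfd (by simpa using ENat.LEInfty.out) I.uniqueDiffOn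
      (I.range_subset_closure_interior (mem_range_self _)) (mem_range_self _) hYd hXd,
    key _ (mdifferentiableAt_of_contMDiffOn (contMDiffOn_along hu hY hf) hu hx),
    key _ (mdifferentiableAt_of_contMDiffOn (contMDiffOn_along hu hX hf) hu hx),
    (near X).fderivWithin_eq (by simpa using (near X).self_of_nhdsWithin (mem_range_self _)),
    (near Y).fderivWithin_eq (by simpa using (near Y).self_of_nhdsWithin (mem_range_self _))]

theorem along_add {f g : M → ℝ} {X : VField I M} {x : M} (hf : MDiffAt f x) (hg : MDiffAt g x) :
    along X (f + g) x = along X f x + along X g x := by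
  simp [along, mvfderiv_add hf hg]

theorem along_neg {f : M → ℝ} {X : VField I M} {x : M} : along X (-f) x = -along X f x := by
  simp [along, mvfderiv_neg]

/-- The Leibniz rule. -/
theorem along_mul {f g : M → ℝ} {X : VField I M} {x : M} (hf : MDiffAt f x) (hg : MDiffAt g x) :
    along X (f * g) x = f x * along X g x + g x * along X f x := by
  simp [along, mvfderiv_mul hf hg]

theorem along_congr {f g : M → ℝ} {X : VField I M} {x : M} (h : f =ᶠ[𝓝 x] g) :
    along X f x = along X g x := by
  simp only [along, mvfderiv]
  rw [h.mfderiv_eq]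
  rfl

theorem along_const {c : ℝ} {X : VField I M} {x : M} : along X (fun _ => c) x = 0 := by
  simp [along, mvfderiv_const]

theorem mdifferentiableAt_fun_sum {ι : Type*} (s : Finset ι) {f : ι → M → ℝ} {x : M}
    (hf : ∀ i ∈ s, MDiffAt (f i) x) : MDiffAt (fun y => ∑ i ∈ s, f i y) x := by
  classical
  induction s using Finset.induction_on with
  | empty => simpa using mdifferentiableAt_const
  | insert a s ha ih =>
    simp only [Finset.mem_insert, forall_eq_or_imp] at hf
    simp only [Finset.sum_insert ha]
    exact hf.1.add (ih hf.2)

theorem along_sum {ι : Type*} (s : Finset ι) {f : ι → M → ℝ} {X : VField I M} {x : M}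
    (hf : ∀ i ∈ s, MDiffAt (f i) x) :
    along X (fun y => ∑ i ∈ s, f i y) x = ∑ i ∈ s, along X (f i) x := by
  classical
  induction s using Finset.induction_on with
  | empty => simpa using along_const
  | insert a s ha ih =>
    simp only [Finset.mem_insert, forall_eq_or_imp] at hf
    simp only [Finset.sum_insert ha, ← ih hf.2]
    exact along_add hf.1 (mdifferentiableAt_fun_sum s hf.2)

end Calculus

/-! ### Connection forms -/

section KoszulForms

open Set Filter Topology VectorField

variable {E : Type*} [NormedAddCommGroup E] [NormedSpace ℝ E] [FiniteDimensional ℝ E]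
  {H : Type*} [TopologicalSpace H] {I : ModelWithCorners ℝ E H}
  {M : Type*} [TopologicalSpace M] [ChartedSpace H M] [IsManifold I ∞ M]

theorem pairing_symm (G : RiemannianMetric (TangentSpace I : M → Type _)) (X Y : VField I M) :
    pairing G X Y = pairing G Y X :=
  funext fun x => G.symm x _ _

theorem pairing_add_left (G : RiemannianMetric (TangentSpace I : M → Type _))
    (X X' Y : VField I M) : pairing G (X + X') Y = pairing G X Y + pairing G X' Y := by
  funext x; simp [pairing]

theorem pairing_smul_left (G : RiemannianMetric (TangentSpace I : M → Type _)) (f : M → ℝ)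
    (X Y : VField I M) : pairing G (f • X) Y = f * pairing G X Y := by
  funext x; simp [pairing]

theorem pairing_add_right (G : RiemannianMetric (TangentSpace I : M → Type _))
    (X Y Y' : VField I M) : pairing G X (Y + Y') = pairing G X Y + pairing G X Y' := by
  funext x; simp [pairing]

theorem pairing_smul_right (G : RiemannianMetric (TangentSpace I : M → Type _)) (f : M → ℝ)
    (X Y : VField I M) : pairing G X (f • Y) = f * pairing G X Y := by
  funext x; simp [pairing]

theorem along_smul_field (f g : M → ℝ) (X : VField I M) (x : M) :
    along (f • X) g x = f x * along X g x := by
  simp [along]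

theorem along_add_field (g : M → ℝ) (X Y : VField I M) (x : M) :
    along (X + Y) g x = along X g x + along Y g x := by
  simp [along]

/-- At `x` the metric is differentiable: it pairs differentiable vector fields to a differentiable
function. -/
def PairsDiffAt (G : RiemannianMetric (TangentSpace I : M → Type _)) (x : M) : Prop :=
  ∀ X Y : VField I M, MDiffAt (T% X) x → MDiffAt (T% Y) x → MDiffAt (pairing G X Y) x

/-- An operation `T` on triples of vector fields which behaves like `(X, Y, Z) ↦ ⟨∇_X Y, Z⟩` at `x`
for a connection `∇`: it is tensorial in `X` and `Z` and satisfies the Leibniz rule in `Y`. -/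
structure IsConnectionFormAt (G : RiemannianMetric (TangentSpace I : M → Type _)) (x : M)
    (T : VField I M → VField I M → VField I M → ℝ) : Prop where
  left : ∀ Y Z, MDiffAt (T% Y) x → MDiffAt (T% Z) x → TensorialAt I E (fun X => T X Y Z) x
  right : ∀ X Y, MDiffAt (T% X) x → MDiffAt (T% Y) x → TensorialAt I E (fun Z => T X Y Z) x
  add : ∀ X Y Y' Z, MDiffAt (T% X) x → MDiffAt (T% Y) x → MDiffAt (T% Y') x → MDiffAt (T% Z) x →
    T X (Y + Y') Z = T X Y Z + T X Y' Z
  leibniz : ∀ (f : M → ℝ) X Y Z, MDiffAt f x → MDiffAt (T% X) x → MDiffAt (T% Y) x →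
    MDiffAt (T% Z) x → T X (f • Y) Z = f x * T X Y Z + along X f x * pairing G Y Z x

/-- An operation on triples of vector fields which is tensorial in each of them. -/
structure IsTensorialAt₃ (x : M) (T : VField I M → VField I M → VField I M → ℝ) : Prop where
  left : ∀ Y Z, MDiffAt (T% Y) x → MDiffAt (T% Z) x → TensorialAt I E (fun X => T X Y Z) x
  middle : ∀ X Z, MDiffAt (T% X) x → MDiffAt (T% Z) x → TensorialAt I E (fun Y => T X Y Z) x
  right : ∀ X Y, MDiffAt (T% X) x → MDiffAt (T% Y) x → TensorialAt I E (fun Z => T X Y Z) x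

theorem tensorialAt_add_smul {Φ Ψ : VField I M → ℝ} {x : M} (hΦ : TensorialAt I E Φ x)
    (hΨ : TensorialAt I E Ψ x) (c : ℝ) : TensorialAt I E (fun X => Φ X + c * Ψ X) x where
  smul hf hX := by simp only [hΦ.smul hf hX, hΨ.smul hf hX, smul_eq_mul]; ring
  add hX hY := by simp only [hΦ.add hX hY, hΨ.add hX hY]; ring

theorem IsConnectionFormAt.add_smul {G : RiemannianMetric (TangentSpace I : M → Type _)} {x : M}
    {T S : VField I M → VField I M → VField I M → ℝ} (hT : IsConnectionFormAt G x T)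
    (hS : IsTensorialAt₃ x S) (c : ℝ) :
    IsConnectionFormAt G x fun X Y Z => T X Y Z + c * S X Y Z where
  left Y Z hY hZ := tensorialAt_add_smul (hT.left Y Z hY hZ) (hS.left Y Z hY hZ) c
  right X Y hX hY := tensorialAt_add_smul (hT.right X Y hX hY) (hS.right X Y hX hY) c
  add X Y Y' Z hX hY hY' hZ := by
    rw [hT.add X Y Y' Z hX hY hY' hZ, (hS.middle X Z hX hZ).add hY hY']
    ring
  leibniz f X Y Z hf hX hY hZ := by
    rw [hT.leibniz f X Y Z hf hX hY hZ, (hS.middle X Z hX hZ).smul hf hY, smul_eq_mul]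
    ring

theorem bracket_add_left {X X' Y : VField I M} {x : M} (hX : MDiffAt (T% X) x)
    (hX' : MDiffAt (T% X') x) : bracket (X + X') Y x = bracket X Y x + bracket X' Y x :=
  mlieBracket_add_left hX hX'

theorem bracket_add_right {X Y Y' : VField I M} {x : M} (hY : MDiffAt (T% Y) x)
    (hY' : MDiffAt (T% Y') x) : bracket X (Y + Y') x = bracket X Y x + bracket X Y' x :=
  mlieBracket_add_right hY hY'

theorem bracket_smul_left {f : M → ℝ} {X Y : VField I M} {x : M} (hf : MDiffAt f x)
    (hX : MDiffAt (T% X) x) :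
    bracket (f • X) Y x = -along Y f x • X x + f x • bracket X Y x :=
  mlieBracket_smul_left hf hX

theorem bracket_smul_right {f : M → ℝ} {X Y : VField I M} {x : M} (hf : MDiffAt f x)
    (hY : MDiffAt (T% Y) x) :
    bracket X (f • Y) x = along X f x • Y x + f x • bracket X Y x :=
  mlieBracket_smul_right hf hY

theorem bracket_swap (X Y : VField I M) : bracket X Y = -bracket Y X := mlieBracket_swap

/-- Half of the Koszul expression behaves like `⟨D_X Y, Z⟩`. This is what makes the Levi-Civita
connection, and its modifications by tensors, computable from a frame. -/
theorem isConnectionFormAt_koszul {G : RiemannianMetric (TangentSpace I : M → Type _)} {x : M}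
    (hG : PairsDiffAt G x) :
    IsConnectionFormAt G x fun X Y Z => 1 / 2 * koszul G X Y Z x where
  left Y Z hY hZ := {
    smul := fun {f X} hf hX => by
      simp only [koszul, pairing_smul_left, along_smul_field, along_mul hf (hG X Z hX hZ),
        along_mul hf (hG X Y hX hY), pairing, bracket_smul_left hf hX, Pi.smul_apply', map_add,
        map_smul, map_neg, neg_smul, add_apply, neg_apply, smul_apply, smul_eq_mul]
      ring
    add := fun {X X'} hX hX' => by
      simp only [koszul, pairing_add_left, along_add_field,
        along_add (hG X Z hX hZ) (hG X' Z hX' hZ),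
        along_add (hG X Y hX hY) (hG X' Y hX' hY), pairing, bracket_add_left hX hX', Pi.add_apply,
        map_add, add_apply]
      ring }
  right X Y hX hY := {
    smul := fun {f Z} hf hZ => by
      simp only [koszul, pairing_smul_right, along_smul_field, along_mul hf (hG X Z hX hZ),
        along_mul hf (hG Y Z hY hZ), pairing, bracket_smul_right hf hZ, Pi.smul_apply', map_add,
        map_smul, add_apply, smul_apply, smul_eq_mul]
      rw [G.symm x (Z x) (X x), G.symm x (Z x) (Y x)]
      ring
    add := fun {Z Z'} hZ hZ' => by
      simp only [koszul, pairing_add_right, along_add_field,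
        along_add (hG X Z hX hZ) (hG X Z' hX hZ'),
        along_add (hG Y Z hY hZ) (hG Y Z' hY hZ'), pairing, bracket_add_right hZ hZ', Pi.add_apply,
        map_add, add_apply]
      ring }
  add X Y Y' Z hX hY hY' hZ := by
    simp only [koszul, pairing_add_right, pairing_add_left, along_add_field,
      along_add (hG X Y hX hY) (hG X Y' hX hY'),
      along_add (hG Y Z hY hZ) (hG Y' Z hY' hZ), pairing, bracket_add_right hY hY',
      bracket_add_left hY hY', Pi.add_apply, map_add, add_apply]
    ring
  leibniz f X Y Z hf hX hY hZ := by
    simp only [koszul, pairing_smul_right, pairing_smul_left, along_smul_field,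
      along_mul hf (hG X Y hX hY), along_mul hf (hG Y Z hY hZ), pairing, bracket_smul_right hf hY,
      bracket_smul_left hf hY, Pi.smul_apply', map_add, map_smul, map_neg, neg_smul, add_apply,
      neg_apply, smul_apply, smul_eq_mul]
    rw [G.symm x (Y x) (X x)]
    ring

theorem app_smul (J : (x : M) → TangentSpace I x →L[ℝ] TangentSpace I x) (f : M → ℝ)
    (X : VField I M) : app J (f • X) = f • app J X := by
  funext x; simp [app]

theorem app_add (J : (x : M) → TangentSpace I x →L[ℝ] TangentSpace I x) (X Y : VField I M) :
    app J (X + Y) = app J X + app J Y := by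
  funext x; simp [app]

/-- `J` maps vector fields which are differentiable at `x` to such vector fields. -/
def PreservesDiffAt (J : (x : M) → TangentSpace I x →L[ℝ] TangentSpace I x) (x : M) : Prop :=
  ∀ X : VField I M, MDiffAt (T% X) x → MDiffAt (T% (app J X)) x

/-- `J` is skew-symmetric with respect to the metric. -/
def IsSkew (G : RiemannianMetric (TangentSpace I : M → Type _))
    (J : (x : M) → TangentSpace I x →L[ℝ] TangentSpace I x) : Prop :=
  ∀ x v w, G.inner x (J x v) w = -G.inner x (J x w) v

variable {G : RiemannianMetric (TangentSpace I : M → Type _)}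
  {J : (x : M) → TangentSpace I x →L[ℝ] TangentSpace I x} {x : M}

theorem fundForm_swap (hskew : IsSkew G J) (X Y : VField I M) :
    fundForm G J X Y = -fundForm G J Y X :=
  funext fun x => hskew x _ _

/-- The exterior derivative of the fundamental form is invariant under cyclic permutations. -/
theorem dFundForm_rotate (hskew : IsSkew G J) (X Y Z : VField I M) :
    dFundForm G J X Y Z x = dFundForm G J Y Z X x := by
  simp only [dFundForm]
  rw [fundForm_swap hskew Z X, fundForm_swap hskew Y X, along_neg, along_neg, bracket_swap Y X,
    bracket_swap Z X]
  simp only [fundForm, pairing, app, Pi.neg_apply, map_neg, neg_apply]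
  ring

theorem tensorialAt_dFundForm_right (hG : PairsDiffAt G x) (hJ : PreservesDiffAt J x)
    (hskew : IsSkew G J) {X Y : VField I M} (hX : MDiffAt (T% X) x) (hY : MDiffAt (T% Y) x) :
    TensorialAt I E (fun Z => dFundForm G J X Y Z x) x where
  smul {f Z} hf hZ := by
    have h1 := hG _ _ (hJ X hX) hZ
    have h2 := hG _ _ (hJ Y hY) hZ
    have h3 := hskew x (Z x) (X x)
    have h4 := hskew x (Z x) (Y x)
    simp only [dFundForm, fundForm, pairing_smul_right, along_smul_field, along_mul hf h1,
      along_mul hf h2]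
    simp only [pairing, app, bracket_smul_right hf hZ, Pi.mul_apply, map_add, map_smul,
      add_apply, smul_apply, smul_eq_mul, h3, h4]
    ring
  add {Z Z'} hZ hZ' := by
    have h1 := hG _ _ (hJ X hX) hZ
    have h2 := hG _ _ (hJ Y hY) hZ
    have h1' := hG _ _ (hJ X hX) hZ'
    have h2' := hG _ _ (hJ Y hY) hZ'
    simp only [dFundForm, fundForm, pairing_add_right, along_add_field, along_add h1 h1',
      along_add h2 h2']
    simp only [pairing, app, bracket_add_right hZ hZ', Pi.add_apply, map_add, add_apply]
    ring

/-- By cyclic invariance it suffices to have tensoriality of `dω` in the last argument. -/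
theorem isTensorialAt₃_dFundForm (hG : PairsDiffAt G x) (hJ : PreservesDiffAt J x)
    (hskew : IsSkew G J) : IsTensorialAt₃ x fun X Y Z => dFundForm G J X Y Z x where
  right _ _ hX hY := tensorialAt_dFundForm_right hG hJ hskew hX hY
  left Y Z hY hZ := by
    simp only [fun X => dFundForm_rotate (x := x) hskew X Y Z]
    exact tensorialAt_dFundForm_right hG hJ hskew hY hZ
  middle X Z hX hZ := by
    simp only [fun Y => (dFundForm_rotate (x := x) hskew Z X Y).symm]
    exact tensorialAt_dFundForm_right hG hJ hskew hZ hX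

theorem tensorialAt_comp_app {Φ : VField I M → ℝ} (hΦ : TensorialAt I E Φ x)
    (hJ : PreservesDiffAt J x) : TensorialAt I E (fun X => Φ (app J X)) x where
  smul hf hX := by rw [app_smul, hΦ.smul hf (hJ _ hX)]
  add hX hY := by rw [app_add, hΦ.add (hJ _ hX) (hJ _ hY)]

theorem IsTensorialAt₃.comp_app {T : VField I M → VField I M → VField I M → ℝ}
    (hT : IsTensorialAt₃ x T) (hJ : PreservesDiffAt J x) :
    IsTensorialAt₃ x fun X Y Z => T (app J X) (app J Y) (app J Z) where
  left _ _ hY hZ := tensorialAt_comp_app (hT.left _ _ (hJ _ hY) (hJ _ hZ)) hJ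
  middle _ _ hX hZ := tensorialAt_comp_app (hT.middle _ _ (hJ _ hX) (hJ _ hZ)) hJ
  right _ _ hX hY := tensorialAt_comp_app (hT.right _ _ (hJ _ hX) (hJ _ hY)) hJ

theorem IsTensorialAt₃.comp_app_left {T : VField I M → VField I M → VField I M → ℝ}
    (hT : IsTensorialAt₃ x T) (hJ : PreservesDiffAt J x) :
    IsTensorialAt₃ x fun X Y Z => T (app J X) Y Z where
  left _ _ hY hZ := tensorialAt_comp_app (hT.left _ _ hY hZ) hJ
  middle _ _ hX hZ := hT.middle _ _ (hJ _ hX) hZ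
  right _ _ hX hY := hT.right _ _ (hJ _ hX) hY

/-- `⟨∇_X Y, Z⟩` for the Bismut connection. -/
def bismutForm (G : RiemannianMetric (TangentSpace I : M → Type _))
    (J : (x : M) → TangentSpace I x →L[ℝ] TangentSpace I x) (x : M) (X Y Z : VField I M) : ℝ :=
  1 / 2 * koszul G X Y Z x + 1 / 2 * dFundForm G J (app J X) (app J Y) (app J Z) x

/-- `⟨∇_X Y, Z⟩` for the Chern connection. -/
def chernForm (G : RiemannianMetric (TangentSpace I : M → Type _))
    (J : (x : M) → TangentSpace I x →L[ℝ] TangentSpace I x) (x : M) (X Y Z : VField I M) : ℝ :=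
  1 / 2 * koszul G X Y Z x + -(1 / 2) * dFundForm G J (app J X) Y Z x

theorem isConnectionFormAt_bismutForm (hG : PairsDiffAt G x) (hJ : PreservesDiffAt J x)
    (hskew : IsSkew G J) : IsConnectionFormAt G x (bismutForm G J x) :=
  (isConnectionFormAt_koszul hG).add_smul
    ((isTensorialAt₃_dFundForm hG hJ hskew).comp_app hJ) (1 / 2)

theorem isConnectionFormAt_chernForm (hG : PairsDiffAt G x) (hJ : PreservesDiffAt J x)
    (hskew : IsSkew G J) : IsConnectionFormAt G x (chernForm G J x) :=
  (isConnectionFormAt_koszul hG).add_smul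
    ((isTensorialAt₃_dFundForm hG hJ hskew).comp_app_left hJ) (-(1 / 2))

end KoszulForms

/-! ### Connections in orthonormal frames -/

section Frames

open Set Filter Topology VectorField

variable {E : Type*} [NormedAddCommGroup E] [NormedSpace ℝ E] [FiniteDimensional ℝ E]
  {H : Type*} [TopologicalSpace H] {I : ModelWithCorners ℝ E H}
  {M : Type*} [TopologicalSpace M] [ChartedSpace H M] [IsManifold I ∞ M]
  {ι : Type*} [Fintype ι] [DecidableEq ι]

/-- A smooth orthonormal frame `F` on the open set `u`. The last condition, smoothness of the
coefficient functions on the tangent bundle, expresses smoothness of the metric on `u`. -/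
structure IsOrthonormalFrameOn (G : RiemannianMetric (TangentSpace I : M → Type _))
    (F : ι → VField I M) (u : Set M) : Prop where
  isOpen : IsOpen u
  contMDiffOn : ∀ a, CMDiff[u] ∞ (T% (F a))
  inner : ∀ x ∈ u, ∀ a b, G.inner x (F a x) (F b x) = if a = b then 1 else 0
  sum : ∀ x ∈ u, ∀ v : TangentSpace I x, ∑ a, G.inner x v (F a x) • F a x = v
  coeff : ∀ a, ContMDiffOn I.tangent 𝓘(ℝ, ℝ) ∞
    (fun ξ : TangentBundle I M => G.inner ξ.1 ξ.2 (F a ξ.1)) (TotalSpace.proj ⁻¹' u)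

namespace IsOrthonormalFrameOn

variable {G : RiemannianMetric (TangentSpace I : M → Type _)} {F : ι → VField I M} {u : Set M}

theorem mono (hF : IsOrthonormalFrameOn G F u) {s : Set M} (hs : IsOpen s) (hsu : s ⊆ u) :
    IsOrthonormalFrameOn G F s where
  isOpen := hs
  contMDiffOn a := (hF.contMDiffOn a).mono hsu
  inner x hx := hF.inner x (hsu hx)
  sum x hx := hF.sum x (hsu hx)
  coeff a := (hF.coeff a).mono (preimage_mono hsu)

theorem mdifferentiableAt (hF : IsOrthonormalFrameOn G F u) {x : M} (hx : x ∈ u) (a : ι) :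
    MDiffAt (T% (F a)) x :=
  mdifferentiableAt_of_contMDiffOn (hF.contMDiffOn a) hF.isOpen hx

theorem mdifferentiableAt_pairing (hF : IsOrthonormalFrameOn G F u) {x : M} (hx : x ∈ u)
    {X : VField I M} (hX : MDiffAt (T% X) x) (a : ι) : MDiffAt (pairing G X (F a)) x := by
  have h : MDifferentiableAt I.tangent 𝓘(ℝ, ℝ)
      (fun ξ : TangentBundle I M => G.inner ξ.1 ξ.2 (F a ξ.1)) ⟨x, X x⟩ :=
    ((hF.coeff a).contMDiffAt ((hF.isOpen.preimage
      (FiberBundle.continuous_proj E (TangentSpace I))).mem_nhds hx)).mdifferentiableAt (by simp)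
  exact h.comp x hX

theorem contMDiffOn_pairing (hF : IsOrthonormalFrameOn G F u) {X : VField I M}
    (hX : CMDiff[u] ∞ (T% X)) (a : ι) : ContMDiffOn I 𝓘(ℝ, ℝ) ∞ (pairing G X (F a)) u :=
  (hF.coeff a).comp hX fun _ hx => hx

theorem inner_eq_sum (hF : IsOrthonormalFrameOn G F u) {x : M} (hx : x ∈ u)
    (v w : TangentSpace I x) :
    G.inner x v w = ∑ a, G.inner x v (F a x) * G.inner x w (F a x) := by
  conv_lhs => rw [← hF.sum x hx v]
  simp only [map_sum, map_smul, sum_apply, smul_apply, smul_eq_mul]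
  exact Finset.sum_congr rfl fun a _ => by rw [G.symm x (F a x) w]

theorem pairsDiffAt (hF : IsOrthonormalFrameOn G F u) {x : M} (hx : x ∈ u) :
    PairsDiffAt G x := by
  intro X Y hX hY
  refine (mdifferentiableAt_fun_sum Finset.univ fun a _ =>
    (hF.mdifferentiableAt_pairing hx hX a).mul
      (hF.mdifferentiableAt_pairing hx hY a)).congr_of_eventuallyEq ?_
  filter_upwards [hF.isOpen.mem_nhds hx] with y hy
  exact hF.inner_eq_sum hy _ _

/-- A tensorial operation is determined by its values on a frame. -/
theorem tensorialAt_eq_sum (hF : IsOrthonormalFrameOn G F u) {x : M} (hx : x ∈ u)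
    {Φ : VField I M → ℝ} (hΦ : TensorialAt I E Φ x) {X : VField I M} (hX : MDiffAt (T% X) x) :
    Φ X = ∑ a, G.inner x (X x) (F a x) * Φ (F a) := by
  have hs : ∀ a, MDiffAt (T% ((fun _ : M => G.inner x (X x) (F a x)) • F a)) x := fun a =>
    mdifferentiableAt_const.smul_section (hF.mdifferentiableAt hx a)
  rw [hΦ.pointwise hX (MDifferentiableAt.sum_section (s := Finset.univ) fun a _ => hs a)
    (hF.sum x hx (X x)).symm, hΦ.sum _ fun a _ => hs a]
  exact Finset.sum_congr rfl fun a _ =>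
    hΦ.smul mdifferentiableAt_const (hF.mdifferentiableAt hx a)

theorem pairing_frame (hF : IsOrthonormalFrameOn G F u) {x : M} (hx : x ∈ u) (a b : ι) :
    pairing G (F a) (F b) =ᶠ[𝓝 x] fun _ => if a = b then 1 else 0 := by
  filter_upwards [hF.isOpen.mem_nhds hx] with y hy
  exact hF.inner y hy a b

theorem along_pairing_frame (hF : IsOrthonormalFrameOn G F u) {x : M} (hx : x ∈ u)
    (X : VField I M) (a b : ι) : along X (pairing G (F a) (F b)) x = 0 := by
  rw [along_congr (hF.pairing_frame hx a b), along_const]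

end IsOrthonormalFrameOn

/-- A connection form is determined by its values on the triples from a frame: subtracting the
derivative of `⟨Y, F c⟩` leaves an operation which is tensorial in `Y`, too. -/
theorem IsConnectionFormAt.eq_sum {G : RiemannianMetric (TangentSpace I : M → Type _)}
    {F : ι → VField I M} {u : Set M} (hF : IsOrthonormalFrameOn G F u) {x : M} (hx : x ∈ u)
    {T : VField I M → VField I M → VField I M → ℝ} (hT : IsConnectionFormAt G x T)
    {X Y Z : VField I M} (hX : MDiffAt (T% X) x) (hY : MDiffAt (T% Y) x)
    (hZ : MDiffAt (T% Z) x) :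
    T X Y Z = ∑ c, (along X (pairing G Y (F c)) x + ∑ a, ∑ b,
      G.inner x (X x) (F a x) * G.inner x (Y x) (F b x) * T (F a) (F b) (F c))
        * G.inner x (Z x) (F c x) := by
  have hFd := hF.mdifferentiableAt hx
  have hm : ∀ c, TensorialAt I E (fun Y => T X Y (F c) - along X (pairing G Y (F c)) x) x :=
    fun c => {
      smul := fun {f Y} hf hY => by
        simp only [hT.leibniz f X Y (F c) hf hX hY (hFd c), pairing_smul_left,
          along_mul hf (hF.mdifferentiableAt_pairing hx hY c), smul_eq_mul]
        ring
      add := fun {Y Y'} hY hY' => by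
        simp only [hT.add X Y Y' (F c) hX hY hY' (hFd c), pairing_add_left,
          along_add (hF.mdifferentiableAt_pairing hx hY c)
            (hF.mdifferentiableAt_pairing hx hY' c)]
        ring }
  rw [hF.tensorialAt_eq_sum hx (hT.right X Y hX hY) hZ]
  refine Finset.sum_congr rfl fun c _ => ?_
  have h1 := hF.tensorialAt_eq_sum hx (hm c) hY
  simp only [hF.along_pairing_frame hx, sub_zero] at h1
  rw [mul_comm, eq_add_of_sub_eq' h1]
  congr 2
  rw [Finset.sum_comm]
  refine Finset.sum_congr rfl fun b _ => ?_
  rw [hF.tensorialAt_eq_sum hx (hT.left _ _ (hFd b) (hFd c)) hX, Finset.mul_sum]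
  exact Finset.sum_congr rfl fun a _ => by ring

/-- On `u` the connection `nab` has the connection coefficients `Θ` with respect to the
orthonormal frame `F`: `∇_{F a} F b = ∑ c, Θ a b c F c`. -/
def HasConnCoeffs (G : RiemannianMetric (TangentSpace I : M → Type _)) (F : ι → VField I M)
    (u : Set M) (nab : VField I M → VField I M → VField I M) (Θ : ι → ι → ι → M → ℝ) : Prop :=
  ∀ x ∈ u, ∀ X Y : VField I M, MDiffAt (T% X) x → MDiffAt (T% Y) x →
    nab X Y x = ∑ c, (along X (pairing G Y (F c)) x + ∑ a, ∑ b,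
      G.inner x (X x) (F a x) * G.inner x (Y x) (F b x) * Θ a b c x) • F c x

theorem eq_of_inner_eq (G : RiemannianMetric (TangentSpace I : M → Type _)) {x : M}
    {v w : TangentSpace I x} (h : ∀ z, G.inner x v z = G.inner x w z) : v = w := by
  rw [← sub_eq_zero]
  by_contra hne
  have h3 := G.pos x _ hne
  rw [map_sub (G.inner x) v w, sub_apply, h, sub_self] at h3
  exact lt_irrefl _ h3

theorem sharp_eq_sum {G : RiemannianMetric (TangentSpace I : M → Type _)}
    {F : ι → VField I M} {x : M}
    {φ : TangentSpace I x → ℝ} {k : ι → ℝ} (hφ : ∀ z, φ z = ∑ c, k c * G.inner x z (F c x)) :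
    sharp G x φ = ∑ c, k c • F c x := by
  have h : φ = (G.inner x (∑ c, k c • F c x) : TangentSpace I x →ₗ[ℝ] ℝ) := by
    funext z
    simp [hφ, G.symm x z]
  refine eq_of_inner_eq G fun z => ?_
  rw [h, inner_sharp]
  rfl

theorem mdifferentiableAt_ext {x : M} (v : TangentSpace I x) :
    MDiffAt (T% (ext v : VField I M)) x :=
  FiberBundle.mdifferentiableAt_extend ..

@[simp] theorem ext_self {x : M} (v : TangentSpace I x) : (ext v : VField I M) x = v := by
  simp [ext]

/-- The connection which is defined by a connection form `T` has the coefficients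
`T (F a) (F b) (F c)`. -/
theorem hasConnCoeffs_of_form {G : RiemannianMetric (TangentSpace I : M → Type _)}
    {F : ι → VField I M} {u : Set M} (hF : IsOrthonormalFrameOn G F u)
    {T : M → VField I M → VField I M → VField I M → ℝ}
    (hT : ∀ x ∈ u, IsConnectionFormAt G x (T x)) :
    HasConnCoeffs G F u (fun X Y x => sharp G x fun z => T x X Y (ext z))
      (fun a b c x => T x (F a) (F b) (F c)) := by
  intro x hx X Y hX hY
  refine sharp_eq_sum fun z => ?_
  have := (hT x hx).eq_sum hF hx hX hY (mdifferentiableAt_ext z)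
  simpa using! this

theorem hasConnCoeffs_leviCivita {G : RiemannianMetric (TangentSpace I : M → Type _)}
    {F : ι → VField I M} {u : Set M} (hF : IsOrthonormalFrameOn G F u) :
    HasConnCoeffs G F u (leviCivita G) fun a b c x => 1 / 2 * koszul G (F a) (F b) (F c) x :=
  hasConnCoeffs_of_form hF fun _ hx => isConnectionFormAt_koszul (hF.pairsDiffAt hx)

theorem inner_leviCivita {G : RiemannianMetric (TangentSpace I : M → Type _)}
    {F : ι → VField I M} {u : Set M} (hF : IsOrthonormalFrameOn G F u) {x : M} (hx : x ∈ u)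
    {X Y Z : VField I M} (hX : MDiffAt (T% X) x) (hY : MDiffAt (T% Y) x) (hZ : MDiffAt (T% Z) x) :
    G.inner x (leviCivita G X Y x) (Z x) = 1 / 2 * koszul G X Y Z x := by
  rw [(isConnectionFormAt_koszul (hF.pairsDiffAt hx)).eq_sum hF hx hX hY hZ,
    hasConnCoeffs_leviCivita hF x hx X Y hX hY]
  simp [G.symm x (Z x)]

theorem hasConnCoeffs_bismut {G : RiemannianMetric (TangentSpace I : M → Type _)}
    {J : (x : M) → TangentSpace I x →L[ℝ] TangentSpace I x}
    {F : ι → VField I M} {u : Set M} (hF : IsOrthonormalFrameOn G F u)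
    (hJ : ∀ x ∈ u, PreservesDiffAt J x) (hskew : IsSkew G J) :
    HasConnCoeffs G F u (bismut G J) fun a b c x => bismutForm G J x (F a) (F b) (F c) := by
  intro x hx X Y hX hY
  rw [← hasConnCoeffs_of_form hF (fun x hx => isConnectionFormAt_bismutForm (hF.pairsDiffAt hx)
    (hJ x hx) hskew) x hx X Y hX hY]
  refine congrArg (sharp G x) (funext fun z => ?_)
  have := inner_leviCivita hF hx hX hY (mdifferentiableAt_ext z)
  rw [ext_self] at this
  rw [this]
  rfl

theorem hasConnCoeffs_chern {G : RiemannianMetric (TangentSpace I : M → Type _)}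
    {J : (x : M) → TangentSpace I x →L[ℝ] TangentSpace I x}
    {F : ι → VField I M} {u : Set M} (hF : IsOrthonormalFrameOn G F u)
    (hJ : ∀ x ∈ u, PreservesDiffAt J x) (hskew : IsSkew G J) :
    HasConnCoeffs G F u (chern G J) fun a b c x => chernForm G J x (F a) (F b) (F c) := by
  intro x hx X Y hX hY
  rw [← hasConnCoeffs_of_form hF (fun x hx => isConnectionFormAt_chernForm (hF.pairsDiffAt hx)
    (hJ x hx) hskew) x hx X Y hX hY]
  refine congrArg (sharp G x) (funext fun z => ?_)
  have := inner_leviCivita hF hx hX hY (mdifferentiableAt_ext z)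
  rw [ext_self] at this
  rw [this, chernForm]
  ring

end Frames

/-! ### Curvature and Ricci forms in orthonormal frames -/

section Curvature

open Set Filter Topology VectorField

variable {E : Type*} [NormedAddCommGroup E] [NormedSpace ℝ E] [FiniteDimensional ℝ E]
  {H : Type*} [TopologicalSpace H] {I : ModelWithCorners ℝ E H}
  {M : Type*} [TopologicalSpace M] [ChartedSpace H M] [IsManifold I ∞ M]
  {ι : Type*} [Fintype ι] [DecidableEq ι]

/-- The connection form: `∇_X F b = ∑ c, connForm X b c • F c`. -/
def connForm (G : RiemannianMetric (TangentSpace I : M → Type _)) (F : ι → VField I M)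
    (Θ : ι → ι → ι → M → ℝ) (X : VField I M) (b c : ι) (x : M) : ℝ :=
  ∑ a, pairing G X (F a) x * Θ a b c x

/-- The curvature form: `R(X, Y) F b = ∑ c, curvForm X Y b c • F c`. -/
def curvForm (G : RiemannianMetric (TangentSpace I : M → Type _)) (F : ι → VField I M)
    (Θ : ι → ι → ι → M → ℝ) (X Y : VField I M) (b c : ι) (x : M) : ℝ :=
  connForm G F Θ (bracket X Y) b c x - along X (connForm G F Θ Y b c) x
    + along Y (connForm G F Θ X b c) x
    - ∑ d, connForm G F Θ Y b d x * connForm G F Θ X d c x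
    + ∑ d, connForm G F Θ X b d x * connForm G F Θ Y d c x

variable {G : RiemannianMetric (TangentSpace I : M → Type _)} {F : ι → VField I M} {u : Set M}
  {nab : VField I M → VField I M → VField I M} {Θ : ι → ι → ι → M → ℝ}

theorem contMDiffOn_connForm (hF : IsOrthonormalFrameOn G F u)
    (hΘ : ∀ a b c, ContMDiffOn I 𝓘(ℝ, ℝ) ∞ (Θ a b c) u) {X : VField I M}
    (hX : CMDiff[u] ∞ (T% X)) (b c : ι) :
    ContMDiffOn I 𝓘(ℝ, ℝ) ∞ (connForm G F Θ X b c) u := by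
  have := contMDiffOn_finsetSum (t := Finset.univ) fun a (_ : a ∈ Finset.univ) =>
    (hF.contMDiffOn_pairing hX a).mul (hΘ a b c)
  exact this.congr fun y _ => by simp [connForm]

theorem HasConnCoeffs.eq_sum (hnab : HasConnCoeffs G F u nab Θ) {x : M} (hx : x ∈ u)
    {X Y : VField I M} (hX : MDiffAt (T% X) x) (hY : MDiffAt (T% Y) x) :
    nab X Y x = ∑ c, (along X (pairing G Y (F c)) x
      + ∑ b, pairing G Y (F b) x * connForm G F Θ X b c x) • F c x := by
  rw [hnab x hx X Y hX hY]
  refine Finset.sum_congr rfl fun c _ => ?_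
  rw [Finset.sum_comm]
  simp only [connForm, Finset.mul_sum, pairing]
  congr 2
  exact Finset.sum_congr rfl fun b _ => Finset.sum_congr rfl fun a _ => by ring

theorem IsOrthonormalFrameOn.inner_sum_smul (hF : IsOrthonormalFrameOn G F u) {x : M}
    (hx : x ∈ u) (k : ι → ℝ) (c : ι) : G.inner x (∑ a, k a • F a x) (F c x) = k c := by
  simp [hF.inner x hx]

theorem HasConnCoeffs.inner (hF : IsOrthonormalFrameOn G F u) (hnab : HasConnCoeffs G F u nab Θ)
    {x : M} (hx : x ∈ u) {X Y : VField I M} (hX : MDiffAt (T% X) x) (hY : MDiffAt (T% Y) x)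
    (c : ι) :
    pairing G (nab X Y) (F c) x = along X (pairing G Y (F c)) x
      + ∑ b, pairing G Y (F b) x * connForm G F Θ X b c x := by
  rw [pairing, hnab.eq_sum hx hX hY, hF.inner_sum_smul hx]

theorem contMDiffOn_of_coeff (hF : IsOrthonormalFrameOn G F u) {X : VField I M}
    (hX : ∀ c, ContMDiffOn I 𝓘(ℝ, ℝ) ∞ (pairing G X (F c)) u) : CMDiff[u] ∞ (T% X) := by
  refine (ContMDiffOn.sum_section (s := Finset.univ) fun c _ =>
    (hX c).smul_section (hF.contMDiffOn c)).congr fun y hy => ?_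
  simp only [TotalSpace.mk_inj]
  exact (hF.sum y hy (X y)).symm

theorem HasConnCoeffs.contMDiffOn_pairing (hF : IsOrthonormalFrameOn G F u)
    (hnab : HasConnCoeffs G F u nab Θ)
    (hΘ : ∀ a b c, ContMDiffOn I 𝓘(ℝ, ℝ) ∞ (Θ a b c) u) {X Y : VField I M}
    (hX : CMDiff[u] ∞ (T% X)) (hY : CMDiff[u] ∞ (T% Y)) (c : ι) :
    ContMDiffOn I 𝓘(ℝ, ℝ) ∞ (pairing G (nab X Y) (F c)) u := by
  have h := (contMDiffOn_along hF.isOpen hX (hF.contMDiffOn_pairing hY c)).add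
    (contMDiffOn_finsetSum (t := Finset.univ) fun b (_ : b ∈ Finset.univ) =>
      (hF.contMDiffOn_pairing hY b).mul (contMDiffOn_connForm hF hΘ hX b c))
  refine h.congr fun y hy => ?_
  rw [hnab.inner hF hy (mdifferentiableAt_of_contMDiffOn hX hF.isOpen hy)
    (mdifferentiableAt_of_contMDiffOn hY hF.isOpen hy)]
  simp

theorem HasConnCoeffs.contMDiffOn (hF : IsOrthonormalFrameOn G F u)
    (hnab : HasConnCoeffs G F u nab Θ)
    (hΘ : ∀ a b c, ContMDiffOn I 𝓘(ℝ, ℝ) ∞ (Θ a b c) u) {X Y : VField I M}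
    (hX : CMDiff[u] ∞ (T% X)) (hY : CMDiff[u] ∞ (T% Y)) : CMDiff[u] ∞ (T% (nab X Y)) :=
  contMDiffOn_of_coeff hF (hnab.contMDiffOn_pairing hF hΘ hX hY)

theorem HasConnCoeffs.inner_nab_nab (hF : IsOrthonormalFrameOn G F u)
    (hnab : HasConnCoeffs G F u nab Θ)
    (hΘ : ∀ a b c, ContMDiffOn I 𝓘(ℝ, ℝ) ∞ (Θ a b c) u) {X Y Z : VField I M}
    (hX : CMDiff[u] ∞ (T% X)) (hY : CMDiff[u] ∞ (T% Y)) (hZ : CMDiff[u] ∞ (T% Z)) {x : M}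
    (hx : x ∈ u) (c : ι) :
    pairing G (nab X (nab Y Z)) (F c) x = along X (along Y (pairing G Z (F c))) x
      + ∑ b, (pairing G Z (F b) x * along X (connForm G F Θ Y b c) x
        + connForm G F Θ Y b c x * along X (pairing G Z (F b)) x)
      + ∑ b, (along Y (pairing G Z (F b)) x * connForm G F Θ X b c x)
      + ∑ b, pairing G Z (F b) x * ∑ d, connForm G F Θ Y b d x * connForm G F Θ X d c x := by
  have hXd := mdifferentiableAt_of_contMDiffOn hX hF.isOpen hx
  have hd : ∀ {f : M → ℝ}, ContMDiffOn I 𝓘(ℝ, ℝ) ∞ f u → MDiffAt f x := fun hf =>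
    mdifferentiableAt_of_contMDiffOn hf hF.isOpen hx
  have hZF := fun c => hF.contMDiffOn_pairing hZ c
  have hYZ := hnab.contMDiffOn hF hΘ hY hZ
  have hev : ∀ c, pairing G (nab Y Z) (F c) =ᶠ[𝓝 x] along Y (pairing G Z (F c))
      + fun y => ∑ b, (pairing G Z (F b) * connForm G F Θ Y b c) y := fun c => by
    filter_upwards [hF.isOpen.mem_nhds hx] with y hy
    exact hnab.inner hF hy (mdifferentiableAt_of_contMDiffOn hY hF.isOpen hy)
      (mdifferentiableAt_of_contMDiffOn hZ hF.isOpen hy) c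
  have hC := fun b c => contMDiffOn_connForm hF hΘ hY b c
  rw [hnab.inner hF hx hXd (mdifferentiableAt_of_contMDiffOn hYZ hF.isOpen hx),
    along_congr (hev c), along_add (hd (contMDiffOn_along hF.isOpen hY (hZF c)))
      (mdifferentiableAt_fun_sum _ fun b _ => (hd (hZF b)).mul (hd (hC b c))),
    along_sum _ fun b _ => (hd (hZF b)).mul (hd (hC b c)), add_assoc, add_assoc, add_assoc]
  congr 2
  · exact Finset.sum_congr rfl fun b _ => along_mul (hd (hZF b)) (hd (hC b c))
  · simp only [fun d => (hev d).self_of_nhds, Pi.add_apply, Pi.mul_apply, add_mul,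
      Finset.sum_add_distrib, Finset.mul_sum, Finset.sum_mul]
    congr 1
    rw [Finset.sum_comm]
    exact Finset.sum_congr rfl fun b _ => Finset.sum_congr rfl fun a _ => by ring

/-- Cartan's second structure equation: the curvature operator has the matrix `curvForm` in the
frame. -/
theorem HasConnCoeffs.inner_curvature (hF : IsOrthonormalFrameOn G F u)
    (hnab : HasConnCoeffs G F u nab Θ)
    (hΘ : ∀ a b c, ContMDiffOn I 𝓘(ℝ, ℝ) ∞ (Θ a b c) u) {X Y Z : VField I M}
    (hX : CMDiff[u] ∞ (T% X)) (hY : CMDiff[u] ∞ (T% Y)) (hZ : CMDiff[u] ∞ (T% Z)) {x : M}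
    (hx : x ∈ u) (c : ι) :
    G.inner x (curvature nab X Y Z x) (F c x)
      = ∑ b, G.inner x (Z x) (F b x) * curvForm G F Θ X Y b c x := by
  have h1 := hnab.inner_nab_nab hF hΘ hX hY hZ hx c
  have h2 := hnab.inner_nab_nab hF hΘ hY hX hZ hx c
  have h3 := hnab.inner hF hx
    (mdifferentiableAt_of_contMDiffOn (contMDiffOn_bracket hF.isOpen hX hY) hF.isOpen hx)
    (mdifferentiableAt_of_contMDiffOn hZ hF.isOpen hx) c
  rw [along_bracket hF.isOpen (hF.contMDiffOn_pairing hZ c) hX hY hx] at h3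
  have h4 : G.inner x (curvature nab X Y Z x) (F c x) = pairing G (nab (bracket X Y) Z) (F c) x
      - pairing G (nab X (nab Y Z)) (F c) x + pairing G (nab Y (nab X Z)) (F c) x := by
    simp [curvature, pairing]
  have h5 : ∀ V W : VField I M, ∑ b, connForm G F Θ V b c x * along W (pairing G Z (F b)) x
      = ∑ b, along W (pairing G Z (F b)) x * connForm G F Θ V b c x := fun V W =>
    Finset.sum_congr rfl fun b _ => mul_comm _ _
  rw [h4, h1, h2, h3]
  simp only [curvForm, mul_add, mul_sub, Finset.sum_add_distrib, Finset.sum_sub_distrib, h5]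
  simp only [pairing]
  ring

/-- The trace of the curvature form against a constant matrix which commutes with the connection
coefficients, and is orthogonal to them, vanishes. -/
theorem sum_curvForm_eq_zero (hF : IsOrthonormalFrameOn G F u)
    (hΘ : ∀ a b c, ContMDiffOn I 𝓘(ℝ, ℝ) ∞ (Θ a b c) u) (j : Matrix ι ι ℝ)
    (hcomm : ∀ x ∈ u, ∀ a, Commute j.transpose (Matrix.of fun b c => Θ a b c x))
    (htr : ∀ x ∈ u, ∀ a, ∑ b, ∑ c, Θ a b c x * j b c = 0) {X Y : VField I M}
    (hX : CMDiff[u] ∞ (T% X)) (hY : CMDiff[u] ∞ (T% Y)) {x : M} (hx : x ∈ u) :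
    ∑ b, ∑ c, curvForm G F Θ X Y b c x * j b c = 0 := by
  have hd : ∀ {f : M → ℝ}, ContMDiffOn I 𝓘(ℝ, ℝ) ∞ f u → MDiffAt f x := fun hf =>
    mdifferentiableAt_of_contMDiffOn hf hF.isOpen hx
  have htr' : ∀ (Z : VField I M), ∀ y ∈ u, ∑ b, ∑ c, connForm G F Θ Z b c y * j b c = 0 := by
    intro Z y hy
    have : ∑ b, ∑ c, connForm G F Θ Z b c y * j b c
        = ∑ a, pairing G Z (F a) y * ∑ b, ∑ c, Θ a b c y * j b c := by
      simp only [connForm, Finset.sum_mul, Finset.mul_sum]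
      refine ((Finset.sum_congr rfl fun b _ => Finset.sum_comm).trans Finset.sum_comm).trans ?_
      exact Finset.sum_congr rfl fun a _ => Finset.sum_congr rfl fun b _ =>
        Finset.sum_congr rfl fun c _ => by ring
    rw [this]
    exact Finset.sum_eq_zero fun a _ => by rw [htr y hy a, mul_zero]
  have halong : ∀ {Z : VField I M}, CMDiff[u] ∞ (T% Z) → ∀ W : VField I M,
      ∑ b, ∑ c, along W (connForm G F Θ Z b c) x * j b c = 0 := by
    intro Z hZ W
    have hC := fun b c => hd (contMDiffOn_connForm hF hΘ hZ b c)
    have hm : ∀ b c, MDiffAt (fun y => connForm G F Θ Z b c y * j b c) x := fun b c =>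
      (hC b c).mul mdifferentiableAt_const
    have h1 : along W (fun y => ∑ b, ∑ c, connForm G F Θ Z b c y * j b c) x = 0 := by
      rw [along_congr (g := fun _ => 0), along_const]
      filter_upwards [hF.isOpen.mem_nhds hx] with y hy
      exact htr' Z y hy
    rw [along_sum _ fun b _ => mdifferentiableAt_fun_sum _ fun c _ => hm b c] at h1
    rw [← h1]
    refine Finset.sum_congr rfl fun b _ => ?_
    rw [along_sum _ fun c _ => hm b c]
    refine Finset.sum_congr rfl fun c _ => ?_
    refine Eq.trans ?_ (along_mul (hC b c) (mdifferentiableAt_const (c := j b c))).symm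
    rw [along_const]
    ring
  let θ : VField I M → Matrix ι ι ℝ := fun Z => Matrix.of fun b c => connForm G F Θ Z b c x
  have hθ : ∀ Z, Commute j.transpose (θ Z) := by
    intro Z
    have : θ Z = ∑ a, pairing G Z (F a) x • Matrix.of fun b c => Θ a b c x := by
      ext b c
      simp [θ, connForm, Matrix.sum_apply]
    rw [this]
    exact Commute.sum_right _ _ _ fun a _ => (hcomm x hx a).smul_right _
  have hquad : ∀ Z W : VField I M,
      ∑ b, ∑ c, (∑ d, connForm G F Θ Z b d x * connForm G F Θ W d c x) * j b c
        = (j.transpose * (θ Z * θ W)).trace := by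
    intro Z W
    simp only [Matrix.trace, Matrix.diag, Matrix.mul_apply, Matrix.transpose_apply, θ,
      Matrix.of_apply]
    rw [Finset.sum_comm]
    exact Finset.sum_congr rfl fun c _ => Finset.sum_congr rfl fun b _ => by rw [mul_comm]
  -- the trace of `j` against a commutator of matrices which commute with `j` vanishes
  have hsymm : (j.transpose * (θ Y * θ X)).trace = (j.transpose * (θ X * θ Y)).trace := by
    rw [← mul_assoc, (hθ Y).eq, mul_assoc, Matrix.trace_mul_comm, mul_assoc]
  simp only [curvForm, add_mul, sub_mul, Finset.sum_add_distrib, Finset.sum_sub_distrib]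
  rw [htr' _ x hx, halong hY, halong hX, hquad, hquad, hsymm]
  ring

/-- Parseval's identity for the basis in the definitions of the traces. -/
theorem sum_inner_orthoBasis (G : RiemannianMetric (TangentSpace I : M → Type _)) (x : M)
    (v w : TangentSpace I x) :
    ∑ i, G.inner x (orthoBasis G x i) v * G.inner x (orthoBasis G x i) w = G.inner x v w := by
  have h := inner_sharp G x (G.inner x v : TangentSpace I x →ₗ[ℝ] ℝ) w
  refine Eq.trans ?_ h
  simp [sharp, G.symm x v]

/-- If the metric and the almost complex structure are constant in the frame `F`, and the matrix
of the latter commutes with the connection coefficients and is orthogonal to them, then the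
Ricci form vanishes. -/
theorem ricciForm_eq_zero (hF : IsOrthonormalFrameOn G F u)
    {J : (x : M) → TangentSpace I x →L[ℝ] TangentSpace I x} (hnab : HasConnCoeffs G F u nab Θ)
    (hΘ : ∀ a b c, ContMDiffOn I 𝓘(ℝ, ℝ) ∞ (Θ a b c) u) (j : Matrix ι ι ℝ)
    (hj : ∀ x ∈ u, ∀ b c, G.inner x (F c x) (J x (F b x)) = j b c)
    (hcomm : ∀ x ∈ u, ∀ a, Commute j.transpose (Matrix.of fun b c => Θ a b c x))
    (htr : ∀ x ∈ u, ∀ a, ∑ b, ∑ c, Θ a b c x * j b c = 0) {X Y : VField I M}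
    (hX : CMDiff[u] ∞ (T% X)) (hY : CMDiff[u] ∞ (T% Y)) {x : M} (hx : x ∈ u) :
    ricciForm G J nab X Y x = 0 := by
  have hcurv : ∀ (v : TangentSpace I x) (c : ι),
      G.inner x (curvature nab X Y (ext v) x) (F c x)
        = ∑ b, G.inner x v (F b x) * curvForm G F Θ X Y b c x := by
    intro v c
    -- the extension of `v` is smooth only on some neighbourhood of `x`
    obtain ⟨s, hs, hsv⟩ := FiberBundle.exists_contMDiffOn_extend (I := I) (k := ∞) E v
    obtain ⟨t, hts, hto, hxt⟩ := mem_nhds_iff.1 hs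
    have hut : u ∩ t ⊆ u := inter_subset_left
    have h := HasConnCoeffs.inner_curvature (nab := nab) (Θ := Θ) (u := u ∩ t)
      (hF.mono (hF.isOpen.inter hto) hut) (fun y hy => hnab y (hut hy))
      (fun a b c => (hΘ a b c).mono hut) (hX.mono hut) (hY.mono hut)
      (Z := ext v) (hsv.mono (inter_subset_right.trans hts)) ⟨hx, hxt⟩ c
    rwa [ext_self] at h
  have hsum : ∑ i, G.inner x (curvature nab X Y (ext (orthoBasis G x i)) x)
      (J x (orthoBasis G x i)) = ∑ b, ∑ c, curvForm G F Θ X Y b c x * j b c := by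
    have h1 : ∀ i, G.inner x (curvature nab X Y (ext (orthoBasis G x i)) x)
        (J x (orthoBasis G x i)) = ∑ b, ∑ c, ∑ d,
          (G.inner x (orthoBasis G x i) (F b x) * G.inner x (orthoBasis G x i) (F d x))
            * (curvForm G F Θ X Y b c x * j d c) := by
      intro i
      rw [hF.inner_eq_sum hx, Finset.sum_comm]
      refine Finset.sum_congr rfl fun c _ => ?_
      have h2 : G.inner x (J x (orthoBasis G x i)) (F c x)
          = ∑ d, G.inner x (orthoBasis G x i) (F d x) * j d c := by
        conv_lhs => rw [← hF.sum x hx (orthoBasis G x i)]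
        simp [hj x hx, G.symm x (J x _)]
      rw [hcurv, h2, Finset.sum_mul_sum]
      exact Finset.sum_congr rfl fun b _ => Finset.sum_congr rfl fun d _ => by ring
    simp only [h1]
    rw [Finset.sum_comm]
    refine Finset.sum_congr rfl fun b _ => ?_
    rw [Finset.sum_comm]
    refine Finset.sum_congr rfl fun c _ => ?_
    rw [Finset.sum_comm]
    simp only [← Finset.sum_mul, sum_inner_orthoBasis, hF.inner x hx]
    simp
  rw [ricciForm, hsum, sum_curvForm_eq_zero hF hΘ j hcomm htr hX hY hx, mul_zero]

end Curvature

/-! ### Covariant derivatives of traces -/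

section Traces

open Set Filter Topology VectorField

variable {E : Type*} [NormedAddCommGroup E] [NormedSpace ℝ E] [FiniteDimensional ℝ E]
  {H : Type*} [TopologicalSpace H] {I : ModelWithCorners ℝ E H}
  {M : Type*} [TopologicalSpace M] [ChartedSpace H M] [IsManifold I ∞ M]
  {ι : Type*} [Fintype ι] [DecidableEq ι]

/-- On `u` the operation `A` is the tensor field with components `B a b c = ⟨A(F a, F b), F c⟩` in
the orthonormal frame `F`. -/
def HasComponents (G : RiemannianMetric (TangentSpace I : M → Type _)) (F : ι → VField I M)
    (u : Set M) (A : VField I M → VField I M → VField I M) (B : ι → ι → ι → M → ℝ) : Prop :=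
  ∀ x ∈ u, ∀ X Y : VField I M, MDiffAt (T% X) x → MDiffAt (T% Y) x →
    A X Y x = ∑ c, (∑ a, ∑ b, G.inner x (X x) (F a x) * G.inner x (Y x) (F b x) * B a b c x) • F c x

variable {G : RiemannianMetric (TangentSpace I : M → Type _)} {F : ι → VField I M} {u : Set M}
  {A : VField I M → VField I M → VField I M} {B Θ : ι → ι → ι → M → ℝ}

theorem HasComponents.inner (hF : IsOrthonormalFrameOn G F u) (hA : HasComponents G F u A B)
    {x : M} (hx : x ∈ u) {X Y : VField I M} (hX : MDiffAt (T% X) x) (hY : MDiffAt (T% Y) x)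
    (c : ι) :
    pairing G (A X Y) (F c) x
      = ∑ a, ∑ b, pairing G X (F a) x * pairing G Y (F b) x * B a b c x := by
  rw [pairing, hA x hx X Y hX hY, hF.inner_sum_smul hx]
  rfl

theorem HasComponents.contMDiffOn (hF : IsOrthonormalFrameOn G F u)
    (hA : HasComponents G F u A B) (hB : ∀ a b c, ContMDiffOn I 𝓘(ℝ, ℝ) ∞ (B a b c) u)
    {X Y : VField I M} (hX : CMDiff[u] ∞ (T% X)) (hY : CMDiff[u] ∞ (T% Y)) :
    CMDiff[u] ∞ (T% (A X Y)) := by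
  refine contMDiffOn_of_coeff hF fun c => ?_
  have h := contMDiffOn_finsetSum (t := Finset.univ) fun a (_ : a ∈ Finset.univ) =>
    contMDiffOn_finsetSum (t := Finset.univ) fun b (_ : b ∈ Finset.univ) =>
      ((hF.contMDiffOn_pairing hX a).mul (hF.contMDiffOn_pairing hY b)).mul (hB a b c)
  refine h.congr fun y hy => ?_
  rw [hA.inner hF hy (mdifferentiableAt_of_contMDiffOn hX hF.isOpen hy)
    (mdifferentiableAt_of_contMDiffOn hY hF.isOpen hy)]
  simp

theorem metricTrace_eq_sum (hF : IsOrthonormalFrameOn G F u) (hA : HasComponents G F u A B)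
    {x : M} (hx : x ∈ u) : metricTrace G A x = ∑ c, (∑ a, B a a c x) • F c x := by
  have h : ∀ i, A (ext (orthoBasis G x i)) (ext (orthoBasis G x i)) x = ∑ c, (∑ a, ∑ b,
      G.inner x (orthoBasis G x i) (F a x) * G.inner x (orthoBasis G x i) (F b x) * B a b c x)
        • F c x := by
    intro i
    have := hA x hx _ _ (mdifferentiableAt_ext (orthoBasis G x i))
      (mdifferentiableAt_ext (orthoBasis G x i))
    simpa only [ext_self] using this
  simp only [metricTrace, h]
  rw [Finset.sum_comm]
  refine Finset.sum_congr rfl fun c _ => ?_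
  rw [← Finset.sum_smul, Finset.sum_comm]
  congr 1
  refine Finset.sum_congr rfl fun a _ => ?_
  rw [Finset.sum_comm]
  simp only [← Finset.sum_mul, sum_inner_orthoBasis, hF.inner x hx]
  simp

theorem sum_components_eq_zero (hF : IsOrthonormalFrameOn G F u) (hA : HasComponents G F u A B)
    (htr : metricTrace G A = 0) {x : M} (hx : x ∈ u) (c : ι) : ∑ a, B a a c x = 0 := by
  have h := metricTrace_eq_sum hF hA hx
  rw [htr] at h
  rw [← hF.inner_sum_smul hx (fun c => ∑ a, B a a c x) c, ← h]
  simp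

/-- The components of `D_X(A)`. -/
theorem inner_covDeriv (hF : IsOrthonormalFrameOn G F u)
    (hD : HasConnCoeffs G F u (leviCivita G) Θ)
    (hΘ : ∀ a b c, ContMDiffOn I 𝓘(ℝ, ℝ) ∞ (Θ a b c) u) (hA : HasComponents G F u A B)
    (hB : ∀ a b c, ContMDiffOn I 𝓘(ℝ, ℝ) ∞ (B a b c) u) {X Y Z : VField I M}
    (hX : CMDiff[u] ∞ (T% X)) (hY : CMDiff[u] ∞ (T% Y)) (hZ : CMDiff[u] ∞ (T% Z)) {x : M}
    (hx : x ∈ u) (d : ι) :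
    G.inner x (covDeriv G X A Y Z x) (F d x)
      = ∑ b, ∑ c, pairing G Y (F b) x * pairing G Z (F c) x * (along X (B b c d) x
        + ∑ f, B b c f x * connForm G F Θ X f d x
        - ∑ f, connForm G F Θ X b f x * B f c d x
        - ∑ f, connForm G F Θ X c f x * B b f d x) := by
  have hd : ∀ {f : M → ℝ}, ContMDiffOn I 𝓘(ℝ, ℝ) ∞ f u → MDiffAt f x := fun hf =>
    mdifferentiableAt_of_contMDiffOn hf hF.isOpen hx
  have hXd := mdifferentiableAt_of_contMDiffOn hX hF.isOpen hx
  have hYd := mdifferentiableAt_of_contMDiffOn hY hF.isOpen hx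
  have hZd := mdifferentiableAt_of_contMDiffOn hZ hF.isOpen hx
  have hYF := fun c => hd (hF.contMDiffOn_pairing hY c)
  have hZF := fun c => hd (hF.contMDiffOn_pairing hZ c)
  have hBd := fun a b c => hd (hB a b c)
  have h1 := hD.inner hF hx hXd
    (mdifferentiableAt_of_contMDiffOn (hA.contMDiffOn hF hB hY hZ) hF.isOpen hx) d
  have h2 := hA.inner hF hx
    (mdifferentiableAt_of_contMDiffOn (hD.contMDiffOn hF hΘ hX hY) hF.isOpen hx) hZd d
  have h3 := hA.inner hF hx hYd
    (mdifferentiableAt_of_contMDiffOn (hD.contMDiffOn hF hΘ hX hZ) hF.isOpen hx) d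
  have hev : pairing G (A Y Z) (F d) =ᶠ[𝓝 x] fun y => ∑ b, ∑ c,
      ((pairing G Y (F b) * pairing G Z (F c)) * B b c d) y := by
    filter_upwards [hF.isOpen.mem_nhds hx] with y hy
    exact hA.inner hF hy (mdifferentiableAt_of_contMDiffOn hY hF.isOpen hy)
      (mdifferentiableAt_of_contMDiffOn hZ hF.isOpen hy) d
  have hm := fun b c => ((hYF b).mul (hZF c)).mul (hBd b c d)
  have h4 : along X (pairing G (A Y Z) (F d)) x = ∑ b, ∑ c,
      (pairing G Y (F b) x * pairing G Z (F c) x * along X (B b c d) x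
        + B b c d x * pairing G Y (F b) x * along X (pairing G Z (F c)) x
        + B b c d x * pairing G Z (F c) x * along X (pairing G Y (F b)) x) := by
    rw [along_congr hev, along_sum _ fun b _ => mdifferentiableAt_fun_sum _ fun c _ => hm b c]
    refine Finset.sum_congr rfl fun b _ => ?_
    rw [along_sum _ fun c _ => hm b c]
    refine Finset.sum_congr rfl fun c _ => ?_
    refine (along_mul ((hYF b).mul (hZF c)) (hBd b c d)).trans ?_
    refine (congrArg₂ (· + ·) rfl (congrArg _ (along_mul (hYF b) (hZF c)))).trans ?_
    simp only [Pi.mul_apply]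
    ring
  have h0 : G.inner x (covDeriv G X A Y Z x) (F d x)
      = pairing G (leviCivita G X (A Y Z)) (F d) x - pairing G (A (leviCivita G X Y) Z) (F d) x
        - pairing G (A Y (leviCivita G X Z)) (F d) x := by
    simp [covDeriv, pairing]
  have h5 : ∑ f, pairing G (A Y Z) (F f) x * connForm G F Θ X f d x
      = ∑ b, ∑ c, pairing G Y (F b) x * pairing G Z (F c) x
        * ∑ f, B b c f x * connForm G F Θ X f d x := by
    simp only [hA.inner hF hx hYd hZd, Finset.sum_mul, Finset.mul_sum]
    refine Finset.sum_comm.trans (Finset.sum_congr rfl fun b _ => ?_)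
    refine Finset.sum_comm.trans (Finset.sum_congr rfl fun c _ => ?_)
    exact Finset.sum_congr rfl fun f _ => by ring
  have h6 : pairing G (A (leviCivita G X Y) Z) (F d) x = ∑ b, ∑ c,
      (B b c d x * pairing G Z (F c) x * along X (pairing G Y (F b)) x
        + pairing G Y (F b) x * pairing G Z (F c) x
          * ∑ f, connForm G F Θ X b f x * B f c d x) := by
    rw [h2]
    simp only [hD.inner hF hx hXd hYd, add_mul, Finset.sum_add_distrib, Finset.mul_sum,
      Finset.sum_mul]
    congr 1
    · exact Finset.sum_congr rfl fun b _ => Finset.sum_congr rfl fun c _ => by ring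
    · refine (Finset.sum_congr rfl fun f _ => Finset.sum_comm).trans ?_
      refine Finset.sum_comm.trans (Finset.sum_congr rfl fun b _ => ?_)
      refine Finset.sum_comm.trans (Finset.sum_congr rfl fun c _ => ?_)
      exact Finset.sum_congr rfl fun f _ => by ring
  have h7 : pairing G (A Y (leviCivita G X Z)) (F d) x = ∑ b, ∑ c,
      (B b c d x * pairing G Y (F b) x * along X (pairing G Z (F c)) x
        + pairing G Y (F b) x * pairing G Z (F c) x
          * ∑ f, connForm G F Θ X c f x * B b f d x) := by
    rw [h3]
    simp only [hD.inner hF hx hXd hZd, add_mul, mul_add, Finset.sum_add_distrib, Finset.mul_sum,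
      Finset.sum_mul]
    congr 1
    · exact Finset.sum_congr rfl fun b _ => Finset.sum_congr rfl fun c _ => by ring
    · refine Finset.sum_congr rfl fun b _ => ?_
      refine Finset.sum_comm.trans (Finset.sum_congr rfl fun c _ => ?_)
      exact Finset.sum_congr rfl fun f _ => by ring
  rw [h0, h1, h4, h5, h6, h7]
  simp only [← Finset.sum_add_distrib, ← Finset.sum_sub_distrib]
  exact Finset.sum_congr rfl fun b _ => Finset.sum_congr rfl fun c _ => by ring

theorem connForm_antisymm (hΘ : ∀ x ∈ u, ∀ a b c, Θ a b c x = -Θ a c b x) (X : VField I M)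
    {x : M} (hx : x ∈ u) (b c : ι) : connForm G F Θ X b c x = -connForm G F Θ X c b x := by
  simp only [connForm, ← Finset.sum_neg_distrib]
  exact Finset.sum_congr rfl fun a _ => by rw [hΘ x hx a b c]; ring

/-- The covariant derivative of a tensor field with vanishing trace has vanishing trace. -/
theorem metricTrace_covDeriv_eq_zero (hF : IsOrthonormalFrameOn G F u)
    (hD : HasConnCoeffs G F u (leviCivita G) Θ)
    (hΘ : ∀ a b c, ContMDiffOn I 𝓘(ℝ, ℝ) ∞ (Θ a b c) u)
    (hanti : ∀ x ∈ u, ∀ a b c, Θ a b c x = -Θ a c b x) (hA : HasComponents G F u A B)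
    (hB : ∀ a b c, ContMDiffOn I 𝓘(ℝ, ℝ) ∞ (B a b c) u)
    (htr : ∀ x ∈ u, ∀ c, ∑ a, B a a c x = 0) {X : VField I M} (hX : CMDiff[u] ∞ (T% X)) {x : M}
    (hx : x ∈ u) : metricTrace G (covDeriv G X A) x = 0 := by
  have hcomp : ∀ (v : TangentSpace I x) (d : ι),
      G.inner x (covDeriv G X A (ext v) (ext v) x) (F d x)
      = ∑ b, ∑ c, G.inner x v (F b x) * G.inner x v (F c x) * (along X (B b c d) x
        + ∑ f, B b c f x * connForm G F Θ X f d x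
        - ∑ f, connForm G F Θ X b f x * B f c d x
        - ∑ f, connForm G F Θ X c f x * B b f d x) := by
    intro v d
    -- the extension of `v` is smooth only on some neighbourhood of `x`
    obtain ⟨s, hs, hsv⟩ := FiberBundle.exists_contMDiffOn_extend (I := I) (k := ∞) E v
    obtain ⟨t, hts, hto, hxt⟩ := mem_nhds_iff.1 hs
    have hut : u ∩ t ⊆ u := inter_subset_left
    have hv : CMDiff[u ∩ t] ∞ (T% (ext v : VField I M)) :=
      hsv.mono (inter_subset_right.trans hts)
    have h := inner_covDeriv (u := u ∩ t) (hF.mono (hF.isOpen.inter hto) hut)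
      (fun y hy => hD y (hut hy)) (fun a b c => (hΘ a b c).mono hut)
      (fun y hy => hA y (hut hy)) (fun a b c => (hB a b c).mono hut) (hX.mono hut) hv hv
      ⟨hx, hxt⟩ d
    simpa only [pairing, ext_self] using h
  have hd : ∀ {f : M → ℝ}, ContMDiffOn I 𝓘(ℝ, ℝ) ∞ f u → MDiffAt f x := fun hf =>
    mdifferentiableAt_of_contMDiffOn hf hF.isOpen hx
  refine eq_of_inner_eq G fun z => ?_
  rw [hF.inner_eq_sum hx, map_zero, zero_apply]
  refine Finset.sum_eq_zero fun d _ => mul_eq_zero_of_left ?_ _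
  have h1 : G.inner x (metricTrace G (covDeriv G X A) x) (F d x)
      = ∑ b, (along X (B b b d) x
        + ∑ f, B b b f x * connForm G F Θ X f d x
        - ∑ f, connForm G F Θ X b f x * B f b d x
        - ∑ f, connForm G F Θ X b f x * B b f d x) := by
    simp only [metricTrace, map_sum, sum_apply, hcomp]
    rw [Finset.sum_comm]
    refine Finset.sum_congr rfl fun b _ => ?_
    rw [Finset.sum_comm]
    simp only [← Finset.sum_mul, sum_inner_orthoBasis, hF.inner x hx]
    simp
  have h2 : ∑ b, along X (B b b d) x = 0 := by
    rw [← along_sum _ fun b _ => hd (hB b b d), along_congr (g := fun _ => 0), along_const]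
    filter_upwards [hF.isOpen.mem_nhds hx] with y hy
    exact htr y hy d
  have h3 : ∑ b, ∑ f, B b b f x * connForm G F Θ X f d x = 0 := by
    rw [Finset.sum_comm]
    simp only [← Finset.sum_mul, htr x hx, zero_mul, Finset.sum_const_zero]
  -- the two terms in which `D` acts on the arguments cancel, as `D` is skew-symmetric
  have h4 : ∑ b, ∑ f, connForm G F Θ X b f x * B b f d x
      = -∑ b, ∑ f, connForm G F Θ X b f x * B f b d x := by
    rw [Finset.sum_comm]
    simp only [← Finset.sum_neg_distrib]
    exact Finset.sum_congr rfl fun b _ => Finset.sum_congr rfl fun f _ => by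
      rw [connForm_antisymm hanti X hx f b]; ring
  rw [h1]
  simp only [Finset.sum_add_distrib, Finset.sum_sub_distrib, h2, h3, h4]
  ring

/-- In an orthonormal frame the Koszul expression only involves the structure functions. -/
theorem IsOrthonormalFrameOn.koszul_eq (hF : IsOrthonormalFrameOn G F u) {x : M} (hx : x ∈ u)
    (a b c : ι) : koszul G (F a) (F b) (F c) x = pairing G (bracket (F a) (F b)) (F c) x
      - pairing G (bracket (F a) (F c)) (F b) x - pairing G (bracket (F b) (F c)) (F a) x := by
  simp only [koszul, hF.along_pairing_frame hx]
  ring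

theorem HasConnCoeffs.congr {nab : VField I M → VField I M → VField I M}
    {Θ' : ι → ι → ι → M → ℝ} (h : HasConnCoeffs G F u nab Θ)
    (hΘ : ∀ x ∈ u, ∀ a b c, Θ a b c x = Θ' a b c x) : HasConnCoeffs G F u nab Θ' := by
  intro x hx X Y hX hY
  simp only [h x hx X Y hX hY, hΘ x hx]

end Traces

/-! ### Existence of orthonormal frames -/

section LocalFrames

open Set Filter Topology VectorField

variable {E : Type*} [NormedAddCommGroup E] [NormedSpace ℝ E] [FiniteDimensional ℝ E]
  {H : Type*} [TopologicalSpace H] {I : ModelWithCorners ℝ E H}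
  {M : Type*} [TopologicalSpace M] [ChartedSpace H M] [IsManifold I ∞ M]

theorem contMDiffOn_inner_bundle [RiemannianBundle (TangentSpace I : M → Type _)]
    [IsContMDiffRiemannianBundle I ∞ E (TangentSpace I : M → Type _)] {X Y : VField I M}
    {u : Set M} (hX : CMDiff[u] ∞ (T% X)) (hY : CMDiff[u] ∞ (T% Y)) :
    ContMDiffOn I 𝓘(ℝ, ℝ) ∞ (fun x => inner ℝ (X x) (Y x)) u :=
  ContMDiffOn.inner_bundle (IB := I) (n := ∞) (F := E) (E := (TangentSpace I : M → Type _))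
    (b := fun x : M => x) (v := fun x => X x) (w := fun x => Y x) hX hY

/-- The Gram–Schmidt process applied to smooth vector fields which are pointwise linearly
independent yields smooth vector fields. -/
theorem contMDiffOn_gramSchmidt {ι : Type*} [LinearOrder ι] [LocallyFiniteOrderBot ι]
    [WellFoundedLT ι] [RiemannianBundle (TangentSpace I : M → Type _)]
    [IsContMDiffRiemannianBundle I ∞ E (TangentSpace I : M → Type _)]
    {s : ι → VField I M} {u : Set M} (hs : ∀ i, CMDiff[u] ∞ (T% (s i)))
    (hli : ∀ x ∈ u, LinearIndependent ℝ fun i => s i x) (i : ι) :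
    CMDiff[u] ∞ (T% (fun x => InnerProductSpace.gramSchmidt ℝ (fun k => s k x) i)) := by
  induction i using WellFoundedLT.induction with
  | ind i ih =>
    have h : ∀ x ∈ u, InnerProductSpace.gramSchmidt ℝ (fun k => s k x) i = s i x
        + ∑ j ∈ Finset.Iio i,
          (-(inner ℝ (InnerProductSpace.gramSchmidt ℝ (fun k => s k x) j) (s i x) *
            (inner ℝ (InnerProductSpace.gramSchmidt ℝ (fun k => s k x) j)
            (InnerProductSpace.gramSchmidt ℝ (fun k => s k x) j))⁻¹)) •
            InnerProductSpace.gramSchmidt ℝ (fun k => s k x) j := by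
      intro x _
      rw [InnerProductSpace.gramSchmidt_def, sub_eq_add_neg, ← Finset.sum_neg_distrib]
      congr 1
      refine Finset.sum_congr rfl fun j _ => ?_
      rw [Submodule.starProjection_singleton, neg_smul, real_inner_self_eq_norm_sq]
      rfl
    refine ContMDiffOn.congr (ContMDiffOn.add_section (hs i)
      (ContMDiffOn.sum_section (s := Finset.Iio i) fun j hj => ?_)) fun x hx => by
        simp only [TotalSpace.mk_inj]; exact h x hx
    have hj' := ih j (Finset.mem_Iio.1 hj)
    refine ContMDiffOn.smul_section (((contMDiffOn_inner_bundle hj' (hs i)).mul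
      ((contMDiffOn_inner_bundle hj' hj').inv₀ fun x hx => ?_)).neg) hj'
    exact inner_self_ne_zero.2 (InnerProductSpace.gramSchmidt_ne_zero _ (hli x hx))

/-- The function `ξ ↦ ⟨ξ, F⟩` on the tangent bundle is smooth, for a smooth metric and a smooth
vector field `F`. -/
theorem contMDiffOn_inner (g : ContMDiffRiemannianMetric I ∞ E (TangentSpace I : M → Type _))
    {F : VField I M} {u : Set M} (hF : CMDiff[u] ∞ (T% F)) :
    ContMDiffOn I.tangent 𝓘(ℝ, ℝ) ∞
    (fun ξ : TangentBundle I M => g.toRiemannianMetric.inner ξ.1 ξ.2 (F ξ.1))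
      (TotalSpace.proj ⁻¹' u) := by
  let : RiemannianBundle (TangentSpace I : M → Type _) := ⟨g.toRiemannianMetric⟩
  have h1 : ContMDiffOn I.tangent I.tangent ∞ (fun ξ : TangentBundle I M => ξ)
    (TotalSpace.proj ⁻¹' u) := contMDiffOn_id
  have h2 : ContMDiffOn I.tangent I.tangent ∞
    (fun ξ : TangentBundle I M => (⟨ξ.1, F ξ.1⟩ : TangentBundle I M))
    (TotalSpace.proj ⁻¹' u) :=
    hF.comp (contMDiff_proj (TangentSpace I)).contMDiffOn fun _ h => h
  exact ContMDiffOn.inner_bundle (IB := I) (n := ∞) (F := E) (E := (TangentSpace I : M → Type _))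
    (b := fun ξ : TangentBundle I M => ξ.1) (v := fun ξ => ξ.2) (w := fun ξ => F ξ.1) h1 h2

theorem isOrthonormalFrameOn_of_inner {ι : Type*} [Fintype ι] [DecidableEq ι]
    (g : ContMDiffRiemannianMetric I ∞ E (TangentSpace I : M → Type _))
    {F : ι → VField I M} {u : Set M} (hu : IsOpen u) (hF : ∀ a, CMDiff[u] ∞ (T% (F a)))
    (hcard : Fintype.card ι = finrank ℝ E)
    (hinner : ∀ x ∈ u, ∀ a b,
      g.toRiemannianMetric.inner x (F a x) (F b x) = if a = b then 1 else 0) :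
    IsOrthonormalFrameOn g.toRiemannianMetric F u where
  isOpen := hu
  contMDiffOn := hF
  inner := hinner
  coeff a := contMDiffOn_inner g (hF a)
  sum x hx v := by
    let : RiemannianBundle (TangentSpace I : M → Type _) := ⟨g.toRiemannianMetric⟩
    have : FiniteDimensional ℝ (TangentSpace I x) := inferInstanceAs (FiniteDimensional ℝ E)
    have ho : Orthonormal ℝ fun a => F a x := orthonormal_iff_ite.2 (hinner x hx)
    let b := basisOfLinearIndependentOfCardEqFinrank' (fun a => F a x) ho.linearIndependent hcard
    have hb : ∀ a, b a = F a x := fun a =>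
      congrFun (coe_basisOfLinearIndependentOfCardEqFinrank' _ ho.linearIndependent hcard) a
    conv_rhs => rw [← b.sum_repr v]
    refine Finset.sum_congr rfl fun a _ => ?_
    conv_lhs => rw [← b.sum_repr v]
    simp only [hb, map_sum, map_smul, sum_apply, smul_apply, smul_eq_mul, hinner x hx]
    simp

/-- Near every point there is an orthonormal frame which consists of globally smooth vector fields.
It is orthonormal only near the point; the fields are global because flatness of a connection is a
condition on such fields. -/
theorem exists_isOrthonormalFrameOn [T2Space M]
    (g : ContMDiffRiemannianMetric I ∞ E (TangentSpace I : M → Type _)) (x : M) :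
    ∃ u, x ∈ u ∧ ∃ F : Fin (finrank ℝ E) → VField I M, (∀ a, IsSmoothField (F a)) ∧
      IsOrthonormalFrameOn g.toRiemannianMetric F u := by
  let : RiemannianBundle (TangentSpace I : M → Type _) := ⟨g.toRiemannianMetric⟩
  let t := trivializationAt E (TangentSpace I : M → Type _) x
  have hx : x ∈ t.baseSet := FiberBundle.mem_baseSet_trivializationAt E (TangentSpace I) x
  let b := finBasis ℝ E
  have ht := t.isLocalFrameOn_localFrame_baseSet I ∞ b
  let s : Fin (finrank ℝ E) → VField I M := t.localFrame b
  let f : Fin (finrank ℝ E) → VField I M := fun a y =>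
    InnerProductSpace.gramSchmidtNormed ℝ (fun k => s k y) a
  have hf : ∀ a, CMDiff[t.baseSet] ∞ (T% (f a)) := by
    intro a
    have h1 := contMDiffOn_gramSchmidt (s := s) ht.contMDiffOn
      (fun y hy => ht.linearIndependent hy) a
    have h2 := contMDiffOn_inner_bundle h1 h1
    have h3 : ∀ y ∈ t.baseSet, inner ℝ (InnerProductSpace.gramSchmidt ℝ (fun k => s k y) a)
      (InnerProductSpace.gramSchmidt ℝ (fun k => s k y) a) ≠ 0 := fun y hy =>
        inner_self_ne_zero.2 (InnerProductSpace.gramSchmidt_ne_zero _ (ht.linearIndependent hy))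
    have h4 : ContMDiffOn I 𝓘(ℝ, ℝ) ∞ (fun y => (Real.sqrt
        (inner ℝ (InnerProductSpace.gramSchmidt ℝ (fun k => s k y) a)
          (InnerProductSpace.gramSchmidt ℝ (fun k => s k y) a)))⁻¹) t.baseSet := fun y hy =>
      ((Real.contDiffAt_sqrt (n := ∞) (h3 y hy)).contMDiffAt.comp_contMDiffWithinAt y
        (h2 y hy)).inv₀ (Real.sqrt_ne_zero'.2 (lt_of_le_of_ne real_inner_self_nonneg (h3 y hy).symm))
    refine (h4.smul_section h1).congr fun y hy => ?_
    simp only [TotalSpace.mk_inj, f, InnerProductSpace.gramSchmidtNormed, norm_eq_sqrt_real_inner]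
    rfl
  have hfo : ∀ y ∈ t.baseSet, ∀ a b,
      g.toRiemannianMetric.inner y (f a y) (f b y) = if a = b then 1 else 0 :=
    fun y hy a b => by
      have h := InnerProductSpace.gramSchmidtNormed_orthonormal (𝕜 := ℝ) (E := TangentSpace I y)
        (ht.linearIndependent hy)
      exact orthonormal_iff_ite.1 h a b
  -- multiplication by a bump function turns the local frame into globally smooth vector fields
  obtain ⟨ψ, -, hψ⟩ := (SmoothBumpFunction.nhds_basis_tsupport (I := I) x).mem_iff.1
    (t.open_baseSet.mem_nhds hx)
  obtain ⟨v, hv, hvo, hxv⟩ := mem_nhds_iff.1 (inter_mem ψ.eventuallyEq_one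
    (t.open_baseSet.mem_nhds hx))
  have hsm : ∀ a, IsSmoothField ((ψ : M → ℝ) • f a) := fun a =>
    ContMDiffOn.smul_section_of_tsupport ψ.contMDiff.contMDiffOn t.open_baseSet hψ (hf a)
  refine ⟨v, hxv, fun a => (ψ : M → ℝ) • f a, hsm,
    isOrthonormalFrameOn_of_inner g hvo (fun a => (hsm a).contMDiffOn) (by simp) ?_⟩
  intro y hy a b
  have h1 : ψ y = 1 := (hv hy).1
  simpa [h1] using hfo y (hv hy).2 a b

end LocalFrames

/-! ### Flat torsion-free connections and the difference tensor -/

section FlatConnections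

open Set Filter Topology VectorField

variable {E : Type*} [NormedAddCommGroup E] [NormedSpace ℝ E] [FiniteDimensional ℝ E]
  {M : Type*} [TopologicalSpace M] [ChartedSpace E M] [IsManifold 𝓘(ℝ, E) ∞ M]
  {ι : Type*} [Fintype ι] [DecidableEq ι]
  {nab : CovariantDerivative 𝓘(ℝ, E) E (TangentSpace 𝓘(ℝ, E) : M → Type _)}
  {G : RiemannianMetric (TangentSpace 𝓘(ℝ, E) : M → Type _)}
  {F : ι → VField 𝓘(ℝ, E) M} {u : Set M}

theorem conn_add_right {X Y Y' : VField 𝓘(ℝ, E) M} {x : M} (hY : MDiffAt (T% Y) x)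
    (hY' : MDiffAt (T% Y') x) : conn nab X (Y + Y') x = conn nab X Y x + conn nab X Y' x := by
  simp [conn, nab.isCovariantDerivativeOnUniv.add hY hY']

theorem conn_smul_right {f : M → ℝ} {X Y : VField 𝓘(ℝ, E) M} {x : M} (hf : MDiffAt f x)
    (hY : MDiffAt (T% Y) x) :
    conn nab X (f • Y) x = f x • conn nab X Y x + along X f x • Y x := by
  simp [conn, nab.isCovariantDerivativeOnUniv.leibniz hY hf, along]

theorem isConnectionFormAt_conn (nab : CovariantDerivative 𝓘(ℝ, E) E
    (TangentSpace 𝓘(ℝ, E) : M → Type _)) (G : RiemannianMetric (TangentSpace 𝓘(ℝ, E) : M → Type _))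
    (x : M) : IsConnectionFormAt G x fun X Y Z => pairing G (conn nab X Y) Z x where
  left Y Z hY hZ := {
    smul := fun {f X} hf hX => by simp [pairing, conn]
    add := fun {X X'} hX hX' => by simp [pairing, conn] }
  right X Y hX hY := {
    smul := fun {f Z} hf hZ => by simp [pairing]
    add := fun {Z Z'} hZ hZ' => by simp [pairing] }
  add X Y Y' Z hX hY hY' hZ := by simp [pairing, conn_add_right hY hY']
  leibniz f X Y Z hf hX hY hZ := by simp [pairing, conn_smul_right hf hY]

/-- The connection coefficients `⟨∇_{F a} F b, F c⟩` of `∇`. -/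
def connCoeff (nab : CovariantDerivative 𝓘(ℝ, E) E (TangentSpace 𝓘(ℝ, E) : M → Type _))
    (G : RiemannianMetric (TangentSpace 𝓘(ℝ, E) : M → Type _)) (F : ι → VField 𝓘(ℝ, E) M)
    (a b c : ι) : M → ℝ :=
  pairing G (conn nab (F a) (F b)) (F c)

theorem hasConnCoeffs_conn (hF : IsOrthonormalFrameOn G F u) :
    HasConnCoeffs G F u (conn nab) (connCoeff nab G F) := by
  intro x hx X Y hX hY
  refine Eq.trans ?_
    (hasConnCoeffs_of_form hF (fun x _ => isConnectionFormAt_conn nab G x) x hx X Y hX hY)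
  refine eq_of_inner_eq G fun z => ?_
  simp only [pairing, ext_self]
  exact (inner_sharp G x (G.inner x (conn nab X Y x) : TangentSpace 𝓘(ℝ, E) x →ₗ[ℝ] ℝ) z).symm

theorem contMDiffOn_connCoeff
    (hsmooth : CovariantDerivative.ContMDiffCovariantDerivative nab ∞)
    (hF : IsOrthonormalFrameOn G F u) (hFs : ∀ a, IsSmoothField (F a)) (a b c : ι) :
    ContMDiffOn 𝓘(ℝ, E) 𝓘(ℝ, ℝ) ∞ (connCoeff nab G F a b c) u := by
  refine hF.contMDiffOn_pairing ?_ c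
  have h := hsmooth.contMDiff.contMDiff (σ := F b) (hFs b).contMDiffOn
  exact (ContMDiffOn.clm_bundle_apply (h.mono (subset_univ u)) (hF.contMDiffOn a))

/-- Since the connection is torsion-free, its coefficients determine the brackets of the frame
fields. -/
theorem inner_bracket_frame (htorsion : nab.torsion = 0) (hF : IsOrthonormalFrameOn G F u)
    {x : M} (hx : x ∈ u) (a b c : ι) :
    pairing G (bracket (F a) (F b)) (F c) x
      = connCoeff nab G F a b c x - connCoeff nab G F b a c x := by
  have h := nab.torsion_eq_zero_iff.1 htorsion (hF.mdifferentiableAt hx a)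
    (hF.mdifferentiableAt hx b)
  simp only [pairing, bracket, ← h, connCoeff, conn, map_sub, sub_apply]

/-- For a flat connection the curvature form vanishes on pairs of frame fields. -/
theorem curvForm_eq_zero (hsmooth : CovariantDerivative.ContMDiffCovariantDerivative nab ∞)
    (hflat : IsFlat nab) (hF : IsOrthonormalFrameOn G F u) (hFs : ∀ a, IsSmoothField (F a))
    {x : M} (hx : x ∈ u) (a b c d : ι) :
    curvForm G F (connCoeff nab G F) (F a) (F b) c d x = 0 := by
  have h := (hasConnCoeffs_conn (nab := nab) hF).inner_curvature hF
    (contMDiffOn_connCoeff hsmooth hF hFs)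
    (hF.contMDiffOn a) (hF.contMDiffOn b) (hF.contMDiffOn c) hx d
  rw [hflat _ _ _ (hFs a) (hFs b) (hFs c)] at h
  simpa [hF.inner x hx] using h.symm

/-- The connection coefficients of the Levi-Civita connection with respect to an orthonormal frame,
in terms of those of a torsion-free connection. -/
def lcCoeff (m : ι → ι → ι → M → ℝ) (a b c : ι) (x : M) : ℝ :=
  1 / 2 * ((m a b c x - m b a c x) - (m a c b x - m c a b x) - (m b c a x - m c b a x))

theorem lcCoeff_antisymm (m : ι → ι → ι → M → ℝ) (a b c : ι) (x : M) :
    lcCoeff m a b c x = -lcCoeff m a c b x := by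
  simp only [lcCoeff]
  ring

theorem contMDiffOn_lcCoeff {m : ι → ι → ι → M → ℝ}
    (hm : ∀ a b c, ContMDiffOn 𝓘(ℝ, E) 𝓘(ℝ, ℝ) ∞ (m a b c) u) (a b c : ι) :
    ContMDiffOn 𝓘(ℝ, E) 𝓘(ℝ, ℝ) ∞ (lcCoeff m a b c) u :=
  contMDiffOn_const.mul
    ((((hm a b c).sub (hm b a c)).sub ((hm a c b).sub (hm c a b))).sub ((hm b c a).sub (hm c b a)))

theorem hasConnCoeffs_lcCoeff (htorsion : nab.torsion = 0) (hF : IsOrthonormalFrameOn G F u) :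
    HasConnCoeffs G F u (leviCivita G) (lcCoeff (connCoeff nab G F)) :=
  (hasConnCoeffs_leviCivita hF).congr fun x hx a b c => by
    rw [hF.koszul_eq hx, inner_bracket_frame htorsion hF hx, inner_bracket_frame htorsion hF hx,
      inner_bracket_frame htorsion hF hx, lcCoeff]

/-- The components `⟨γ_{F a} F b, F c⟩` of the difference tensor. -/
def gamCoeff (nab : CovariantDerivative 𝓘(ℝ, E) E (TangentSpace 𝓘(ℝ, E) : M → Type _))
    (G : RiemannianMetric (TangentSpace 𝓘(ℝ, E) : M → Type _)) (F : ι → VField 𝓘(ℝ, E) M)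
    (a b c : ι) (x : M) : ℝ :=
  lcCoeff (connCoeff nab G F) a b c x - connCoeff nab G F a b c x

theorem hasComponents_gam (htorsion : nab.torsion = 0) (hF : IsOrthonormalFrameOn G F u) :
    HasComponents G F u (gam nab G) (gamCoeff nab G F) := by
  intro x hx X Y hX hY
  have h1 := hasConnCoeffs_lcCoeff htorsion hF x hx X Y hX hY
  have h2 := hasConnCoeffs_conn (nab := nab) hF x hx X Y hX hY
  rw [gam, Pi.sub_apply, h1, h2, ← Finset.sum_sub_distrib]
  refine Finset.sum_congr rfl fun c _ => ?_
  rw [← sub_smul, add_sub_add_left_eq_sub]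
  simp only [← Finset.sum_sub_distrib, gamCoeff, mul_sub]

theorem hasComponents_gamStar (htorsion : nab.torsion = 0) (hF : IsOrthonormalFrameOn G F u) :
    HasComponents G F u (gamStar nab G) fun a b c => gamCoeff nab G F a c b := by
  intro x hx X Y hX hY
  refine sharp_eq_sum fun z => ?_
  rw [hasComponents_gam htorsion hF x hx X (ext z) hX (mdifferentiableAt_ext z), ext_self]
  simp only [map_sum, map_smul, smul_eq_mul, Finset.sum_mul]
  rw [Finset.sum_comm]
  conv_rhs => rw [Finset.sum_comm]
  refine Finset.sum_congr rfl fun a _ => ?_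
  rw [Finset.sum_comm]
  refine Finset.sum_congr rfl fun b _ => Finset.sum_congr rfl fun c _ => ?_
  ring

theorem contMDiffOn_gamCoeff (hsmooth : CovariantDerivative.ContMDiffCovariantDerivative nab ∞)
    (hF : IsOrthonormalFrameOn G F u) (hFs : ∀ a, IsSmoothField (F a)) (a b c : ι) :
    ContMDiffOn 𝓘(ℝ, E) 𝓘(ℝ, ℝ) ∞ (gamCoeff nab G F a b c) u :=
  (contMDiffOn_lcCoeff (contMDiffOn_connCoeff hsmooth hF hFs) a b c).sub
    (contMDiffOn_connCoeff hsmooth hF hFs a b c)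

/-- The condition `tr γ = 0` in terms of the connection coefficients of `∇`. -/
theorem sum_connCoeff_of_metricTrace_gam (htorsion : nab.torsion = 0)
    (hF : IsOrthonormalFrameOn G F u) (htr : metricTrace G (gam nab G) = 0) {x : M} (hx : x ∈ u)
    (c : ι) : ∑ a, (connCoeff nab G F c a a x - connCoeff nab G F a c a x
      - connCoeff nab G F a a c x) = 0 := by
  rw [← sum_components_eq_zero hF (hasComponents_gam htorsion hF) htr hx c]
  refine Finset.sum_congr rfl fun a _ => ?_
  simp only [gamCoeff, lcCoeff]
  ring

/-- The condition `tr γ* = 0` in terms of the connection coefficients of `∇`. -/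
theorem sum_connCoeff_of_metricTrace_gamStar (htorsion : nab.torsion = 0)
    (hF : IsOrthonormalFrameOn G F u) (htr : metricTrace G (gamStar nab G) = 0) {x : M}
    (hx : x ∈ u) (c : ι) : ∑ a, connCoeff nab G F c a a x = 0 := by
  rw [← neg_eq_zero, ← sum_components_eq_zero hF (hasComponents_gamStar htorsion hF) htr hx c,
    ← Finset.sum_neg_distrib]
  refine Finset.sum_congr rfl fun a _ => ?_
  simp only [gamCoeff, lcCoeff]
  ring

theorem metricTrace_covDeriv_gam [T2Space M]
    (hsmooth : CovariantDerivative.ContMDiffCovariantDerivative nab ∞) (htorsion : nab.torsion = 0)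
    (g : ContMDiffRiemannianMetric 𝓘(ℝ, E) ∞ E (TangentSpace 𝓘(ℝ, E) : M → Type _))
    (htr : metricTrace g.toRiemannianMetric (gam nab g.toRiemannianMetric) = 0)
    {X : VField 𝓘(ℝ, E) M} (hX : IsSmoothField X) :
    metricTrace g.toRiemannianMetric (covDeriv g.toRiemannianMetric X
      (gam nab g.toRiemannianMetric)) = 0 := by
  funext x
  obtain ⟨u, hx, F, hFs, hF⟩ := exists_isOrthonormalFrameOn g x
  exact metricTrace_covDeriv_eq_zero hF (hasConnCoeffs_lcCoeff htorsion hF)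
    (contMDiffOn_lcCoeff (contMDiffOn_connCoeff hsmooth hF hFs))
    (fun x _ a b c => lcCoeff_antisymm _ a b c x) (hasComponents_gam htorsion hF)
    (contMDiffOn_gamCoeff hsmooth hF hFs)
    (fun x hx c => sum_components_eq_zero hF (hasComponents_gam htorsion hF) htr hx c)
    hX.contMDiffOn hx

theorem metricTrace_covDeriv_gamStar [T2Space M]
    (hsmooth : CovariantDerivative.ContMDiffCovariantDerivative nab ∞) (htorsion : nab.torsion = 0)
    (g : ContMDiffRiemannianMetric 𝓘(ℝ, E) ∞ E (TangentSpace 𝓘(ℝ, E) : M → Type _))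
    (htr : metricTrace g.toRiemannianMetric (gamStar nab g.toRiemannianMetric) = 0)
    {X : VField 𝓘(ℝ, E) M} (hX : IsSmoothField X) :
    metricTrace g.toRiemannianMetric (covDeriv g.toRiemannianMetric X
      (gamStar nab g.toRiemannianMetric)) = 0 := by
  funext x
  obtain ⟨u, hx, F, hFs, hF⟩ := exists_isOrthonormalFrameOn g x
  exact metricTrace_covDeriv_eq_zero hF (hasConnCoeffs_lcCoeff htorsion hF)
    (contMDiffOn_lcCoeff (contMDiffOn_connCoeff hsmooth hF hFs))
    (fun x _ a b c => lcCoeff_antisymm _ a b c x) (hasComponents_gamStar htorsion hF)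
    (fun a b c => contMDiffOn_gamCoeff hsmooth hF hFs a c b)
    (fun x hx c => sum_components_eq_zero hF (hasComponents_gamStar htorsion hF) htr hx c)
    hX.contMDiffOn hx

end FlatConnections

/-! ### Vector fields on the tangent bundle -/

section TangentBundleFields

open Set Filter Topology VectorField

variable {E : Type*} [NormedAddCommGroup E] [NormedSpace ℝ E] [FiniteDimensional ℝ E]
  {M : Type*} [TopologicalSpace M] [ChartedSpace E M] [IsManifold 𝓘(ℝ, E) ∞ M]
  {ι : Type*} [Fintype ι] [DecidableEq ι]
  {nab : CovariantDerivative 𝓘(ℝ, E) E (TangentSpace 𝓘(ℝ, E) : M → Type _)}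
  {G : RiemannianMetric (TangentSpace 𝓘(ℝ, E) : M → Type _)}
  {F : ι → VField 𝓘(ℝ, E) M} {u : Set M}

/-- The `i`-th fiber coordinate `q ↦ ⟨q, F i⟩` on `TM`; for an orthonormal frame `F` it is the
coefficient of `F i` in `q`. -/
def fiberCoord (G : RiemannianMetric (TangentSpace 𝓘(ℝ, E) : M → Type _))
    (F : ι → VField 𝓘(ℝ, E) M) (i : ι) (q : TangentBundle 𝓘(ℝ, E) M) : ℝ :=
  G.inner q.1 q.2 (F i q.1)

theorem IsOrthonormalFrameOn.isOpen_preimage (hF : IsOrthonormalFrameOn G F u) :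
    IsOpen (TotalSpace.proj ⁻¹' u : Set (TangentBundle 𝓘(ℝ, E) M)) :=
  hF.isOpen.preimage (FiberBundle.continuous_proj E (TangentSpace 𝓘(ℝ, E)))

theorem mdifferentiableAt_fiberCoord (hF : IsOrthonormalFrameOn G F u)
    {q : TangentBundle 𝓘(ℝ, E) M} (hq : q.1 ∈ u) (i : ι) : MDiffAt (fiberCoord G F i) q :=
  mdifferentiableAt_of_contMDiffOn (hF.coeff i) hF.isOpen_preimage hq

/-- The map `(x, c) ↦ ∑ i, c i • F i x` to the tangent bundle is smooth. Over the set where `F` is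
an orthonormal frame it inverts the map `(π, ℓ)` to the foot point and the fiber coordinates. -/
theorem contMDiff_sum_smul_frame (hFs : ∀ a, IsSmoothField (F a)) :
    ContMDiff (𝓘(ℝ, E).prod 𝓘(ℝ, ι → ℝ)) 𝓘(ℝ, E).tangent ∞ (fun p : M × (ι → ℝ) =>
      (⟨p.1, ∑ i, p.2 i • F i p.1⟩ : TangentBundle 𝓘(ℝ, E) M)) := by
  intro p
  rw [contMDiffAt_totalSpace]
  refine ⟨contMDiffAt_fst, ?_⟩
  have h1 : ∀ i, ContMDiffAt 𝓘(ℝ, E) 𝓘(ℝ, E) ∞ (fun x => (trivializationAt E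
      (TangentSpace 𝓘(ℝ, E)) p.1 (⟨x, F i x⟩ : TangentBundle 𝓘(ℝ, E) M)).2) p.1 :=
    fun i => (contMDiffAt_totalSpace.1 (hFs i p.1)).2
  have h2 : ∀ i, ContMDiffAt (𝓘(ℝ, E).prod 𝓘(ℝ, ι → ℝ)) 𝓘(ℝ, E) ∞ (fun y : M × (ι → ℝ) =>
      y.2 i • (trivializationAt E (TangentSpace 𝓘(ℝ, E)) p.1
        (⟨y.1, F i y.1⟩ : TangentBundle 𝓘(ℝ, E) M)).2) p := fun i =>
    ((contMDiffAt_pi_space.1 contMDiffAt_snd) i).smul ((h1 i).comp p contMDiffAt_fst)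
  refine (contMDiffAt_finsetSum (t := Finset.univ) fun i _ => h2 i).congr_of_eventuallyEq ?_
  have hb : (trivializationAt E (TangentSpace 𝓘(ℝ, E) : M → Type _) p.1).baseSet ∈ 𝓝 p.1 :=
    (trivializationAt E (TangentSpace 𝓘(ℝ, E)) p.1).open_baseSet.mem_nhds
      (FiberBundle.mem_baseSet_trivializationAt E (TangentSpace 𝓘(ℝ, E)) p.1)
  filter_upwards [continuousAt_fst.preimage_mem_nhds hb] with y hy
  have hl := (trivializationAt E (TangentSpace 𝓘(ℝ, E) : M → Type _) p.1).linear ℝ hy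
  refine (map_sum (hl.mk' _) (fun i => y.2 i • F i y.1) Finset.univ).trans ?_
  exact Finset.sum_congr rfl fun i _ => (hl.mk' _).map_smul (y.2 i) (F i y.1)

/-- A pair of smooth functions to a vector space `V` is a smooth map to `TV`. -/
theorem contMDiffOn_tangentBundle_vectorSpace {V : Type*} [NormedAddCommGroup V] [NormedSpace ℝ V]
    {E' : Type*} [NormedAddCommGroup E'] [NormedSpace ℝ E']
    {H' : Type*} [TopologicalSpace H'] {I' : ModelWithCorners ℝ E' H'}
    {N : Type*} [TopologicalSpace N] [ChartedSpace H' N] {s : Set N} {a b : N → V}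
    (ha : ContMDiffOn I' 𝓘(ℝ, V) ∞ a s) (hb : ContMDiffOn I' 𝓘(ℝ, V) ∞ b s) :
    ContMDiffOn I' 𝓘(ℝ, V).tangent ∞ (fun q => (⟨a q, b q⟩ : TangentBundle 𝓘(ℝ, V) V)) s := by
  intro q hq
  rw [contMDiffWithinAt_totalSpace]
  refine ⟨ha q hq, ?_⟩
  simpa using! hb q hq

theorem mfderiv_pi_apply {E' : Type*} [NormedAddCommGroup E'] [NormedSpace ℝ E']
    {H' : Type*} [TopologicalSpace H'] {I' : ModelWithCorners ℝ E' H'}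
    {N : Type*} [TopologicalSpace N] [ChartedSpace H' N] {f : N → ι → ℝ} {q : N}
    (hf : MDifferentiableAt I' 𝓘(ℝ, ι → ℝ) f q) (v : TangentSpace I' q) :
    (mfderiv I' 𝓘(ℝ, ι → ℝ) f q v : ι → ℝ) = fun i => mvfderiv I' (fun y => f y i) q v := by
  funext i
  have h := mfderiv_comp (I := I') (I' := 𝓘(ℝ, ι → ℝ)) (I'' := 𝓘(ℝ, ℝ)) q
    (ContinuousLinearMap.proj (R := ℝ) (φ := fun _ : ι => ℝ) i).mdifferentiableAt hf
  rw [ContinuousLinearMap.mfderiv_eq] at h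
  have h2 := DFunLike.congr_fun h v
  exact h2.symm

/-- A vector field on `TM` is smooth if its projection to `M` and the derivatives of the fiber
coordinates along it are. -/
theorem contMDiffOn_of_dproj_of_fiberCoord (hF : IsOrthonormalFrameOn G F u)
    (hFs : ∀ a, IsSmoothField (F a)) {Ξ : VField 𝓘(ℝ, E).tangent (TangentBundle 𝓘(ℝ, E) M)}
    (h1 : ContMDiffOn 𝓘(ℝ, E).tangent 𝓘(ℝ, E).tangent ∞
      (fun q => (⟨q.1, dproj q (Ξ q)⟩ : TangentBundle 𝓘(ℝ, E) M)) (TotalSpace.proj ⁻¹' u))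
    (h2 : ∀ i, ContMDiffOn 𝓘(ℝ, E).tangent 𝓘(ℝ, ℝ) ∞ (along Ξ (fiberCoord G F i))
      (TotalSpace.proj ⁻¹' u)) :
    CMDiff[(TotalSpace.proj ⁻¹' u : Set (TangentBundle 𝓘(ℝ, E) M))] ∞ (T% Ξ) := by
  set P : M × (ι → ℝ) → TangentBundle 𝓘(ℝ, E) M := fun p => ⟨p.1, ∑ i, p.2 i • F i p.1⟩ with hP
  have hPs := contMDiff_sum_smul_frame hFs
  let ℓ : TangentBundle 𝓘(ℝ, E) M → ι → ℝ := fun q i => fiberCoord G F i q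
  have hℓ : ContMDiffOn 𝓘(ℝ, E).tangent 𝓘(ℝ, ι → ℝ) ∞ ℓ (TotalSpace.proj ⁻¹' u) :=
    contMDiffOn_pi_space.2 hF.coeff
  have hℓs : ContMDiffOn 𝓘(ℝ, E).tangent 𝓘(ℝ, ι → ℝ).tangent ∞
      (fun q => (⟨ℓ q, fun i => along Ξ (fiberCoord G F i) q⟩ : TangentBundle 𝓘(ℝ, ι → ℝ) (ι → ℝ)))
      (TotalSpace.proj ⁻¹' u) := by
    have h3 : ContMDiffOn 𝓘(ℝ, E).tangent 𝓘(ℝ, ι → ℝ) ∞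
      (fun q i => along Ξ (fiberCoord G F i) q) (TotalSpace.proj ⁻¹' u) := contMDiffOn_pi_space.2 h2
    exact contMDiffOn_tangentBundle_vectorSpace hℓ h3
  have hs := ((hPs.contMDiff_tangentMap (m := ∞) (by simp)).comp
    contMDiff_equivTangentBundleProd_symm).comp_contMDiffOn (h1.prodMk hℓs)
  refine hs.congr fun q hq => ?_
  -- `P ∘ (π, ℓ)` is the identity near `q`, so `Ξ` is the image under `TP` of its image
  -- under `T(π, ℓ)`, and the latter is given by the functions which are smooth by assumption
  have hPq : ∀ q : TangentBundle 𝓘(ℝ, E) M, q.1 ∈ u → P (q.1, ℓ q) = q := fun q hq =>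
    congrArg (TotalSpace.mk q.1) (hF.sum q.1 hq q.2)
  have hℓd := mdifferentiableAt_of_contMDiffOn hℓ hF.isOpen_preimage hq
  have hπd : MDifferentiableAt 𝓘(ℝ, E).tangent 𝓘(ℝ, E)
    (fun q : TangentBundle 𝓘(ℝ, E) M => q.proj) q := mdifferentiableAt_proj _
  have hsd := hπd.prodMk hℓd
  let p : TangentBundle 𝓘(ℝ, E).tangent (TangentBundle 𝓘(ℝ, E) M) := ⟨q, Ξ q⟩
  have hc := tangentMap_comp_at (I' := 𝓘(ℝ, E).prod 𝓘(ℝ, ι → ℝ)) p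
    (hPs.mdifferentiable (by simp) (q.1, ℓ q)) hsd
  have hid : tangentMap 𝓘(ℝ, E).tangent 𝓘(ℝ, E).tangent (P ∘ fun q => (q.proj, ℓ q)) p = p := by
    have hu : UniqueMDiffWithinAt 𝓘(ℝ, E).tangent
        (TotalSpace.proj ⁻¹' u : Set (TangentBundle 𝓘(ℝ, E) M)) p.1 :=
      hF.isOpen_preimage.uniqueMDiffOn q hq
    have hd : MDifferentiableAt 𝓘(ℝ, E).tangent 𝓘(ℝ, E).tangent
        (P ∘ fun q => (q.proj, ℓ q)) p.1 :=
      mdifferentiableAt_id.congr_of_eventuallyEq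
        (eventuallyEq_of_mem (hF.isOpen_preimage.mem_nhds hq) hPq)
    exact (tangentMapWithin_eq_tangentMap (p := p) hu hd).symm.trans
      ((tangentMapWithin_congr (f₁ := id) (fun q hq => hPq q hq) p hq).trans
        (tangentMapWithin_id (p := p) hu))
  rw [hid] at hc
  refine hc.trans (congrArg (tangentMap _ _ _) ?_)
  rw [tangentMap, mfderiv_prodMk hπd hℓd]
  have hv : mfderiv 𝓘(ℝ, E).tangent 𝓘(ℝ, ι → ℝ) ℓ q (Ξ q) = fun i => along Ξ (fiberCoord G F i) q :=
    mfderiv_pi_apply hℓd (Ξ q)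
  exact congrArg (fun w : ι → ℝ => (⟨(q.1, ℓ q), (dproj q (Ξ q), w)⟩ :
    TangentBundle (𝓘(ℝ, E).prod 𝓘(ℝ, ι → ℝ)) (M × (ι → ℝ)))) hv

end TangentBundleFields

/-! ### Horizontal and vertical lifts -/

section Lifts

open Set Filter Topology VectorField

variable {E : Type*} [NormedAddCommGroup E] [NormedSpace ℝ E] [FiniteDimensional ℝ E]
  {M : Type*} [TopologicalSpace M] [ChartedSpace E M] [IsManifold 𝓘(ℝ, E) ∞ M]
  {ι : Type*} [Fintype ι] [DecidableEq ι]
  {nab : CovariantDerivative 𝓘(ℝ, E) E (TangentSpace 𝓘(ℝ, E) : M → Type _)}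
  {G : RiemannianMetric (TangentSpace 𝓘(ℝ, E) : M → Type _)}
  {F : ι → VField 𝓘(ℝ, E) M} {u : Set M}

theorem hLift_hPart_add_vLift_vPart (q : TangentBundle 𝓘(ℝ, E) M)
    (ξ : TangentSpace 𝓘(ℝ, E).tangent q) :
    hLift nab q (hPart nab q ξ) + vLift q (vPart nab q ξ) = ξ :=
  (split nab q).apply_symm_apply ξ

theorem hPart_hLift (q : TangentBundle 𝓘(ℝ, E) M) (v : TangentSpace 𝓘(ℝ, E) q.proj) :
    hPart nab q (hLift nab q v) = v := by
  have h : (split nab q).symm (hLift nab q v) = (v, 0) := by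
    rw [ContinuousLinearEquiv.symm_apply_eq, split_apply, map_zero, add_zero]
  exact congrArg Prod.fst h

theorem vPart_hLift (q : TangentBundle 𝓘(ℝ, E) M) (v : TangentSpace 𝓘(ℝ, E) q.proj) :
    vPart nab q (hLift nab q v) = 0 := by
  have h : (split nab q).symm (hLift nab q v) = (v, 0) := by
    rw [ContinuousLinearEquiv.symm_apply_eq, split_apply, map_zero, add_zero]
  exact congrArg Prod.snd h

theorem hPart_vLift (q : TangentBundle 𝓘(ℝ, E) M) (v : TangentSpace 𝓘(ℝ, E) q.proj) :
    hPart nab q (vLift q v) = 0 := by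
  have h : (split nab q).symm (vLift q v) = (0, v) := by
    rw [ContinuousLinearEquiv.symm_apply_eq, split_apply, map_zero, zero_add]
  exact congrArg Prod.fst h

theorem vPart_vLift (q : TangentBundle 𝓘(ℝ, E) M) (v : TangentSpace 𝓘(ℝ, E) q.proj) :
    vPart nab q (vLift q v) = v := by
  have h : (split nab q).symm (vLift q v) = (0, v) := by
    rw [ContinuousLinearEquiv.symm_apply_eq, split_apply, map_zero, zero_add]
  exact congrArg Prod.snd h

theorem hPart_eq_dproj (q : TangentBundle 𝓘(ℝ, E) M) (ξ : TangentSpace 𝓘(ℝ, E).tangent q) :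
    hPart nab q ξ = dproj q ξ := by
  conv_rhs => rw [← hLift_hPart_add_vLift_vPart (nab := nab) q ξ, map_add, dproj_hLift,
    dproj_vLift, add_zero]

theorem J1_hLift (q : TangentBundle 𝓘(ℝ, E) M) (v : TangentSpace 𝓘(ℝ, E) q.proj) :
    J1 nab q (hLift nab q v) = vLift q v := by
  change vLift q (hPart nab q _) - hLift nab q (vPart nab q _) = _
  rw [hPart_hLift, vPart_hLift, map_zero, sub_zero]

theorem J1_vLift (q : TangentBundle 𝓘(ℝ, E) M) (v : TangentSpace 𝓘(ℝ, E) q.proj) :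
    J1 nab q (vLift q v) = -hLift nab q v := by
  change vLift q (hPart nab q _) - hLift nab q (vPart nab q _) = _
  rw [hPart_vLift, vPart_vLift, map_zero, zero_sub]

theorem hPart_J1 (q : TangentBundle 𝓘(ℝ, E) M) (ξ : TangentSpace 𝓘(ℝ, E).tangent q) :
    hPart nab q (J1 nab q ξ) = -vPart nab q ξ := by
  change hPart nab q (vLift q (hPart nab q ξ) - hLift nab q (vPart nab q ξ)) = _
  rw [map_sub, hPart_vLift, hPart_hLift, zero_sub]

theorem vPart_J1 (q : TangentBundle 𝓘(ℝ, E) M) (ξ : TangentSpace 𝓘(ℝ, E).tangent q) :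
    vPart nab q (J1 nab q ξ) = hPart nab q ξ := by
  change vPart nab q (vLift q (hPart nab q ξ) - hLift nab q (vPart nab q ξ)) = _
  rw [map_sub, vPart_vLift, vPart_hLift, sub_zero]

theorem isSkew_J1 (nab : CovariantDerivative 𝓘(ℝ, E) E (TangentSpace 𝓘(ℝ, E) : M → Type _))
    (G : RiemannianMetric (TangentSpace 𝓘(ℝ, E) : M → Type _)) :
    IsSkew (g1 nab G) (J1 nab) := by
  intro q ξ η
  change g1Inner nab G q _ _ = -g1Inner nab G q _ _
  rw [g1Inner_apply, g1Inner_apply, hPart_J1, vPart_J1, hPart_J1, vPart_J1, map_neg, map_neg,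
    neg_apply, neg_apply, G.symm _ (hPart nab q ξ), G.symm _ (hPart nab q η)]
  ring

theorem inner_g1_hLift (q : TangentBundle 𝓘(ℝ, E) M) (ξ : TangentSpace 𝓘(ℝ, E).tangent q)
    (v : TangentSpace 𝓘(ℝ, E) q.proj) :
    (g1 nab G).inner q ξ (hLift nab q v) = G.inner q.proj (hPart nab q ξ) v := by
  change g1Inner nab G q _ _ = _
  rw [g1Inner_apply, hPart_hLift, vPart_hLift, map_zero, add_zero]

theorem inner_g1_vLift (q : TangentBundle 𝓘(ℝ, E) M) (ξ : TangentSpace 𝓘(ℝ, E).tangent q)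
    (v : TangentSpace 𝓘(ℝ, E) q.proj) :
    (g1 nab G).inner q ξ (vLift q v) = G.inner q.proj (vPart nab q ξ) v := by
  change g1Inner nab G q _ _ = _
  rw [g1Inner_apply, hPart_vLift, vPart_vLift, map_zero, zero_add]

theorem mvfderiv_comp_proj {f : M → ℝ} {q : TangentBundle 𝓘(ℝ, E) M} (hf : MDiffAt f q.1)
    (ξ : TangentSpace 𝓘(ℝ, E).tangent q) :
    mvfderiv 𝓘(ℝ, E).tangent (fun q : TangentBundle 𝓘(ℝ, E) M => f q.1) q ξ
      = mvfderiv 𝓘(ℝ, E) f q.1 (dproj q ξ) := by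
  have h := mfderiv_comp (I := 𝓘(ℝ, E).tangent) (I' := 𝓘(ℝ, E)) (I'' := 𝓘(ℝ, ℝ))
    (f := fun q : TangentBundle 𝓘(ℝ, E) M => q.proj) q hf (mdifferentiableAt_proj _)
  exact DFunLike.congr_fun h ξ

/-- Along a fiber the coordinate `⟨·, F i⟩` is linear, so it is its own derivative. -/
theorem mvfderiv_fiberCoord_vLift (hF : IsOrthonormalFrameOn G F u)
    {q : TangentBundle 𝓘(ℝ, E) M} (hq : q.1 ∈ u) (i : ι) (w : TangentSpace 𝓘(ℝ, E) q.proj) :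
    mvfderiv 𝓘(ℝ, E).tangent (fiberCoord G F i) q (vLift q w) = G.inner q.1 w (F i q.1) := by
  have hd := mdifferentiableAt_fiberCoord hF hq i
  obtain ⟨x, v⟩ := q
  change E at v
  have h := mfderiv_comp (I := 𝓘(ℝ, E)) (I' := 𝓘(ℝ, E).tangent) (I'' := 𝓘(ℝ, ℝ))
    (f := fun w : E => (⟨x, w⟩ : TangentBundle 𝓘(ℝ, E) M)) v hd (mdifferentiable_fiber x v)
  let B : E →L[ℝ] E →L[ℝ] ℝ := G.inner x
  let φ : E →L[ℝ] ℝ := B.flip (F i x)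
  have h2 : mfderiv 𝓘(ℝ, E) 𝓘(ℝ, ℝ) (fiberCoord G F i ∘
      fun w : E => (⟨x, w⟩ : TangentBundle 𝓘(ℝ, E) M)) v = φ := φ.mfderiv_eq
  rw [h2] at h
  exact (DFunLike.congr_fun h w).symm

/-- The derivative of a fiber coordinate along a horizontal vector: parallel transport changes the
coordinates by minus the connection form. The horizontal lift of `v` at `q` is the derivative of a
section `σ` through `q` in the direction `v`, minus the vertical lift of `∇_v σ`. -/
theorem mvfderiv_fiberCoord_hLift (hF : IsOrthonormalFrameOn G F u)
    {q : TangentBundle 𝓘(ℝ, E) M} (hq : q.1 ∈ u) (i : ι) (v : TangentSpace 𝓘(ℝ, E) q.proj) :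
    mvfderiv 𝓘(ℝ, E).tangent (fiberCoord G F i) q (hLift nab q v)
      = -∑ b, fiberCoord G F b q * ∑ a, G.inner q.1 v (F a q.1) * connCoeff nab G F a b i q.1 := by
  have hd := mdifferentiableAt_fiberCoord hF hq i
  have hs := mdifferentiableAt_ext (I := 𝓘(ℝ, E)) q.2
  let σ : VField 𝓘(ℝ, E) M := ext q.2
  have hσ : (⟨q.1, σ q.1⟩ : TangentBundle 𝓘(ℝ, E) M) = q := by simp [σ]
  have hc := mfderiv_comp_of_eq (I := 𝓘(ℝ, E)) (I' := 𝓘(ℝ, E).tangent) (I'' := 𝓘(ℝ, ℝ))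
    (g := fiberCoord G F i) hd hs hσ
  have h1 : mvfderiv 𝓘(ℝ, E).tangent (fiberCoord G F i) q (hLift nab q v)
      = along (ext v) (pairing G σ (F i)) q.1
        - mvfderiv 𝓘(ℝ, E).tangent (fiberCoord G F i) q (vLift q (nab σ q.1 v)) := by
    refine (map_sub _ _ _).trans (congrArg₂ _ ?_ rfl)
    have := DFunLike.congr_fun hc v
    -- the foot points `⟨q.1, σ q.1⟩` and `q` agree only propositionally
    have key : ∀ p : TangentBundle 𝓘(ℝ, E) M, p = q → ∀ ξ : E × E,
        (mfderiv 𝓘(ℝ, E).tangent 𝓘(ℝ, ℝ) (fiberCoord G F i) p ξ : ℝ)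
          = mvfderiv 𝓘(ℝ, E).tangent (fiberCoord G F i) q ξ := by
      rintro p rfl ξ
      rfl
    refine ((key _ hσ _).symm.trans this.symm).trans ?_
    change mvfderiv 𝓘(ℝ, E) (pairing G σ (F i)) q.1 v = along (ext v) (pairing G σ (F i)) q.1
    rw [along, ext_self]
  have h2 := (hasConnCoeffs_conn (nab := nab) hF).inner hF hq (mdifferentiableAt_ext v) hs i
  rw [h1, mvfderiv_fiberCoord_vLift hF hq]
  have h3 : G.inner q.1 (nab σ q.1 v) (F i q.1) = pairing G (conn nab (ext v) σ) (F i) q.1 := by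
    simp [pairing, conn]
  rw [h3, h2]
  simp [connForm, fiberCoord, pairing, σ]

/-- The vertical part in coordinates: `dℓ_i + ∑ b, ℓ_b θ_{bi}`, with the fiber coordinates `ℓ` and
the connection form `θ`. -/
theorem inner_vPart (hF : IsOrthonormalFrameOn G F u)
    {q : TangentBundle 𝓘(ℝ, E) M} (hq : q.1 ∈ u) (i : ι) (ξ : TangentSpace 𝓘(ℝ, E).tangent q) :
    G.inner q.1 (vPart nab q ξ) (F i q.1) = mvfderiv 𝓘(ℝ, E).tangent (fiberCoord G F i) q ξ
      + ∑ b, fiberCoord G F b q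
        * ∑ a, G.inner q.1 (dproj q ξ) (F a q.1) * connCoeff nab G F a b i q.1 := by
  have h : mvfderiv 𝓘(ℝ, E).tangent (fiberCoord G F i) q ξ
      = mvfderiv 𝓘(ℝ, E).tangent (fiberCoord G F i) q (hLift nab q (hPart nab q ξ))
        + mvfderiv 𝓘(ℝ, E).tangent (fiberCoord G F i) q (vLift q (vPart nab q ξ)) := by
    rw [← map_add, hLift_hPart_add_vLift_vPart]
  rw [h, mvfderiv_fiberCoord_hLift hF hq, mvfderiv_fiberCoord_vLift hF hq, hPart_eq_dproj]
  ring

theorem IsOrthonormalFrameOn.ext_inner (hF : IsOrthonormalFrameOn G F u) {x : M} (hx : x ∈ u)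
    {v w : TangentSpace 𝓘(ℝ, E) x} (h : ∀ i, G.inner x v (F i x) = G.inner x w (F i x)) :
    v = w := by
  rw [← hF.sum x hx v, ← hF.sum x hx w]
  simp only [h]

/-- A tangent vector of `TM` is determined by its projection and by the derivatives of the fiber
coordinates. -/
theorem eq_of_dproj_of_fiberCoord (nab : CovariantDerivative 𝓘(ℝ, E) E
    (TangentSpace 𝓘(ℝ, E) : M → Type _)) (hF : IsOrthonormalFrameOn G F u)
    {q : TangentBundle 𝓘(ℝ, E) M} (hq : q.1 ∈ u) {ξ η : TangentSpace 𝓘(ℝ, E).tangent q}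
    (h1 : dproj q ξ = dproj q η)
    (h2 : ∀ i, mvfderiv 𝓘(ℝ, E).tangent (fiberCoord G F i) q ξ
      = mvfderiv 𝓘(ℝ, E).tangent (fiberCoord G F i) q η) : ξ = η := by
  rw [← hLift_hPart_add_vLift_vPart (nab := nab) q ξ,
    ← hLift_hPart_add_vLift_vPart (nab := nab) q η, hPart_eq_dproj, hPart_eq_dproj, h1,
    hF.ext_inner hq (v := vPart nab q ξ) (w := vPart nab q η) fun i => by
      rw [inner_vPart hF hq, inner_vPart hF hq, h1, h2]]

/-- The horizontal lift of a vector field. -/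
def hField (nab : CovariantDerivative 𝓘(ℝ, E) E (TangentSpace 𝓘(ℝ, E) : M → Type _))
    (X : VField 𝓘(ℝ, E) M) : VField 𝓘(ℝ, E).tangent (TangentBundle 𝓘(ℝ, E) M) :=
  fun q => hLift nab q (X q.1)

/-- The vertical lift of a vector field. -/
def vField (X : VField 𝓘(ℝ, E) M) : VField 𝓘(ℝ, E).tangent (TangentBundle 𝓘(ℝ, E) M) :=
  fun q => vLift q (X q.1)

theorem along_hField_fiberCoord (hF : IsOrthonormalFrameOn G F u)
    {q : TangentBundle 𝓘(ℝ, E) M} (hq : q.1 ∈ u) (i : ι) (X : VField 𝓘(ℝ, E) M) :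
    along (hField nab X) (fiberCoord G F i) q
      = -∑ b, fiberCoord G F b q * connForm G F (connCoeff nab G F) X b i q.1 :=
  mvfderiv_fiberCoord_hLift hF hq i (X q.1)

theorem along_vField_fiberCoord (hF : IsOrthonormalFrameOn G F u)
    {q : TangentBundle 𝓘(ℝ, E) M} (hq : q.1 ∈ u) (i : ι) (X : VField 𝓘(ℝ, E) M) :
    along (vField X) (fiberCoord G F i) q = pairing G X (F i) q.1 :=
  mvfderiv_fiberCoord_vLift hF hq i (X q.1)

theorem along_hField_comp_proj {f : M → ℝ} {q : TangentBundle 𝓘(ℝ, E) M} (hf : MDiffAt f q.1)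
    (X : VField 𝓘(ℝ, E) M) :
    along (hField nab X) (fun q : TangentBundle 𝓘(ℝ, E) M => f q.1) q = along X f q.1 := by
  rw [along, mvfderiv_comp_proj hf, hField, dproj_hLift]
  rfl

theorem along_vField_comp_proj {f : M → ℝ} {q : TangentBundle 𝓘(ℝ, E) M} (hf : MDiffAt f q.1)
    (X : VField 𝓘(ℝ, E) M) :
    along (vField X) (fun q : TangentBundle 𝓘(ℝ, E) M => f q.1) q = 0 := by
  rw [along, mvfderiv_comp_proj hf, vField, dproj_vLift, map_zero]

theorem contMDiffOn_comp_proj {V : Type*} [NormedAddCommGroup V] [NormedSpace ℝ V]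
    {H : Type*} [TopologicalSpace H] {I : ModelWithCorners ℝ V H}
    {B : Type*} [TopologicalSpace B] [ChartedSpace H B] [IsManifold I ∞ B]
    {V' : Type*} [NormedAddCommGroup V'] [NormedSpace ℝ V']
    {H' : Type*} [TopologicalSpace H'] {I' : ModelWithCorners ℝ V' H'}
    {N : Type*} [TopologicalSpace N] [ChartedSpace H' N] {f : B → N} {s : Set B}
    (hf : ContMDiffOn I I' ∞ f s) :
    ContMDiffOn I.tangent I' ∞ (fun q : TangentBundle I B => f q.1) (TotalSpace.proj ⁻¹' s) :=
  hf.comp (contMDiff_proj (TangentSpace I)).contMDiffOn fun _ h => h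

theorem contMDiffOn_hField (hF : IsOrthonormalFrameOn G F u) (hFs : ∀ a, IsSmoothField (F a))
    (hm : ∀ a b c, ContMDiffOn 𝓘(ℝ, E) 𝓘(ℝ, ℝ) ∞ (connCoeff nab G F a b c) u)
    {X : VField 𝓘(ℝ, E) M} (hX : CMDiff[u] ∞ (T% X)) :
    CMDiff[(TotalSpace.proj ⁻¹' u : Set (TangentBundle 𝓘(ℝ, E) M))] ∞ (T% (hField nab X)) := by
  refine contMDiffOn_of_dproj_of_fiberCoord hF hFs ?_ fun i => ?_
  · simp only [hField, dproj_hLift]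
    exact contMDiffOn_comp_proj hX
  · refine (contMDiffOn_finsetSum (t := Finset.univ) fun b _ =>
      (hF.coeff b).mul (contMDiffOn_comp_proj (contMDiffOn_connForm hF hm hX b i))).neg.congr
        fun q hq => ?_
    rw [along_hField_fiberCoord hF hq]
    simp [fiberCoord]

theorem contMDiffOn_vField (hF : IsOrthonormalFrameOn G F u) (hFs : ∀ a, IsSmoothField (F a))
    {X : VField 𝓘(ℝ, E) M} (hX : CMDiff[u] ∞ (T% X)) :
    CMDiff[(TotalSpace.proj ⁻¹' u : Set (TangentBundle 𝓘(ℝ, E) M))] ∞ (T% (vField X)) := by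
  refine contMDiffOn_of_dproj_of_fiberCoord hF hFs ?_ fun i => ?_
  · simp only [vField, dproj_vLift]
    exact (contMDiff_zeroSection ℝ (TangentSpace 𝓘(ℝ, E))).comp_contMDiffOn
      (contMDiff_proj (TangentSpace 𝓘(ℝ, E))).contMDiffOn
  · exact (contMDiffOn_comp_proj (hF.contMDiffOn_pairing hX i)).congr fun q hq =>
      along_vField_fiberCoord hF hq i X

/-- Tangent vectors are separated by the functions which are smooth on the domain of a chart. -/
theorem eq_of_mvfderiv_eq {x : M} {v w : TangentSpace 𝓘(ℝ, E) x}
    (h : ∀ f : M → ℝ, ContMDiffOn 𝓘(ℝ, E) 𝓘(ℝ, ℝ) ∞ f (chartAt E x).source →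
      mvfderiv 𝓘(ℝ, E) f x v = mvfderiv 𝓘(ℝ, E) f x w) : v = w := by
  -- linear coordinates in the chart at `x` suffice
  have key : ∀ (φ : E →L[ℝ] ℝ) (v : E),
      (mvfderiv 𝓘(ℝ, E) (φ ∘ extChartAt 𝓘(ℝ, E) x) x v : ℝ) = φ v := by
    intro φ v
    have h1 := mfderiv_comp (I := 𝓘(ℝ, E)) (I' := 𝓘(ℝ, E)) (I'' := 𝓘(ℝ, ℝ)) x
      φ.mdifferentiableAt (mdifferentiableAt_extChartAt (mem_chart_source E x))
    rw [ContinuousLinearMap.mfderiv_eq, mfderiv_extChartAt_self] at h1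
    exact DFunLike.congr_fun h1 v
  refine (SeparatingDual.eq_iff_forall_dual_eq (R := ℝ) (V := E)).2 fun φ => ?_
  refine (key φ v).symm.trans (Eq.trans ?_ (key φ w))
  exact h _ (φ.contMDiff.comp_contMDiffOn contMDiffOn_extChartAt)

/-- The bracket of vector fields on `TM` which project to `X` and `Y` projects to `[X, Y]`. -/
theorem dproj_bracket (hu : IsOpen u) {X Y : VField 𝓘(ℝ, E) M}
    (hX : CMDiff[u] ∞ (T% X)) (hY : CMDiff[u] ∞ (T% Y))
    {Ξ Υ : VField 𝓘(ℝ, E).tangent (TangentBundle 𝓘(ℝ, E) M)}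
    (hΞ : CMDiff[(TotalSpace.proj ⁻¹' u : Set (TangentBundle 𝓘(ℝ, E) M))] ∞ (T% Ξ))
    (hΥ : CMDiff[(TotalSpace.proj ⁻¹' u : Set (TangentBundle 𝓘(ℝ, E) M))] ∞ (T% Υ))
    (hΞX : ∀ q : TangentBundle 𝓘(ℝ, E) M, dproj q (Ξ q) = X q.1)
    (hΥY : ∀ q : TangentBundle 𝓘(ℝ, E) M, dproj q (Υ q) = Y q.1)
    {q : TangentBundle 𝓘(ℝ, E) M} (hq : q.1 ∈ u) :
    dproj q (bracket Ξ Υ q) = bracket X Y q.1 := by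
  refine eq_of_mvfderiv_eq fun f hf => ?_
  have ho : IsOpen (u ∩ (chartAt E q.1).source) := hu.inter (chartAt E q.1).open_source
  have hqs : q.1 ∈ u ∩ (chartAt E q.1).source := ⟨hq, mem_chart_source E q.1⟩
  have hf' := hf.mono (inter_subset_right (s := u))
  have hX' := hX.mono (inter_subset_left (t := (chartAt E q.1).source))
  have hY' := hY.mono (inter_subset_left (t := (chartAt E q.1).source))
  have ho' : IsOpen (TotalSpace.proj ⁻¹' (u ∩ (chartAt E q.1).source) :
      Set (TangentBundle 𝓘(ℝ, E) M)) :=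
    ho.preimage (FiberBundle.continuous_proj E (TangentSpace 𝓘(ℝ, E)))
  have hsub : (TotalSpace.proj ⁻¹' (u ∩ (chartAt E q.1).source) :
      Set (TangentBundle 𝓘(ℝ, E) M)) ⊆ TotalSpace.proj ⁻¹' u := preimage_mono inter_subset_left
  have hfd : ∀ q' : TangentBundle 𝓘(ℝ, E) M, q'.1 ∈ u ∩ (chartAt E q.1).source → MDiffAt f q'.1 :=
    fun q' hq' => mdifferentiableAt_of_contMDiffOn hf' ho hq'
  have hnear : ∀ {Ξ : VField 𝓘(ℝ, E).tangent (TangentBundle 𝓘(ℝ, E) M)} {X : VField 𝓘(ℝ, E) M},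
      (∀ q : TangentBundle 𝓘(ℝ, E) M, dproj q (Ξ q) = X q.1) →
      along Ξ (fun q : TangentBundle 𝓘(ℝ, E) M => f q.1) =ᶠ[𝓝 q] fun q => along X f q.1 := by
    intro Ξ X h
    filter_upwards [ho'.mem_nhds hqs] with q' hq'
    rw [along, mvfderiv_comp_proj (hfd q' hq'), h]
    rfl
  have h1 := along_bracket ho' (contMDiffOn_comp_proj hf') (hΞ.mono hsub) (hΥ.mono hsub)
    (x := q) hqs
  rw [along_congr (hnear hΞX), along_congr (hnear hΥY), along,
    mvfderiv_comp_proj (hfd q hqs), along, along,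
    mvfderiv_comp_proj (mdifferentiableAt_of_contMDiffOn (contMDiffOn_along ho hX' hf') ho hqs),
    mvfderiv_comp_proj (mdifferentiableAt_of_contMDiffOn (contMDiffOn_along ho hY' hf') ho hqs),
    hΞX, hΥY] at h1
  exact h1.trans (along_bracket ho hf' hX' hY' hqs).symm

end Lifts

/-! ### Lie brackets of lifts -/

section LiftBrackets

open Set Filter Topology VectorField

variable {E : Type*} [NormedAddCommGroup E] [NormedSpace ℝ E] [FiniteDimensional ℝ E]
  {M : Type*} [TopologicalSpace M] [ChartedSpace E M] [IsManifold 𝓘(ℝ, E) ∞ M]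
  {ι : Type*} [Fintype ι] [DecidableEq ι]
  {nab : CovariantDerivative 𝓘(ℝ, E) E (TangentSpace 𝓘(ℝ, E) : M → Type _)}
  {G : RiemannianMetric (TangentSpace 𝓘(ℝ, E) : M → Type _)}
  {F : ι → VField 𝓘(ℝ, E) M} {u : Set M}

/-- For a flat connection the horizontal lift is compatible with Lie brackets. -/
theorem bracket_hField_hField (hF : IsOrthonormalFrameOn G F u) (hFs : ∀ a, IsSmoothField (F a))
    (hm : ∀ a b c, ContMDiffOn 𝓘(ℝ, E) 𝓘(ℝ, ℝ) ∞ (connCoeff nab G F a b c) u)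
    {X Y : VField 𝓘(ℝ, E) M} (hX : CMDiff[u] ∞ (T% X)) (hY : CMDiff[u] ∞ (T% Y))
    {q : TangentBundle 𝓘(ℝ, E) M} (hq : q.1 ∈ u)
    (hcurv : ∀ b c, curvForm G F (connCoeff nab G F) X Y b c q.1 = 0) :
    bracket (hField nab X) (hField nab Y) q = hLift nab q (bracket X Y q.1) := by
  have hXs := contMDiffOn_hField hF hFs hm hX
  have hYs := contMDiffOn_hField hF hFs hm hY
  refine eq_of_dproj_of_fiberCoord nab hF hq ?_ fun k => ?_
  · rw [dproj_hLift]
    exact dproj_bracket hF.isOpen hX hY hXs hYs (fun q => dproj_hLift nab q _)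
      (fun q => dproj_hLift nab q _) hq
  have hsecond : ∀ {X Y : VField 𝓘(ℝ, E) M}, CMDiff[u] ∞ (T% X) → CMDiff[u] ∞ (T% Y) →
      along (hField nab X) (along (hField nab Y) (fiberCoord G F k)) q
        = -∑ b, fiberCoord G F b q * (along X (connForm G F (connCoeff nab G F) Y b k) q.1
          - ∑ d, connForm G F (connCoeff nab G F) X b d q.1
            * connForm G F (connCoeff nab G F) Y d k q.1) := by
    intro X Y hX hY
    have hd : ∀ b, MDiffAt (connForm G F (connCoeff nab G F) Y b k) q.1 := fun b =>
      mdifferentiableAt_of_contMDiffOn (contMDiffOn_connForm hF hm hY b k) hF.isOpen hq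
    have hd' : ∀ b, MDiffAt (fun q : TangentBundle 𝓘(ℝ, E) M =>
        connForm G F (connCoeff nab G F) Y b k q.1) q := fun b =>
      mdifferentiableAt_of_contMDiffOn
        (contMDiffOn_comp_proj (contMDiffOn_connForm hF hm hY b k)) hF.isOpen_preimage hq
    have hnear : along (hField nab Y) (fiberCoord G F k) =ᶠ[𝓝 q]
        -fun q => ∑ b, (fiberCoord G F b * fun q : TangentBundle 𝓘(ℝ, E) M =>
          connForm G F (connCoeff nab G F) Y b k q.1) q := by
      filter_upwards [hF.isOpen_preimage.mem_nhds hq] with q' hq'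
      exact along_hField_fiberCoord hF hq' k Y
    rw [along_congr hnear, along_neg, along_sum _ fun b _ =>
      (mdifferentiableAt_fiberCoord hF hq b).mul (hd' b)]
    simp only [along_mul (mdifferentiableAt_fiberCoord hF hq _) (hd' _),
      along_hField_comp_proj (hd _), along_hField_fiberCoord hF hq, Finset.sum_add_distrib, mul_sub,
      Finset.sum_sub_distrib, mul_neg, Finset.sum_neg_distrib, Finset.mul_sum]
    rw [← sub_eq_add_neg]
    congr 2
    rw [Finset.sum_comm]
    exact Finset.sum_congr rfl fun b _ => Finset.sum_congr rfl fun d _ => by ring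
  have h1 := along_bracket hF.isOpen_preimage (hF.coeff k) hXs hYs (x := q) hq
  refine (h1.trans ?_).trans (along_hField_fiberCoord hF hq k (bracket X Y)).symm
  refine (congrArg₂ (· - ·) (hsecond hX hY) (hsecond hY hX)).trans ?_
  simp only [← Finset.sum_neg_distrib, ← Finset.sum_sub_distrib]
  refine Finset.sum_congr rfl fun b _ => ?_
  have hc := hcurv b k
  rw [curvForm] at hc
  linear_combination fiberCoord G F b q * hc

theorem bracket_zero_right (X : VField 𝓘(ℝ, E) M) : bracket X 0 = 0 :=
  mlieBracket_zero_right

/-- The derivative of the coordinate `⟨·, F k⟩` along the bracket is the derivative of `⟨Y, F k⟩`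
along `X`, plus the connection term, hence `⟨∇_X Y, F k⟩`. Flatness is not needed. -/
theorem bracket_hField_vField (hF : IsOrthonormalFrameOn G F u) (hFs : ∀ a, IsSmoothField (F a))
    (hm : ∀ a b c, ContMDiffOn 𝓘(ℝ, E) 𝓘(ℝ, ℝ) ∞ (connCoeff nab G F a b c) u)
    {X Y : VField 𝓘(ℝ, E) M} (hX : CMDiff[u] ∞ (T% X)) (hY : CMDiff[u] ∞ (T% Y))
    {q : TangentBundle 𝓘(ℝ, E) M} (hq : q.1 ∈ u) :
    bracket (hField nab X) (vField Y) q = vLift q (conn nab X Y q.1) := by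
  have hXs := contMDiffOn_hField hF hFs hm hX
  have hYs := contMDiffOn_vField hF hFs hY
  refine eq_of_dproj_of_fiberCoord nab hF hq ?_ fun k => ?_
  · rw [dproj_vLift, dproj_bracket hF.isOpen hX (Y := 0)
      (contMDiff_zeroSection ℝ (TangentSpace 𝓘(ℝ, E))).contMDiffOn hXs hYs
      (fun q => dproj_hLift nab q _) (fun q => dproj_vLift q _) hq, bracket_zero_right]
    rfl
  have h1 := along_bracket hF.isOpen_preimage (hF.coeff k) hXs hYs (x := q) hq
  refine (h1.trans ?_).trans (along_vField_fiberCoord hF hq k (conn nab X Y)).symm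
  have hnear1 : along (vField Y) (fiberCoord G F k) =ᶠ[𝓝 q] fun q => pairing G Y (F k) q.1 := by
    filter_upwards [hF.isOpen_preimage.mem_nhds hq] with q' hq'
    exact along_vField_fiberCoord hF hq' k Y
  have hd : ∀ b, MDiffAt (connForm G F (connCoeff nab G F) X b k) q.1 := fun b =>
    mdifferentiableAt_of_contMDiffOn (contMDiffOn_connForm hF hm hX b k) hF.isOpen hq
  have hd' : ∀ b, MDiffAt (fun q : TangentBundle 𝓘(ℝ, E) M =>
      connForm G F (connCoeff nab G F) X b k q.1) q := fun b =>
    mdifferentiableAt_of_contMDiffOn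
      (contMDiffOn_comp_proj (contMDiffOn_connForm hF hm hX b k)) hF.isOpen_preimage hq
  have hnear2 : along (hField nab X) (fiberCoord G F k) =ᶠ[𝓝 q]
      -fun q => ∑ b, (fiberCoord G F b * fun q : TangentBundle 𝓘(ℝ, E) M =>
        connForm G F (connCoeff nab G F) X b k q.1) q := by
    filter_upwards [hF.isOpen_preimage.mem_nhds hq] with q' hq'
    exact along_hField_fiberCoord hF hq' k X
  refine (congrArg₂ (· - ·) (along_congr hnear1) (along_congr hnear2)).trans ?_
  rw [along_neg, along_sum _ fun b _ => (mdifferentiableAt_fiberCoord hF hq b).mul (hd' b)]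
  simp only [along_mul (mdifferentiableAt_fiberCoord hF hq _) (hd' _),
    along_vField_comp_proj (hd _), along_vField_fiberCoord hF hq]
  rw [along_hField_comp_proj (mdifferentiableAt_of_contMDiffOn (hF.contMDiffOn_pairing hY k)
    hF.isOpen hq), (hasConnCoeffs_conn (nab := nab) hF).inner hF hq
    (mdifferentiableAt_of_contMDiffOn hX hF.isOpen hq)
    (mdifferentiableAt_of_contMDiffOn hY hF.isOpen hq), sub_neg_eq_add]
  congr 1
  exact Finset.sum_congr rfl fun b _ => by ring

theorem bracket_vField_vField (nab : CovariantDerivative 𝓘(ℝ, E) E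
    (TangentSpace 𝓘(ℝ, E) : M → Type _)) (hF : IsOrthonormalFrameOn G F u)
    (hFs : ∀ a, IsSmoothField (F a))
    {X Y : VField 𝓘(ℝ, E) M} (hX : CMDiff[u] ∞ (T% X)) (hY : CMDiff[u] ∞ (T% Y))
    {q : TangentBundle 𝓘(ℝ, E) M} (hq : q.1 ∈ u) :
    bracket (vField X) (vField Y) q = 0 := by
  have hXs := contMDiffOn_vField hF hFs hX
  have hYs := contMDiffOn_vField hF hFs hY
  have h0 : CMDiff[u] ∞ (T% (0 : VField 𝓘(ℝ, E) M)) :=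
    (contMDiff_zeroSection ℝ (TangentSpace 𝓘(ℝ, E))).contMDiffOn
  refine eq_of_dproj_of_fiberCoord nab hF hq ?_ fun k => ?_
  · rw [map_zero, dproj_bracket hF.isOpen h0 h0 hXs hYs (fun q => dproj_vLift q _)
      (fun q => dproj_vLift q _) hq, bracket_zero_right]
    rfl
  have hsecond : ∀ {X Y : VField 𝓘(ℝ, E) M}, CMDiff[u] ∞ (T% Y) →
      along (vField X) (along (vField Y) (fiberCoord G F k)) q = 0 := by
    intro X Y hY
    have hnear : along (vField Y) (fiberCoord G F k) =ᶠ[𝓝 q] fun q => pairing G Y (F k) q.1 := by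
      filter_upwards [hF.isOpen_preimage.mem_nhds hq] with q' hq'
      exact along_vField_fiberCoord hF hq' k Y
    rw [along_congr hnear, along_vField_comp_proj (mdifferentiableAt_of_contMDiffOn
      (hF.contMDiffOn_pairing hY k) hF.isOpen hq)]
  have h1 := along_bracket hF.isOpen_preimage (hF.coeff k) hXs hYs (x := q) hq
  rw [map_zero]
  exact h1.trans (by rw [sub_eq_zero]; exact (hsecond hY).trans (hsecond hX).symm)

end LiftBrackets

/-! ### The lifted frame -/

section LiftFrames

open Set Filter Topology VectorField

variable {E : Type*} [NormedAddCommGroup E] [NormedSpace ℝ E] [FiniteDimensional ℝ E]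
  {M : Type*} [TopologicalSpace M] [ChartedSpace E M] [IsManifold 𝓘(ℝ, E) ∞ M]
  {ι : Type*} [Fintype ι] [DecidableEq ι]
  {nab : CovariantDerivative 𝓘(ℝ, E) E (TangentSpace 𝓘(ℝ, E) : M → Type _)}
  {G : RiemannianMetric (TangentSpace 𝓘(ℝ, E) : M → Type _)}
  {F : ι → VField 𝓘(ℝ, E) M} {u : Set M}

/-- The frame of `T(TM)` which consists of the horizontal and the vertical lifts of a frame. -/
def liftFrame (nab : CovariantDerivative 𝓘(ℝ, E) E (TangentSpace 𝓘(ℝ, E) : M → Type _))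
    (F : ι → VField 𝓘(ℝ, E) M) :
    ι ⊕ ι → VField 𝓘(ℝ, E).tangent (TangentBundle 𝓘(ℝ, E) M) :=
  Sum.elim (fun i => hField nab (F i)) fun i => vField (F i)

/-- The function `ξ ↦ ⟨Tπ ξ, F i⟩` on `T(TM)` is smooth. -/
theorem contMDiffOn_inner_dproj (hF : IsOrthonormalFrameOn G F u) (i : ι) :
    ContMDiffOn 𝓘(ℝ, E).tangent.tangent 𝓘(ℝ, ℝ) ∞
      (fun ξ : TangentBundle 𝓘(ℝ, E).tangent (TangentBundle 𝓘(ℝ, E) M) =>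
        G.inner ξ.1.1 (dproj ξ.1 ξ.2) (F i ξ.1.1))
      (TotalSpace.proj ⁻¹' (TotalSpace.proj ⁻¹' u)) :=
  (hF.coeff i).comp ((contMDiff_proj (n := ∞) (TangentSpace 𝓘(ℝ, E) :
    M → Type _)).contMDiff_tangentMap (m := ∞) (by simp)).contMDiffOn fun _ h => h

theorem isOrthonormalFrameOn_liftFrame (hF : IsOrthonormalFrameOn G F u)
    (hFs : ∀ a, IsSmoothField (F a))
    (hm : ∀ a b c, ContMDiffOn 𝓘(ℝ, E) 𝓘(ℝ, ℝ) ∞ (connCoeff nab G F a b c) u) :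
    IsOrthonormalFrameOn (g1 nab G) (liftFrame nab F) (TotalSpace.proj ⁻¹' u) where
  isOpen := hF.isOpen_preimage
  contMDiffOn a := by
    rcases a with i | i
    · exact contMDiffOn_hField hF hFs hm (hF.contMDiffOn i)
    · exact contMDiffOn_vField hF hFs (hF.contMDiffOn i)
  inner q hq a b := by
    have h := hF.inner q.1 hq
    rcases a with i | i <;> rcases b with j | j <;>
      simp [liftFrame, hField, vField, inner_g1_hLift, inner_g1_vLift, hPart_hLift, hPart_vLift,
        vPart_hLift, vPart_vLift, h]
  sum q hq ξ := by
    rw [Fintype.sum_sum_type]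
    simp only [liftFrame, Sum.elim_inl, Sum.elim_inr, hField, vField, inner_g1_hLift,
      inner_g1_vLift, ← map_smul, ← map_sum, hF.sum q.1 hq]
    exact hLift_hPart_add_vLift_vPart q ξ
  coeff a := by
    rcases a with i | i
    · refine (contMDiffOn_inner_dproj hF i).congr fun ξ _ => ?_
      rw [← hPart_eq_dproj (nab := nab)]
      exact inner_g1_hLift ξ.1 ξ.2 (F i ξ.1.1)
    · have h := (contMDiffOn_mvfderiv hF.isOpen_preimage (hF.coeff i)).add
        (contMDiffOn_finsetSum (t := Finset.univ) fun b _ =>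
          (contMDiffOn_comp_proj (hF.coeff b)).mul
          (contMDiffOn_finsetSum (t := Finset.univ) fun a _ => (contMDiffOn_inner_dproj hF a).mul
            (contMDiffOn_comp_proj (contMDiffOn_comp_proj (hm a b i)))))
      refine h.congr fun ξ hξ => ?_
      refine (inner_g1_vLift ξ.1 ξ.2 (F i ξ.1.1)).trans ((inner_vPart hF hξ i ξ.2).trans ?_)
      simp [fiberCoord]
      rfl

theorem app_J1_hField (X : VField 𝓘(ℝ, E) M) : app (J1 nab) (hField nab X) = vField X :=
  funext fun q => J1_hLift q (X q.1)

theorem app_J1_vField (X : VField 𝓘(ℝ, E) M) : app (J1 nab) (vField X) = -hField nab X :=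
  funext fun q => J1_vLift q (X q.1)

/-- `1` for horizontal and `-1` for vertical indices, so that `J₁` maps the member of the lifted
frame with index `a` to `liftSign a` times the one with index `a.swap`. -/
def liftSign : ι ⊕ ι → ℝ := Sum.elim (fun _ => 1) fun _ => -1

theorem app_J1_liftFrame (a : ι ⊕ ι) :
    app (J1 nab) (liftFrame nab F a)
      = (fun _ : TangentBundle 𝓘(ℝ, E) M => liftSign a) • liftFrame nab F a.swap := by
  rcases a with i | i
  · simp only [liftFrame, Sum.elim_inl, app_J1_hField, liftSign, Sum.swap_inl, Sum.elim_inr]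
    funext q; simp
  · simp only [liftFrame, Sum.elim_inl, app_J1_vField, liftSign, Sum.swap_inr, Sum.elim_inr]
    funext q; simp

theorem preservesDiffAt_J1 (hF' : IsOrthonormalFrameOn (g1 nab G) (liftFrame nab F)
    (TotalSpace.proj ⁻¹' u)) {q : TangentBundle 𝓘(ℝ, E) M} (hq : q.1 ∈ u) :
    PreservesDiffAt (J1 nab) q := by
  intro X hX
  have h := MDifferentiableAt.sum_section (s := Finset.univ) fun a _ =>
    (hF'.mdifferentiableAt_pairing (x := q) hq hX a).smul_section
    ((mdifferentiableAt_const (c := liftSign a)).smul_section (hF'.mdifferentiableAt hq a.swap))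
  refine h.congr_of_eventuallyEq ?_
  filter_upwards [hF'.isOpen.mem_nhds hq] with p hp
  simp only [TotalSpace.mk_inj]
  conv_lhs => rw [app, ← hF'.sum p hp (X p), map_sum]
  refine Finset.sum_congr rfl fun a _ => ?_
  rw [map_smul]
  exact congrArg _ (congrFun (app_J1_liftFrame a) p)

/-- The matrix of `J₁` in the lifted frame. -/
def liftMatrix (ι : Type*) [DecidableEq ι] : Matrix (ι ⊕ ι) (ι ⊕ ι) ℝ :=
  Matrix.fromBlocks 0 1 (-1) 0

theorem inner_J1_liftFrame (hF' : IsOrthonormalFrameOn (g1 nab G) (liftFrame nab F)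
    (TotalSpace.proj ⁻¹' u)) {q : TangentBundle 𝓘(ℝ, E) M} (hq : q.1 ∈ u) (b c : ι ⊕ ι) :
    (g1 nab G).inner q (liftFrame nab F c q) (J1 nab q (liftFrame nab F b q))
      = liftMatrix ι b c := by
  have h := congrFun (app_J1_liftFrame (nab := nab) (F := F) b) q
  rw [app] at h
  rw [h, Pi.smul_apply', map_smul, hF'.inner q hq]
  rcases b with i | i <;> rcases c with j | j <;>
    simp [liftSign, liftMatrix, Matrix.one_apply, eq_comm]
  split_ifs <;> simp

/-- The structure functions `g₁([F_a, F_b], F_c)` of the lifted frame, in terms of the connection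
coefficients `m` of `∇` at the foot point. The only brackets which do not vanish are
`[X^h, Y^h] = [X, Y]^h` and `[X^h, Y^v] = (∇_X Y)^v`. -/
def liftBracketCoeff (m : ι → ι → ι → ℝ) : ι ⊕ ι → ι ⊕ ι → ι ⊕ ι → ℝ
  | .inl i, .inl j, .inl k => m i j k - m j i k
  | .inl i, .inr j, .inr k => m i j k
  | .inr i, .inl j, .inr k => -m j i k
  | _, _, _ => 0

theorem inner_bracket_liftFrame
    (hsmooth : CovariantDerivative.ContMDiffCovariantDerivative nab ∞) (htorsion : nab.torsion = 0)
    (hflat : IsFlat nab) (hF : IsOrthonormalFrameOn G F u) (hFs : ∀ a, IsSmoothField (F a))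
    {q : TangentBundle 𝓘(ℝ, E) M} (hq : q.1 ∈ u) (a b c : ι ⊕ ι) :
    pairing (g1 nab G) (bracket (liftFrame nab F a) (liftFrame nab F b)) (liftFrame nab F c) q
      = liftBracketCoeff (fun i j k => connCoeff nab G F i j k q.1) a b c := by
  have hm := contMDiffOn_connCoeff hsmooth hF hFs
  have hc := hF.contMDiffOn
  -- flatness enters only here
  have hhh : ∀ i j, bracket (hField nab (F i)) (hField nab (F j)) q
      = hLift nab q (bracket (F i) (F j) q.1) := fun i j =>
    bracket_hField_hField hF hFs hm (hc i) (hc j) hq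
      fun b c => curvForm_eq_zero hsmooth hflat hF hFs hq i j b c
  have hhv : ∀ i j, bracket (hField nab (F i)) (vField (F j)) q
      = vLift q (conn nab (F i) (F j) q.1) := fun i j =>
    bracket_hField_vField hF hFs hm (hc i) (hc j) hq
  have hvh : ∀ i j, bracket (vField (F i)) (hField nab (F j)) q
      = -vLift q (conn nab (F j) (F i) q.1) := fun i j => by
    rw [bracket_swap, Pi.neg_apply, hhv]
  have hvv : ∀ i j, bracket (vField (F i)) (vField (F j)) q = 0 := fun i j =>
    bracket_vField_vField nab hF hFs (hc i) (hc j) hq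
  have hb := fun i j k => inner_bracket_frame htorsion hF hq i j k
  simp only [pairing] at hb
  rcases a with i | i <;> rcases b with j | j <;> rcases c with k | k <;>
    simp [pairing, liftFrame, liftBracketCoeff, hhh, hhv, hvh, hvv, hField, vField, inner_g1_hLift,
      inner_g1_vLift, hPart_hLift, hPart_vLift, vPart_hLift, vPart_vLift, hb, connCoeff]

end LiftFrames

/-! ### The Bismut and Chern connections of the tangent bundle -/

section RicciForms

open Set Filter Topology VectorField

variable {E : Type*} [NormedAddCommGroup E] [NormedSpace ℝ E] [FiniteDimensional ℝ E]
  {M : Type*} [TopologicalSpace M] [ChartedSpace E M] [IsManifold 𝓘(ℝ, E) ∞ M]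
  {ι : Type*} [Fintype ι] [DecidableEq ι]
  {nab : CovariantDerivative 𝓘(ℝ, E) E (TangentSpace 𝓘(ℝ, E) : M → Type _)}
  {G : RiemannianMetric (TangentSpace 𝓘(ℝ, E) : M → Type _)}
  {F : ι → VField 𝓘(ℝ, E) M} {u : Set M}

/-- The connection coefficients of the Levi-Civita connection in the lifted frame. -/
def liftLCCoeff (m : ι → ι → ι → ℝ) (a b c : ι ⊕ ι) : ℝ :=
  1 / 2 * (liftBracketCoeff m a b c - liftBracketCoeff m a c b - liftBracketCoeff m b c a)

/-- The values `dω(F_a, F_b, F_c)` on the lifted frame. -/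
def liftDFundCoeff (m : ι → ι → ι → ℝ) (a b c : ι ⊕ ι) : ℝ :=
  liftSign c * liftBracketCoeff m a b c.swap - liftSign b * liftBracketCoeff m a c b.swap
    + liftSign a * liftBracketCoeff m b c a.swap

/-- The connection coefficients of the Bismut connection in the lifted frame. -/
def liftBismutCoeff (m : ι → ι → ι → ℝ) (a b c : ι ⊕ ι) : ℝ :=
  liftLCCoeff m a b c
    + 1 / 2 * (liftSign a * liftSign b * liftSign c * liftDFundCoeff m a.swap b.swap c.swap)

/-- The connection coefficients of the Chern connection in the lifted frame. -/
def liftChernCoeff (m : ι → ι → ι → ℝ) (a b c : ι ⊕ ι) : ℝ :=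
  liftLCCoeff m a b c + -(1 / 2) * (liftSign a * liftDFundCoeff m a.swap b c)

theorem fundForm_liftFrame_left (a : ι ⊕ ι)
    (X : VField 𝓘(ℝ, E).tangent (TangentBundle 𝓘(ℝ, E) M)) (q : TangentBundle 𝓘(ℝ, E) M) :
    fundForm (g1 nab G) (J1 nab) (liftFrame nab F a) X q
      = liftSign a * pairing (g1 nab G) X (liftFrame nab F a.swap) q := by
  rw [fundForm, app_J1_liftFrame, pairing_smul_left, pairing_symm]
  rfl

/-- The fundamental form is constant in the lifted frame, so only the bracket terms of `dω`
remain. -/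
theorem dFundForm_liftFrame
    (hF' : IsOrthonormalFrameOn (g1 nab G) (liftFrame nab F) (TotalSpace.proj ⁻¹' u))
    {q : TangentBundle 𝓘(ℝ, E) M} (hq : q.1 ∈ u) {m : ι → ι → ι → ℝ}
    (hbr : ∀ a b c, pairing (g1 nab G) (bracket (liftFrame nab F a) (liftFrame nab F b))
      (liftFrame nab F c) q = liftBracketCoeff m a b c) (a b c : ι ⊕ ι) :
    dFundForm (g1 nab G) (J1 nab) (liftFrame nab F a) (liftFrame nab F b) (liftFrame nab F c) q
      = liftDFundCoeff m a b c := by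
  have h0 : ∀ (X : VField 𝓘(ℝ, E).tangent (TangentBundle 𝓘(ℝ, E) M)) (b c : ι ⊕ ι),
      along X (fundForm (g1 nab G) (J1 nab) (liftFrame nab F b) (liftFrame nab F c)) q = 0 := by
    intro X b c
    have : fundForm (g1 nab G) (J1 nab) (liftFrame nab F b) (liftFrame nab F c)
        =ᶠ[𝓝 q] fun _ => liftSign b * if c = b.swap then 1 else 0 := by
      filter_upwards [hF'.isOpen.mem_nhds hq] with p hp
      rw [fundForm_liftFrame_left, pairing, hF'.inner p hp]
    rw [along_congr this, along_const]
  have h1 : ∀ (X : VField 𝓘(ℝ, E).tangent (TangentBundle 𝓘(ℝ, E) M)) (c : ι ⊕ ι),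
      fundForm (g1 nab G) (J1 nab) X (liftFrame nab F c) q
        = -(liftSign c * pairing (g1 nab G) X (liftFrame nab F c.swap) q) := by
    intro X c
    rw [fundForm_swap (isSkew_J1 nab G), Pi.neg_apply, fundForm_liftFrame_left]
  simp only [dFundForm, h0, h1, hbr, liftDFundCoeff]
  ring

theorem koszul_liftFrame
    (hF' : IsOrthonormalFrameOn (g1 nab G) (liftFrame nab F) (TotalSpace.proj ⁻¹' u))
    {q : TangentBundle 𝓘(ℝ, E) M} (hq : q.1 ∈ u) {m : ι → ι → ι → ℝ}
    (hbr : ∀ a b c, pairing (g1 nab G) (bracket (liftFrame nab F a) (liftFrame nab F b))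
      (liftFrame nab F c) q = liftBracketCoeff m a b c) (a b c : ι ⊕ ι) :
    1 / 2 * koszul (g1 nab G) (liftFrame nab F a) (liftFrame nab F b) (liftFrame nab F c) q
      = liftLCCoeff m a b c := by
  rw [hF'.koszul_eq (x := q) hq, hbr, hbr, hbr, liftLCCoeff]

theorem bismutForm_liftFrame
    (hF' : IsOrthonormalFrameOn (g1 nab G) (liftFrame nab F) (TotalSpace.proj ⁻¹' u))
    {q : TangentBundle 𝓘(ℝ, E) M} (hq : q.1 ∈ u) {m : ι → ι → ι → ℝ}
    (hbr : ∀ a b c, pairing (g1 nab G) (bracket (liftFrame nab F a) (liftFrame nab F b))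
      (liftFrame nab F c) q = liftBracketCoeff m a b c) (a b c : ι ⊕ ι) :
    bismutForm (g1 nab G) (J1 nab) q (liftFrame nab F a) (liftFrame nab F b) (liftFrame nab F c)
      = liftBismutCoeff m a b c := by
  have hd := hF'.mdifferentiableAt (x := q) hq
  have hJd := fun a => preservesDiffAt_J1 hF' hq _ (hd a)
  have ht := isTensorialAt₃_dFundForm (hF'.pairsDiffAt hq) (preservesDiffAt_J1 hF' hq)
    (isSkew_J1 nab G)
  simp only [app_J1_liftFrame] at hJd
  rw [bismutForm, koszul_liftFrame hF' hq hbr]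
  simp only [app_J1_liftFrame]
  rw [(ht.left _ _ (hJd b) (hJd c)).smul mdifferentiableAt_const (hd _),
    (ht.middle _ _ (hd _) (hJd c)).smul mdifferentiableAt_const (hd _),
    (ht.right _ _ (hd _) (hd _)).smul mdifferentiableAt_const (hd _),
    dFundForm_liftFrame hF' hq hbr, liftBismutCoeff]
  simp only [smul_eq_mul]
  ring

theorem chernForm_liftFrame
    (hF' : IsOrthonormalFrameOn (g1 nab G) (liftFrame nab F) (TotalSpace.proj ⁻¹' u))
    {q : TangentBundle 𝓘(ℝ, E) M} (hq : q.1 ∈ u) {m : ι → ι → ι → ℝ}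
    (hbr : ∀ a b c, pairing (g1 nab G) (bracket (liftFrame nab F a) (liftFrame nab F b))
      (liftFrame nab F c) q = liftBracketCoeff m a b c) (a b c : ι ⊕ ι) :
    chernForm (g1 nab G) (J1 nab) q (liftFrame nab F a) (liftFrame nab F b) (liftFrame nab F c)
      = liftChernCoeff m a b c := by
  have hd := hF'.mdifferentiableAt (x := q) hq
  have ht := isTensorialAt₃_dFundForm (hF'.pairsDiffAt hq) (preservesDiffAt_J1 hF' hq)
    (isSkew_J1 nab G)
  rw [chernForm, koszul_liftFrame hF' hq hbr, app_J1_liftFrame,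
    (ht.left _ _ (hd b) (hd c)).smul mdifferentiableAt_const (hd _),
    dFundForm_liftFrame hF' hq hbr, liftChernCoeff, smul_eq_mul]

/-- A matrix which commutes with that of `J₁` is one with blocks `A, B, -B, A`. -/
theorem commute_transpose_liftMatrix {Θ : ι ⊕ ι → ι ⊕ ι → ℝ}
    (h1 : ∀ j k, Θ (.inl j) (.inl k) = Θ (.inr j) (.inr k))
    (h2 : ∀ j k, Θ (.inl j) (.inr k) = -Θ (.inr j) (.inl k)) :
    Commute (liftMatrix ι).transpose (Matrix.of Θ) := by
  ext b c
  rcases b with j | j <;> rcases c with k | k <;>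
    simp [Matrix.mul_apply, liftMatrix, Fintype.sum_sum_type, Matrix.one_apply, h1, h2]

theorem commute_liftBismutCoeff (m : ι → ι → ι → ℝ) (a : ι ⊕ ι) :
    Commute (liftMatrix ι).transpose (Matrix.of fun b c => liftBismutCoeff m a b c) := by
  refine commute_transpose_liftMatrix (fun j k => ?_) fun j k => ?_ <;> rcases a with i | i <;>
    simp only [liftBismutCoeff, liftDFundCoeff, liftLCCoeff, liftBracketCoeff, liftSign,
      Sum.swap_inl, Sum.swap_inr, Sum.elim_inl, Sum.elim_inr] <;> ring

theorem commute_liftChernCoeff (m : ι → ι → ι → ℝ) (a : ι ⊕ ι) :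
    Commute (liftMatrix ι).transpose (Matrix.of fun b c => liftChernCoeff m a b c) := by
  refine commute_transpose_liftMatrix (fun j k => ?_) fun j k => ?_ <;> rcases a with i | i <;>
    simp only [liftChernCoeff, liftDFundCoeff, liftLCCoeff, liftBracketCoeff, liftSign,
      Sum.swap_inl, Sum.swap_inr, Sum.elim_inl, Sum.elim_inr] <;> ring

/-- The trace of a matrix against that of `J₁` only involves its off-diagonal blocks. -/
theorem sum_mul_liftMatrix (Θ : ι ⊕ ι → ι ⊕ ι → ℝ) :
    ∑ b, ∑ c, Θ b c * liftMatrix ι b c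
      = ∑ i, (Θ (.inl i) (.inr i) - Θ (.inr i) (.inl i)) := by
  rw [Finset.sum_sub_distrib]
  simp [Fintype.sum_sum_type, liftMatrix, Matrix.one_apply, sub_eq_add_neg]

/-- The trace of the Bismut connection form against `J₁` vanishes on horizontal vectors, and on the
vertical lift of `F c` it is a multiple of the sum which encodes `tr γ`. -/
theorem sum_liftBismutCoeff {m : ι → ι → ι → ℝ}
    (hm : ∀ c, ∑ a, (m c a a - m a c a - m a a c) = 0) (a : ι ⊕ ι) :
    ∑ b, ∑ c, liftBismutCoeff m a b c * liftMatrix ι b c = 0 := by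
  rw [sum_mul_liftMatrix]
  rcases a with k | k
  · refine Finset.sum_eq_zero fun i _ => ?_
    simp [liftBismutCoeff, liftDFundCoeff, liftLCCoeff, liftBracketCoeff, liftSign]
  · have h := congrArg (2 * ·) (hm k)
    simp only [Finset.mul_sum, mul_zero] at h
    rw [← h]
    refine Finset.sum_congr rfl fun i _ => ?_
    simp [liftBismutCoeff, liftDFundCoeff, liftLCCoeff, liftBracketCoeff, liftSign]
    ring

/-- The trace of the Chern connection form against `J₁` vanishes on horizontal vectors, and on the
vertical lift of `F c` it is a multiple of the sum which encodes `tr γ*`. -/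
theorem sum_liftChernCoeff {m : ι → ι → ι → ℝ} (hm : ∀ c, ∑ a, m c a a = 0) (a : ι ⊕ ι) :
    ∑ b, ∑ c, liftChernCoeff m a b c * liftMatrix ι b c = 0 := by
  rw [sum_mul_liftMatrix]
  rcases a with k | k
  · refine Finset.sum_eq_zero fun i _ => ?_
    simp [liftChernCoeff, liftDFundCoeff, liftLCCoeff, liftBracketCoeff, liftSign]
  · have h := congrArg (-2 * ·) (hm k)
    simp only [Finset.mul_sum, mul_zero] at h
    rw [← h]
    refine Finset.sum_congr rfl fun i _ => ?_
    simp [liftChernCoeff, liftDFundCoeff, liftLCCoeff, liftBracketCoeff, liftSign]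
    ring

section Smoothness

variable {E' : Type*} [NormedAddCommGroup E'] [NormedSpace ℝ E']
  {H' : Type*} [TopologicalSpace H'] {I' : ModelWithCorners ℝ E' H'}
  {N : Type*} [TopologicalSpace N] [ChartedSpace H' N] {s : Set N} {m : N → ι → ι → ι → ℝ}

theorem contMDiffOn_liftBracketCoeff
    (hm : ∀ i j k, ContMDiffOn I' 𝓘(ℝ, ℝ) ∞ (fun q => m q i j k) s) (a b c : ι ⊕ ι) :
    ContMDiffOn I' 𝓘(ℝ, ℝ) ∞ (fun q => liftBracketCoeff (m q) a b c) s := by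
  rcases a with i | i <;> rcases b with j | j <;> rcases c with k | k <;>
    simp only [liftBracketCoeff]
  all_goals first | exact contMDiffOn_const | exact hm _ _ _ | exact (hm _ _ _).neg |
    exact (hm _ _ _).sub (hm _ _ _)

theorem contMDiffOn_liftLCCoeff
    (hm : ∀ i j k, ContMDiffOn I' 𝓘(ℝ, ℝ) ∞ (fun q => m q i j k) s) (a b c : ι ⊕ ι) :
    ContMDiffOn I' 𝓘(ℝ, ℝ) ∞ (fun q => liftLCCoeff (m q) a b c) s :=
  have h := contMDiffOn_liftBracketCoeff hm
  contMDiffOn_const.mul (((h a b c).sub (h a c b)).sub (h b c a))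

theorem contMDiffOn_liftDFundCoeff
    (hm : ∀ i j k, ContMDiffOn I' 𝓘(ℝ, ℝ) ∞ (fun q => m q i j k) s) (a b c : ι ⊕ ι) :
    ContMDiffOn I' 𝓘(ℝ, ℝ) ∞ (fun q => liftDFundCoeff (m q) a b c) s :=
  have h := contMDiffOn_liftBracketCoeff hm
  ((contMDiffOn_const.mul (h a b c.swap)).sub (contMDiffOn_const.mul (h a c b.swap))).add
    (contMDiffOn_const.mul (h b c a.swap))

theorem contMDiffOn_liftBismutCoeff
    (hm : ∀ i j k, ContMDiffOn I' 𝓘(ℝ, ℝ) ∞ (fun q => m q i j k) s) (a b c : ι ⊕ ι) :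
    ContMDiffOn I' 𝓘(ℝ, ℝ) ∞ (fun q => liftBismutCoeff (m q) a b c) s :=
  (contMDiffOn_liftLCCoeff hm a b c).add (contMDiffOn_const.mul (contMDiffOn_const.mul
    (contMDiffOn_liftDFundCoeff hm a.swap b.swap c.swap)))

theorem contMDiffOn_liftChernCoeff
    (hm : ∀ i j k, ContMDiffOn I' 𝓘(ℝ, ℝ) ∞ (fun q => m q i j k) s) (a b c : ι ⊕ ι) :
    ContMDiffOn I' 𝓘(ℝ, ℝ) ∞ (fun q => liftChernCoeff (m q) a b c) s :=
  (contMDiffOn_liftLCCoeff hm a b c).add (contMDiffOn_const.mul (contMDiffOn_const.mul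
    (contMDiffOn_liftDFundCoeff hm a.swap b c)))

end Smoothness

variable [T2Space M]
  {g : ContMDiffRiemannianMetric 𝓘(ℝ, E) ∞ E (TangentSpace 𝓘(ℝ, E) : M → Type _)}
  {U V : VField 𝓘(ℝ, E).tangent (TangentBundle 𝓘(ℝ, E) M)}

theorem ricciForm_bismut_eq_zero
    (hsmooth : CovariantDerivative.ContMDiffCovariantDerivative nab ∞) (htorsion : nab.torsion = 0)
    (hflat : IsFlat nab)
    (htr : metricTrace g.toRiemannianMetric (gam nab g.toRiemannianMetric) = 0)
    (hU : IsSmoothField U) (hV : IsSmoothField V) :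
    ricciForm (g1 nab g.toRiemannianMetric) (J1 nab)
      (bismut (g1 nab g.toRiemannianMetric) (J1 nab)) U V = 0 := by
  funext q
  obtain ⟨u, hq, F, hFs, hF⟩ := exists_isOrthonormalFrameOn g q.1
  have hm := contMDiffOn_connCoeff hsmooth hF hFs
  have hF' := isOrthonormalFrameOn_liftFrame hF hFs hm
  have hnab := (hasConnCoeffs_bismut hF' (fun p hp => preservesDiffAt_J1 hF' hp)
    (isSkew_J1 nab g.toRiemannianMetric)).congr fun p hp a b c => bismutForm_liftFrame hF' hp
      (inner_bracket_liftFrame hsmooth htorsion hflat hF hFs hp) a b c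
  exact ricciForm_eq_zero hF' hnab
    (contMDiffOn_liftBismutCoeff fun i j k => contMDiffOn_comp_proj (hm i j k)) (liftMatrix _)
    (fun p hp b c => inner_J1_liftFrame hF' hp b c) (fun _ _ a => commute_liftBismutCoeff _ a)
    (fun p hp a => sum_liftBismutCoeff
      (fun c => sum_connCoeff_of_metricTrace_gam htorsion hF htr hp c) a)
    hU.contMDiffOn hV.contMDiffOn (x := q) hq

theorem ricciForm_chern_eq_zero
    (hsmooth : CovariantDerivative.ContMDiffCovariantDerivative nab ∞) (htorsion : nab.torsion = 0)
    (hflat : IsFlat nab)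
    (htr : metricTrace g.toRiemannianMetric (gamStar nab g.toRiemannianMetric) = 0)
    (hU : IsSmoothField U) (hV : IsSmoothField V) :
    ricciForm (g1 nab g.toRiemannianMetric) (J1 nab)
      (chern (g1 nab g.toRiemannianMetric) (J1 nab)) U V = 0 := by
  funext q
  obtain ⟨u, hq, F, hFs, hF⟩ := exists_isOrthonormalFrameOn g q.1
  have hm := contMDiffOn_connCoeff hsmooth hF hFs
  have hF' := isOrthonormalFrameOn_liftFrame hF hFs hm
  have hnab := (hasConnCoeffs_chern hF' (fun p hp => preservesDiffAt_J1 hF' hp)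
    (isSkew_J1 nab g.toRiemannianMetric)).congr fun p hp a b c => chernForm_liftFrame hF' hp
      (inner_bracket_liftFrame hsmooth htorsion hflat hF hFs hp) a b c
  exact ricciForm_eq_zero hF' hnab
    (contMDiffOn_liftChernCoeff fun i j k => contMDiffOn_comp_proj (hm i j k)) (liftMatrix _)
    (fun p hp b c => inner_J1_liftFrame hF' hp b c) (fun _ _ a => commute_liftChernCoeff _ a)
    (fun p hp a => sum_liftChernCoeff
      (fun c => sum_connCoeff_of_metricTrace_gamStar htorsion hF htr hp c) a)
    hU.contMDiffOn hV.contMDiffOn (x := q) hq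

end RicciForms

end AffineRiemann

end

theorem mainTheorem6 {E : Type*} [NormedAddCommGroup E] [NormedSpace ℝ E] [FiniteDimensional ℝ E]
    {M : Type*} [TopologicalSpace M] [T2Space M] [SecondCountableTopology M] [ChartedSpace E M]
    [IsManifold 𝓘(ℝ, E) ∞ M]
    (nab : CovariantDerivative 𝓘(ℝ, E) E (TangentSpace 𝓘(ℝ, E) : M → Type _))
    (hsmooth : CovariantDerivative.ContMDiffCovariantDerivative nab ∞)
    (htorsion : nab.torsion = 0) (hflat : AffineRiemann.IsFlat nab)
    (g : ContMDiffRiemannianMetric 𝓘(ℝ, E) ∞ E (TangentSpace 𝓘(ℝ, E) : M → Type _)) :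
    (AffineRiemann.metricTrace g.toRiemannianMetric
          (AffineRiemann.gam nab g.toRiemannianMetric) = 0 →
      (∀ X : AffineRiemann.VField 𝓘(ℝ, E) M, AffineRiemann.IsSmoothField X →
        AffineRiemann.metricTrace g.toRiemannianMetric
          (AffineRiemann.covDeriv g.toRiemannianMetric X
            (AffineRiemann.gam nab g.toRiemannianMetric)) = 0) ∧
      (∀ U V : AffineRiemann.VField 𝓘(ℝ, E).tangent (TangentBundle 𝓘(ℝ, E) M),
        AffineRiemann.IsSmoothField U → AffineRiemann.IsSmoothField V →
        AffineRiemann.ricciForm (AffineRiemann.g1 nab g.toRiemannianMetric)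
          (AffineRiemann.J1 nab)
          (AffineRiemann.bismut (AffineRiemann.g1 nab g.toRiemannianMetric)
            (AffineRiemann.J1 nab)) U V = 0)) ∧
    (AffineRiemann.metricTrace g.toRiemannianMetric
          (AffineRiemann.gamStar nab g.toRiemannianMetric) = 0 →
      (∀ X : AffineRiemann.VField 𝓘(ℝ, E) M, AffineRiemann.IsSmoothField X →
        AffineRiemann.metricTrace g.toRiemannianMetric
          (AffineRiemann.covDeriv g.toRiemannianMetric X
            (AffineRiemann.gamStar nab g.toRiemannianMetric)) = 0) ∧
      (∀ U V : AffineRiemann.VField 𝓘(ℝ, E).tangent (TangentBundle 𝓘(ℝ, E) M),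
        AffineRiemann.IsSmoothField U → AffineRiemann.IsSmoothField V →
        AffineRiemann.ricciForm (AffineRiemann.g1 nab g.toRiemannianMetric)
          (AffineRiemann.J1 nab)
          (AffineRiemann.chern (AffineRiemann.g1 nab g.toRiemannianMetric)
            (AffineRiemann.J1 nab)) U V = 0)) :=
  ⟨fun htr => ⟨fun _ hX => AffineRiemann.metricTrace_covDeriv_gam hsmooth htorsion g htr hX,
    fun _ _ hU hV => AffineRiemann.ricciForm_bismut_eq_zero hsmooth htorsion hflat htr hU hV⟩,
  fun htr => ⟨fun _ hX => AffineRiemann.metricTrace_covDeriv_gamStar hsmooth htorsion g htr hX,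
    fun _ _ hU hV => AffineRiemann.ricciForm_chern_eq_zero hsmooth htorsion hflat htr hU hV⟩⟩
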